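/- Let $r\ge 3$ be an integer. For an integer $N\ge 1$ put $h=1/N$, $x_j=jh$, and let $S_h$ be the space of $1$-periodic functions of class $C^{r-2}$ on $\mathbb R$ whose restriction to each $[x_{i-1},x_i]$, $1\le i\le N$, is a polynomial of degree at most $r-1$. Write $(\cdot,\cdot)$ and $\|\cdot\|$ for the inner product and norm of $L^2(0,1)$ and $A(f,g)=(f,g)+(f',g')$. Let $B_r$ be the cardinal B-spline of order $r$ with knots $0,1,\dots,r$. A *Thomée–Wendroff kernel* of order $r$ is a finite sum $\psi=\sum_{k\in\mathbb Z}c_kB_r(\cdot-k)$ with real $c_k$ such that $\int_{\mathbb R}\psi=1$, $\int_{\mathbb R}x^m\psi(x)\,dx=0$ for $1\le m\le 2r-1$, and $\sum_kc_ke^{ik\theta}\ne 0$ for all real $\theta$. Its quasi-interpolant is $Q_hv=\sum_{j=1}^Nv(x_j)\phi_j$ with $\phi_j(x)=\sum_{l\in\mathbb Z}\psi\bigl((x-x_j-l)/h\bigr)$. Given $T>0$, a function $u(x,t)$ on $\mathbb R\times[0,T]$, $1$-periodic in $x$, and $w_0\in S_h$, the standard Galerkin semidiscretization with initial value $w_0$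 asks for a differentiable map $u_h:[0,T]\to S_h$ with $u_h(0)=w_0$ and, for all $\phi\in S_h$ and $0\le t\le T$, $$(u_{ht},\phi)+(u_{htx},\phi')+3(u_hu_{hx},\phi)+\tfrac12(u_{hx}^2,\phi')+(u_hu_{hxx},\phi')=0 .$$ Then Thomée–Wendroff kernels of order $r$ exist, and there is an integer $M$, depending only on $r$, such that the following holds for every $T>0$ and every $u$ of class $C^M$ on $\mathbb R\times[0,T]$ that is $1$-periodic in $x$ and solves the reduced Camassa–Holm equation $$u_t-u_{txx}+3uu_x=2u_xu_{xx}+uu_{xxx},\qquad u(\cdot,0)=u_0 .$$ (a) For every Thomée–Wendroff kernel of order $r$, with quasi-interpolant $Q_h$, there are $h_0>0$ and $C$, independent of $h$, such that for all $h=1/N\le h_0$ the semidiscretization with $u_h(0)=Q_hu_0$ has a unique solution on $[0,T]$, and $$\max_{0\le t\le T}\|u(\cdot,t)-u_h(t)\|\le Ch^r .$$ (b) There are $h_0>0$ and $C$, independent of $h$, such that for all $h=1/N\le h_0$ there is a unique $v_h\in S_h$ with $A(v_h,\phi)=A(u_0,\phi)$ for all $\phi\in S_h$, the semidiscretization with $u_h(0)=v_h$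 has a unique solution on $[0,T]$, and it satisfies the same estimate $\max_{0\le t\le T}\|u(\cdot,t)-u_h(t)\|\le Ch^r$. -/

import Mathlib

noncomputable section

/-! ### Smooth periodic splines on a uniform mesh -/

/-- The space of smooth `1`-periodic splines of order `r` (degree at most `r - 1`) on the uniform
mesh `x_i = i h`, `h = 1 / N`: periodic functions of class `C^(r-2)` that are polynomials of degree
at most `r - 1` on every mesh interval. Periodic functions are taken on the whole real line. -/
def periodicSplines (r N : ℕ) : Set (ℝ → ℝ) :=
  {φ | Function.Periodic φ 1 ∧ ContDiff ℝ (r - 2 : ℕ) φ ∧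
    ∀ i : ℕ, i < N → ∃ p : Polynomial ℝ, p.natDegree ≤ r - 1 ∧
      ∀ x ∈ Set.Icc ((i : ℝ) / N) (((i : ℝ) + 1) / N), φ x = p.eval x}

/-! ### The Thomée–Wendroff quasi-interpolant -/

/-- The cardinal B-spline of degree `n` (order `n + 1`), with knots `0, 1, …, n + 1`, obtained by
repeated convolution with the indicator function of `[0, 1)`. -/
def cardinalBSpline : ℕ → ℝ → ℝ
  | 0 => Set.indicator (Set.Ico 0 1) (fun _ => 1)
  | n + 1 => fun x => ∫ t in (x - 1)..x, cardinalBSpline n t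

/-- The compactly supported cardinal spline of order `r` with B-spline coefficients `c`. -/
def cardinalSpline (r : ℕ) (c : ℤ →₀ ℝ) (x : ℝ) : ℝ :=
  c.sum fun k a => a * cardinalBSpline (r - 1) (x - k)

/-- `c` is the coefficient sequence of a Thomée–Wendroff kernel `ψ = ∑ k, c k * B_r (· - k)` of
order `r`. The moment conditions say that the Fourier transform of `ψ` is `1 + O(ξ ^ (2 r))` at
the origin; the symbol condition says that the integer translates of `ψ` are stable, so that the
scaled and periodized translates form a uniformly well-conditioned basis of the periodic splines. -/
structure IsThomeeWendroff (r : ℕ) (c : ℤ →₀ ℝ) : Prop where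
  moments : ∀ m : ℕ, m < 2 * r → ∫ x : ℝ, x ^ m * cardinalSpline r c x = if m = 0 then 1 else 0
  symbol_ne_zero : ∀ θ : ℝ, (c.sum fun k a => (a : ℂ) * Complex.exp (k * θ * Complex.I)) ≠ 0

/-- The basis function `φ_j`: the kernel, scaled by `h = 1 / N`, translated to `x_j = j h` and made
`1`-periodic. For `N ≥ 1` the sum over `l` has finitely many nonzero terms. -/
def quasiBasis (r : ℕ) (c : ℤ →₀ ℝ) (N j : ℕ) (x : ℝ) : ℝ :=
  ∑ᶠ l : ℤ, cardinalSpline r c (N * (x - l) - j)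

/-- The quasi-interpolant `Q_h v = ∑ j, v (x_j) φ_j`, where `j = 1, …, N`. -/
def quasiInterpolant (r : ℕ) (c : ℤ →₀ ℝ) (N : ℕ) (v : ℝ → ℝ) (x : ℝ) : ℝ :=
  ∑ j ∈ Finset.Icc 1 N, v ((j : ℝ) / N) * quasiBasis r c N j x

/-! ### Inner products, norms, the projection -/

/-- The inner product of `L²(0,1)`. -/
def l2Inner (f g : ℝ → ℝ) : ℝ := ∫ x in (0 : ℝ)..1, f x * g x

/-- The norm of `L²(0,1)`. -/
def l2Norm (f : ℝ → ℝ) : ℝ := Real.sqrt (l2Inner f f)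

/-- The inner product of `H¹(0,1)`. -/
def h1Inner (f g : ℝ → ℝ) : ℝ := l2Inner f g + l2Inner (deriv f) (deriv g)

/-- `v` is the `H¹` (elliptic) projection of `f` onto the periodic splines. -/
def IsH1Projection (r N : ℕ) (f v : ℝ → ℝ) : Prop :=
  v ∈ periodicSplines r N ∧ ∀ φ ∈ periodicSplines r N, h1Inner v φ = h1Inner f φ

/-! ### The periodic problem and its semidiscretization -/

/-- The time derivative on `[0, T]` (one-sided at the end points) of `u`, `u t x` being the value
at time `t` and position `x`. -/
def timeDeriv (T : ℝ) (u : ℝ → ℝ → ℝ) (t x : ℝ) : ℝ :=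
  derivWithin (fun s => u s x) (Set.Icc 0 T) t

/-- `u` is a solution, of class `C^M` on `[0, T] × ℝ` and `1`-periodic in `x`, of the reduced
Camassa–Holm equation `u_t - u_txx + 3 u u_x = 2 u_x u_xx + u u_xxx`. -/
structure IsPeriodicRCHSolution (M : ℕ) (T : ℝ) (u : ℝ → ℝ → ℝ) : Prop where
  smooth : ContDiffOn ℝ M (Function.uncurry u) (Set.Icc 0 T ×ˢ Set.univ)
  periodic : ∀ t ∈ Set.Icc 0 T, Function.Periodic (u t) 1
  equation : ∀ t ∈ Set.Icc 0 T, ∀ x : ℝ,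
    timeDeriv T u t x - iteratedDeriv 2 (timeDeriv T u t) x + 3 * u t x * deriv (u t) x
      = 2 * deriv (u t) x * iteratedDeriv 2 (u t) x + u t x * iteratedDeriv 3 (u t) x

/-- `w : [0, T] → S_h` solves the standard Galerkin semidiscretization with initial value `w₀`.
As `S_h` is finite dimensional, differentiability in `t` may be stated pointwise in `x`. -/
structure IsGalerkinSolution (r N : ℕ) (T : ℝ) (w₀ : ℝ → ℝ) (w : ℝ → ℝ → ℝ) : Prop where
  mem : ∀ t ∈ Set.Icc 0 T, w t ∈ periodicSplines r N
  differentiable : ∀ x : ℝ, DifferentiableOn ℝ (fun t => w t x) (Set.Icc 0 T)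
  equation : ∀ t ∈ Set.Icc 0 T, ∀ φ ∈ periodicSplines r N,
    l2Inner (timeDeriv T w t) φ + l2Inner (deriv (timeDeriv T w t)) (deriv φ)
      + 3 * l2Inner (fun x => w t x * deriv (w t) x) φ
      + 1 / 2 * l2Inner (fun x => deriv (w t) x ^ 2) (deriv φ)
      + l2Inner (fun x => w t x * iteratedDeriv 2 (w t) x) (deriv φ) = 0
  initial : w 0 = w₀

/-- The semidiscrete problem with initial value `w₀` has a unique solution on `[0, T]`, and the
maximum over `[0, T]` of its `L²` distance to `u` is at most `ε`. -/
def UniquelySolvableWithError (r N : ℕ) (T : ℝ) (u : ℝ → ℝ → ℝ) (w₀ : ℝ → ℝ) (ε : ℝ) : Prop :=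
  ∃ w : ℝ → ℝ → ℝ, IsGalerkinSolution r N T w₀ w ∧
    (∀ w', IsGalerkinSolution r N T w₀ w' → ∀ t ∈ Set.Icc 0 T, w' t = w t) ∧
    ∀ t ∈ Set.Icc 0 T, l2Norm (fun x => u t x - w t x) ≤ ε

end

/-! The semidiscrete solution is compared in H¹ with the quasi-interpolant U = Q_h u(t). Splines
approximate in H¹ only to order h^(r-1), so an O(h^r) comparison needs a stability argument that
loses nothing and a consistency argument that gains one order.

Stability. With the trilinear form b = `chForm` the scheme reads A(u_ht, φ) + b(u_h, u_h, φ) = 0.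
Integration by parts gives b(w, w, w) = 0 (`chForm_self`). Hence the H¹ energy is conserved, and the
scheme, a quadratic differential equation in a finite-dimensional space, is globally and uniquely
solvable (`exists_galerkin_curve`). For θ = u_h - U the cubic term b(θ, θ, θ) drops out too; what
remains is at most a multiple of ‖θ‖² in H¹, with a constant that depends only on bounds for U, U',
U'' (`abs_chForm_sub_le`). No inverse inequality and no a priori bound on u_h is needed before
Gronwall's inequality.

Consistency. After integration by parts the critical parts of the truncation error are the pairings
of U_t - u_t and of u (U - u)' with φ'', for a spline φ (`abs_h1Inner_sub_le`,
`abs_chForm_sub_le_of_perturbation`). Taylor expansion at x writes Q_h v - v as a sum of terms h^k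
v^(k)(x) p_k(Nx) / k!, where p_k is the periodized k-th moment of the kernel
(`exists_quasiOp_taylor`). Polynomial reproduction removes the orders 1 to r - 1. The next p_k
oscillate with the mesh frequency and have mean zero, because the moments of the kernel vanish. On
the other side φ'' is N² times a combination of translates of a differenced B-spline, with
coefficients controlled by φ' / N (`exists_deriv_two_coeff`). A smooth function times a mean-zero
oscillation, paired with a differenced B-spline, gains two powers of h (`exists_oscillatory_bound`).
This balances N² and yields O(h^r) ‖φ'‖ (`exists_superconvergence`, `exists_superconvergence_deriv`,
collected in `exists_isOptimalApprox`).

So u_h - Q_h u is O(h^r) in H¹ as soon as it is so initially, and the L² estimate follows from the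
uniform O(h^r) bound for u - Q_h u. For the elliptic projection the initial difference is O(h^r) by
the same superconvergence (`exists_h1Projection`). Kernels are built by multiplying polynomials that
correct one moment at a time without creating zeros on the unit circle (`exists_poly_moments`). No
smallness of h is used, so h₀ = 1 serves. -/

section

open MeasureTheory Set Filter Topology
open scoped NNReal

/-! ### Bounded measurable functions -/

/-- Bounded measurable real functions. -/
structure IsBddMeas (f : ℝ → ℝ) : Prop where
  measurable : Measurable f
  bdd : ∃ K : ℝ, ∀ x, |f x| ≤ K

namespace IsBddMeas

variable {f g : ℝ → ℝ}

theorem exists_pos (hf : IsBddMeas f) : ∃ K : ℝ, 0 < K ∧ ∀ x, |f x| ≤ K := by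
  obtain ⟨K, hK⟩ := hf.bdd
  exact ⟨max K 1, by positivity, fun x => (hK x).trans (le_max_left _ _)⟩

theorem const (c : ℝ) : IsBddMeas fun _ => c := ⟨measurable_const, |c|, fun _ => le_rfl⟩

theorem add (hf : IsBddMeas f) (hg : IsBddMeas g) : IsBddMeas fun x => f x + g x := by
  obtain ⟨K, hK⟩ := hf.bdd
  obtain ⟨L, hL⟩ := hg.bdd
  exact ⟨hf.1.add hg.1, K + L, fun x => (abs_add_le _ _).trans (add_le_add (hK x) (hL x))⟩

theorem mul (hf : IsBddMeas f) (hg : IsBddMeas g) : IsBddMeas fun x => f x * g x := by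
  obtain ⟨K, hK0, hK⟩ := hf.exists_pos
  obtain ⟨L, hL0, hL⟩ := hg.exists_pos
  refine ⟨hf.1.mul hg.1, K * L, fun x => ?_⟩
  rw [abs_mul]
  exact mul_le_mul (hK x) (hL x) (abs_nonneg _) hK0.le

theorem const_mul (c : ℝ) (hf : IsBddMeas f) : IsBddMeas fun x => c * f x := (const c).mul hf

theorem neg (hf : IsBddMeas f) : IsBddMeas fun x => -f x := by
  simpa using hf.const_mul (-1)

theorem sub (hf : IsBddMeas f) (hg : IsBddMeas g) : IsBddMeas fun x => f x - g x := by
  simpa [sub_eq_add_neg] using hf.add hg.neg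

theorem pow (hf : IsBddMeas f) (n : ℕ) : IsBddMeas fun x => f x ^ n := by
  induction n with
  | zero => simpa using const 1
  | succ n ih => simpa [pow_succ] using ih.mul hf

theorem abs (hf : IsBddMeas f) : IsBddMeas fun x => |f x| := by
  obtain ⟨K, hK⟩ := hf.bdd
  refine ⟨?_, K, fun x => by simpa using hK x⟩
  simpa [Real.norm_eq_abs] using hf.1.norm

theorem comp (hf : IsBddMeas f) {g : ℝ → ℝ} (hg : Measurable g) : IsBddMeas fun x => f (g x) := by
  obtain ⟨K, hK⟩ := hf.bdd
  exact ⟨hf.1.comp hg, K, fun x => hK _⟩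

theorem intervalIntegrable (hf : IsBddMeas f) (a b : ℝ) : IntervalIntegrable f volume a b := by
  obtain ⟨K, hK⟩ := hf.bdd
  refine (intervalIntegrable_const (c := K)).mono_fun' hf.1.aestronglyMeasurable ?_
  exact Eventually.of_forall fun x => hK x

theorem integrable_mul (hf : IsBddMeas f) (hg : Integrable g) : Integrable fun x => f x * g x := by
  obtain ⟨K, hK⟩ := hf.bdd
  exact hg.bdd_mul hf.1.aestronglyMeasurable (Eventually.of_forall hK)

end IsBddMeas

/-! ### Compactly supported kernels -/

/-- Bounded measurable functions of bounded support. -/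
structure IsKernel (κ : ℝ → ℝ) : Prop extends IsBddMeas κ where
  supp : ∃ L : ℕ, ∀ x : ℝ, (L : ℝ) < |x| → κ x = 0

namespace IsKernel

variable {κ μ : ℝ → ℝ}

theorem add (hκ : IsKernel κ) (hμ : IsKernel μ) : IsKernel fun x => κ x + μ x := by
  obtain ⟨K, hK⟩ := hκ.supp
  obtain ⟨L, hL⟩ := hμ.supp
  refine ⟨hκ.1.add hμ.1, max K L, fun x hx => ?_⟩
  push_cast at hx
  rw [hK x ((le_max_left _ _).trans_lt hx), hL x ((le_max_right _ _).trans_lt hx), add_zero]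

theorem mul_left {f : ℝ → ℝ} (hf : ∀ L : ℕ, ∃ K : ℝ, ∀ x : ℝ, |x| ≤ L → |f x| ≤ K)
    (hfm : Measurable f) (hκ : IsKernel κ) : IsKernel fun x => f x * κ x := by
  obtain ⟨L, hL⟩ := hκ.supp
  obtain ⟨K, hK⟩ := hf L
  obtain ⟨M, hM0, hM⟩ := hκ.1.exists_pos
  refine ⟨⟨hfm.mul hκ.1.1, |K| * M, fun x => ?_⟩, L, fun x hx => by rw [hL x hx, mul_zero]⟩
  rcases le_or_gt |x| L with h | h
  · rw [abs_mul]
    exact mul_le_mul ((hK x h).trans (le_abs_self _)) (hM x) (abs_nonneg _) (abs_nonneg _)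
  · rw [hL x h, mul_zero, abs_zero]; positivity

theorem bddMeas_mul {f : ℝ → ℝ} (hf : IsBddMeas f) (hκ : IsKernel κ) :
    IsKernel fun x => f x * κ x := by
  obtain ⟨K, hK⟩ := hf.bdd
  exact hκ.mul_left (fun _ => ⟨K, fun x _ => hK x⟩) hf.1

theorem const_mul (c : ℝ) (hκ : IsKernel κ) : IsKernel fun x => c * κ x :=
  bddMeas_mul (IsBddMeas.const c) hκ

theorem neg (hκ : IsKernel κ) : IsKernel fun x => -κ x := by
  simpa using hκ.const_mul (-1)

theorem sub (hκ : IsKernel κ) (hμ : IsKernel μ) : IsKernel fun x => κ x - μ x := by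
  simpa [sub_eq_add_neg] using hκ.add hμ.neg

theorem pow_mul (m : ℕ) (hκ : IsKernel κ) : IsKernel fun x => x ^ m * κ x := by
  refine hκ.mul_left (fun L => ⟨(L : ℝ) ^ m, fun x hx => ?_⟩) (by fun_prop)
  rw [abs_pow]
  exact pow_le_pow_left₀ (abs_nonneg _) hx m

theorem neg_pow_mul (m : ℕ) (hκ : IsKernel κ) : IsKernel fun x => (-x) ^ m * κ x := by
  have := (hκ.pow_mul m).const_mul ((-1) ^ m)
  refine (funext fun x => ?_ : (fun x => (-x) ^ m * κ x) = fun x => (-1) ^ m * (x ^ m * κ x)) ▸ this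
  rw [neg_pow, mul_assoc]

theorem shift (hκ : IsKernel κ) (c : ℝ) : IsKernel fun x => κ (x - c) := by
  obtain ⟨L, hL⟩ := hκ.supp
  obtain ⟨K, hK⟩ := exists_nat_ge |c|
  refine ⟨hκ.1.comp (by fun_prop), L + K, fun x hx => hL _ ?_⟩
  push_cast at hx
  have := abs_sub_abs_le_abs_sub x c
  linarith

theorem integrable (hκ : IsKernel κ) : Integrable κ := by
  obtain ⟨L, hL⟩ := hκ.supp
  have h : IntegrableOn κ (Icc (-(L : ℝ)) L) := by
    have := hκ.1.intervalIntegrable (-(L : ℝ)) L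
    rwa [intervalIntegrable_iff_integrableOn_Icc_of_le (by linarith [(Nat.cast_nonneg L : (0:ℝ) ≤ L)])] at this
  rw [← integrableOn_univ]
  refine h.of_forall_sdiff_eq_zero MeasurableSet.univ fun x hx => hL x ?_
  by_contra hc
  exact hx.2 (abs_le.1 (not_lt.1 hc))

theorem sum {ι : Type*} (s : Finset ι) {κ : ι → ℝ → ℝ} (h : ∀ i ∈ s, IsKernel (κ i)) :
    IsKernel fun x => ∑ i ∈ s, κ i x := by
  classical
  induction s using Finset.induction_on with
  | empty => exact ⟨by simpa using IsBddMeas.const 0, 0, by simp⟩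
  | insert a s ha ih =>
    simp only [Finset.sum_insert ha]
    exact (h a (by simp)).add (ih fun i hi => h i (by simp [hi]))

theorem integral_eq_interval (hκ : IsKernel κ) : ∃ L₀ : ℕ, ∀ L : ℕ, L₀ ≤ L →
    ∫ x, κ x = ∫ x in (-(L : ℝ))..L, κ x := by
  obtain ⟨L, hL⟩ := hκ.supp
  refine ⟨L + 1, fun M hM => ?_⟩
  symm
  apply intervalIntegral.integral_eq_integral_of_support_subset
  intro x hx
  have h1 : |x| ≤ L := not_lt.1 fun h => hx (hL x h)
  have h2 : (L : ℝ) + 1 ≤ M := by exact_mod_cast hM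
  have := abs_le.1 h1
  constructor <;> linarith

end IsKernel

/-! ### Sums of integer translates of a kernel -/

/-- The sum `∑ i, a i * κ (y - i)` over all integers. -/
noncomputable def shiftSum (κ : ℝ → ℝ) (a : ℤ → ℝ) (y : ℝ) : ℝ := ∑ᶠ i : ℤ, a i * κ (y - i)

section shiftSum

variable {κ μ : ℝ → ℝ} {a b : ℤ → ℝ}

theorem shiftSum_eq_sum_of_supp {L : ℕ} (hL : ∀ x : ℝ, (L : ℝ) < |x| → κ x = 0) {s : Finset ℤ}
    {y : ℝ} (hs : ∀ i : ℤ, |y - i| ≤ L → i ∈ s) : shiftSum κ a y = ∑ i ∈ s, a i * κ (y - i) := by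
  refine finsum_eq_sum_of_support_subset _ fun i hi => ?_
  refine hs i (not_lt.1 fun h => hi ?_)
  simp [hL _ h]

theorem mem_window {L R : ℕ} {k i : ℤ} {y : ℝ} (hy : |y - k| ≤ R) (hi : |y - i| ≤ L) :
    i ∈ Finset.Icc (k - (L + R : ℕ)) (k + (L + R : ℕ)) := by
  rw [abs_le] at hy hi
  rw [Finset.mem_Icc]
  constructor
  · have : ((k - (L + R : ℕ) : ℤ) : ℝ) ≤ i := by push_cast; linarith
    exact_mod_cast this
  · have : (i : ℝ) ≤ ((k + (L + R : ℕ) : ℤ) : ℝ) := by push_cast; linarith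
    exact_mod_cast this

/-- Near an integer `k` the sum over all integers is a fixed finite sum. -/
theorem shiftSum_eq_window {L R : ℕ} (hL : ∀ x : ℝ, (L : ℝ) < |x| → κ x = 0) {k : ℤ} {y : ℝ}
    (hy : |y - k| ≤ R) :
    shiftSum κ a y = ∑ i ∈ Finset.Icc (k - (L + R : ℕ)) (k + (L + R : ℕ)), a i * κ (y - i) :=
  shiftSum_eq_sum_of_supp hL fun _ hi => mem_window hy hi

theorem abs_sub_floor_le (y : ℝ) {R : ℕ} (hR : 1 ≤ R) : |y - ⌊y⌋| ≤ R := by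
  have h1 := Int.floor_le y
  have h2 := Int.lt_floor_add_one y
  have : (1 : ℝ) ≤ R := by exact_mod_cast hR
  rw [abs_le]; constructor <;> linarith

theorem eventually_abs_sub_floor_le (y : ℝ) : ∀ᶠ z : ℝ in 𝓝 y, |z - ⌊y⌋| ≤ ((2 : ℕ) : ℝ) := by
  filter_upwards [Metric.ball_mem_nhds y one_pos] with z hz
  have h1 := Int.floor_le y
  have h2 := Int.lt_floor_add_one y
  rw [Metric.mem_ball, Real.dist_eq, abs_lt] at hz
  push_cast
  rw [abs_le]; constructor <;> linarith

/-- Locally near `y` the sum over all integers is a fixed finite sum. -/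
theorem eventually_shiftSum_eq (hκ : IsKernel κ) (y : ℝ) : ∃ s : Finset ℤ, ∀ a : ℤ → ℝ,
    ∀ᶠ z in 𝓝 y, shiftSum κ a z = ∑ i ∈ s, a i * κ (z - i) := by
  obtain ⟨L, hL⟩ := hκ.supp
  refine ⟨Finset.Icc (⌊y⌋ - (L + 2 : ℕ)) (⌊y⌋ + (L + 2 : ℕ)), fun a => ?_⟩
  filter_upwards [eventually_abs_sub_floor_le y] with z hz
  exact shiftSum_eq_window hL hz

theorem exists_common_window (hκ : IsKernel κ) (hμ : IsKernel μ) (R : ℕ) (k : ℤ) :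
    ∃ s : Finset ℤ, ∀ (a : ℤ → ℝ) (y : ℝ), |y - k| ≤ R →
      shiftSum κ a y = ∑ i ∈ s, a i * κ (y - i) ∧ shiftSum μ a y = ∑ i ∈ s, a i * μ (y - i) := by
  obtain ⟨L, hL⟩ := hκ.supp
  obtain ⟨L', hL'⟩ := hμ.supp
  refine ⟨Finset.Icc (k - (max L L' + R : ℕ)) (k + (max L L' + R : ℕ)), fun a y hy => ⟨?_, ?_⟩⟩
  · exact shiftSum_eq_window (fun x hx => hL x (lt_of_le_of_lt (by push_cast; exact le_max_left _ _) hx)) hy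
  · exact shiftSum_eq_window (fun x hx => hL' x (lt_of_le_of_lt (by push_cast; exact le_max_right _ _) hx)) hy

theorem shiftSum_add_coeff (hκ : IsKernel κ) (a b : ℤ → ℝ) (y : ℝ) :
    shiftSum κ (fun i => a i + b i) y = shiftSum κ a y + shiftSum κ b y := by
  obtain ⟨s, hs⟩ := exists_common_window hκ hκ 1 ⌊y⌋
  have hy := abs_sub_floor_le y le_rfl
  rw [(hs _ y hy).1, (hs a y hy).1, (hs b y hy).1, ← Finset.sum_add_distrib]
  simp only [add_mul]

theorem shiftSum_mul_coeff (hκ : IsKernel κ) (c : ℝ) (a : ℤ → ℝ) (y : ℝ) :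
    shiftSum κ (fun i => c * a i) y = c * shiftSum κ a y := by
  obtain ⟨s, hs⟩ := exists_common_window hκ hκ 1 ⌊y⌋
  have hy := abs_sub_floor_le y le_rfl
  rw [(hs _ y hy).1, (hs a y hy).1, Finset.mul_sum]
  simp only [mul_assoc]

theorem shiftSum_sub_coeff (hκ : IsKernel κ) (a b : ℤ → ℝ) (y : ℝ) :
    shiftSum κ (fun i => a i - b i) y = shiftSum κ a y - shiftSum κ b y := by
  have := shiftSum_add_coeff hκ a (fun i => -1 * b i) y
  rw [shiftSum_mul_coeff hκ] at this
  simpa [sub_eq_add_neg] using this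

theorem shiftSum_add_kernel (hκ : IsKernel κ) (hμ : IsKernel μ) (a : ℤ → ℝ) (y : ℝ) :
    shiftSum (fun x => κ x + μ x) a y = shiftSum κ a y + shiftSum μ a y := by
  obtain ⟨L, hL⟩ := hκ.supp
  obtain ⟨L', hL'⟩ := hμ.supp
  have hy := abs_sub_floor_le y le_rfl
  have h1 : ∀ x : ℝ, ((max L L' : ℕ) : ℝ) < |x| → κ x = 0 := fun x hx =>
    hL x (lt_of_le_of_lt (by push_cast; exact le_max_left _ _) hx)
  have h2 : ∀ x : ℝ, ((max L L' : ℕ) : ℝ) < |x| → μ x = 0 := fun x hx =>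
    hL' x (lt_of_le_of_lt (by push_cast; exact le_max_right _ _) hx)
  rw [shiftSum_eq_window h1 hy, shiftSum_eq_window h2 hy,
    shiftSum_eq_window (fun x hx => by rw [h1 x hx, h2 x hx, add_zero]) hy, ← Finset.sum_add_distrib]
  simp only [mul_add]

theorem shiftSum_mul_kernel (hκ : IsKernel κ) (c : ℝ) (a : ℤ → ℝ) (y : ℝ) :
    shiftSum (fun x => c * κ x) a y = c * shiftSum κ a y := by
  rw [← shiftSum_mul_coeff hκ]
  simp only [shiftSum]
  congr 1; ext i; ring

theorem shiftSum_sum_kernel {ι : Type*} (s : Finset ι) {κ : ι → ℝ → ℝ}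
    (h : ∀ i ∈ s, IsKernel (κ i)) (a : ℤ → ℝ) (y : ℝ) :
    shiftSum (fun x => ∑ i ∈ s, κ i x) a y = ∑ i ∈ s, shiftSum (κ i) a y := by
  classical
  induction s using Finset.induction_on with
  | empty => simp [shiftSum]
  | insert j s hj ih =>
    have h' : ∀ i ∈ s, IsKernel (κ i) := fun i hi => h i (by simp [hi])
    simp only [Finset.sum_insert hj]
    rw [shiftSum_add_kernel (h j (by simp)) (IsKernel.sum s h'), ih h']

/-- Shifting the kernel by an integer shifts the coefficients. -/
theorem shiftSum_shift_kernel (k : ℤ) (a : ℤ → ℝ) (y : ℝ) :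
    shiftSum (fun x => κ (x - k)) a y = shiftSum κ (fun i => a (i - k)) y := by
  simp only [shiftSum]
  rw [← finsum_comp_equiv (Equiv.subRight k)]
  refine finsum_congr fun i => ?_
  simp only [Equiv.subRight_apply]
  congr 2; push_cast; ring

theorem shiftSum_add_int (k : ℤ) (a : ℤ → ℝ) (y : ℝ) :
    shiftSum κ a (y + k) = shiftSum κ (fun i => a (i + k)) y := by
  simp only [shiftSum]
  rw [← finsum_comp_equiv (Equiv.addRight k)]
  refine finsum_congr fun i => ?_
  simp only [Equiv.coe_addRight]
  congr 2; push_cast; ring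

theorem shiftSum_periodic {N : ℕ} (ha : Function.Periodic a (N : ℤ)) :
    Function.Periodic (shiftSum κ a) N := by
  intro y
  have := shiftSum_add_int (κ := κ) (N : ℤ) a y
  rw [Int.cast_natCast] at this
  rw [this]
  congr 1; ext i; exact ha i

/-- Numbering the translates relative to ⌊y⌋ leaves one finite sum for all y, whose coefficients
depend on y only through its integer part. -/
theorem measurable_shiftSum (hκ : IsKernel κ) (a : ℤ → ℝ) : Measurable (shiftSum κ a) := by
  obtain ⟨L, hL⟩ := hκ.supp
  have : shiftSum κ a = fun y => ∑ j ∈ Finset.Icc (-(L + 1 : ℕ) : ℤ) (L + 1 : ℕ),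
      a (⌊y⌋ + j) * κ (y - ((⌊y⌋ + j : ℤ) : ℝ)) := by
    ext y
    rw [shiftSum_eq_window hL (abs_sub_floor_le y le_rfl)]
    refine Finset.sum_nbij' (fun i => i - ⌊y⌋) (fun j => ⌊y⌋ + j) ?_ ?_ ?_ ?_ ?_ <;>
      intro i hi <;> simp at hi ⊢ <;> omega
  rw [this]
  refine Finset.measurable_sum _ fun j _ => Measurable.mul ?_ (hκ.1.1.comp ?_)
  · exact (measurable_from_top (f := fun i : ℤ => a (i + j))).comp Int.measurable_floor
  · exact measurable_id.sub ((measurable_from_top (f := fun i : ℤ => ((i + j : ℤ) : ℝ))).comp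
      Int.measurable_floor)

/-- A bounded number of translates meets each point. The bound on the coefficients is asked only of
the translates that are nonzero at y, so that coefficients may be Taylor remainders about y. -/
theorem abs_shiftSum_le (hκ : IsKernel κ) : ∃ C : ℝ, 0 < C ∧ ∀ (a : ℤ → ℝ) (V : ℝ) (y : ℝ),
    0 ≤ V → (∀ i : ℤ, κ (y - i) ≠ 0 → |a i| ≤ V) → |shiftSum κ a y| ≤ C * V := by
  obtain ⟨L, hL⟩ := hκ.supp
  obtain ⟨K, hK0, hK⟩ := hκ.1.exists_pos
  refine ⟨(2 * (L + 1) + 1) * K, by positivity, fun a V y hV ha => ?_⟩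
  rw [shiftSum_eq_window hL (abs_sub_floor_le y le_rfl)]
  have : ∀ i ∈ Finset.Icc (⌊y⌋ - (L + 1 : ℕ)) (⌊y⌋ + (L + 1 : ℕ)), |a i * κ (y - i)| ≤ V * K := by
    intro i _
    by_cases h : κ (y - i) = 0
    · rw [h, mul_zero, abs_zero]; positivity
    · rw [abs_mul]
      exact mul_le_mul (ha i h) (hK _) (abs_nonneg _) hV
  refine (Finset.abs_sum_le_sum_abs _ _).trans ((Finset.sum_le_card_nsmul _ _ _ this).trans ?_)
  rw [Int.card_Icc, nsmul_eq_mul]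
  have : (⌊y⌋ + (L + 1 : ℕ) + 1 - (⌊y⌋ - (L + 1 : ℕ))).toNat = 2 * (L + 1) + 1 := by omega
  rw [this]; push_cast
  exact le_of_eq (by ring)

end shiftSum

/-! ### Periodic sequences -/

theorem Function.Periodic.sum_range_add {N : ℕ} {h : ℤ → ℝ} (hp : Function.Periodic h (N : ℤ)) (m : ℤ) :
    ∑ k ∈ Finset.range N, h (k + m) = ∑ k ∈ Finset.range N, h k := by
  have step : ∀ m : ℤ, ∑ k ∈ Finset.range N, h (k + (m + 1)) = ∑ k ∈ Finset.range N, h (k + m) := by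
    intro m
    have h1 := Finset.sum_range_succ (fun k : ℕ => h (k + m)) N
    rw [Finset.sum_range_succ' (fun k : ℕ => h (k + m)) N] at h1
    have h2 : h ((N : ℤ) + m) = h ((0 : ℕ) + m) := by
      rw [add_comm (N : ℤ) m, hp m]; simp
    rw [h2] at h1
    rw [← add_right_cancel h1]
    refine Finset.sum_congr rfl fun k _ => ?_
    congr 1; push_cast; ring
  induction m using Int.induction_on with
  | zero => simp
  | succ m ih => rw [step, ih]
  | pred m ih => rw [← step, ← ih]; simp

theorem Function.Periodic.abs_le_sum_range {N : ℕ} (hN : 1 ≤ N) {a : ℤ → ℝ}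
    (ha : Function.Periodic a (N : ℤ)) (i : ℤ) : |a i| ≤ ∑ k ∈ Finset.range N, |a k| := by
  have hN' : (N : ℤ) ≠ 0 := by omega
  have h1 : a i = a ((i % N).toNat : ℤ) := by
    rw [Int.toNat_of_nonneg (Int.emod_nonneg _ hN')]
    have := ha.sub_zsmul_eq (i / N) (x := i)
    rw [← this]; congr 1
    rw [Int.emod_def, smul_eq_mul, mul_comm]
  rw [h1]
  refine Finset.single_le_sum (f := fun k : ℕ => |a k|) (fun _ _ => abs_nonneg _) ?_
  rw [Finset.mem_range]
  have := Int.emod_lt_of_pos i (show (0 : ℤ) < N by omega)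
  have := Int.emod_nonneg i hN'
  omega

/-! ### Pairings of periodic functions with sums of translates -/

section

variable {κ κ' : ℝ → ℝ}

theorem IsKernel.bddMeas_shiftSum (hκ : IsKernel κ) {a : ℤ → ℝ} {V : ℝ} (ha : ∀ i, |a i| ≤ V) :
    IsBddMeas (shiftSum κ a) := by
  obtain ⟨C, hC0, hC⟩ := abs_shiftSum_le hκ
  exact ⟨measurable_shiftSum hκ a, C * V, fun y =>
    hC a V y ((abs_nonneg _).trans (ha 0)) fun i _ => ha i⟩

theorem IsKernel.bddMeas_shiftSum_periodic (hκ : IsKernel κ) {N : ℕ} (hN : 1 ≤ N) {a : ℤ → ℝ}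
    (ha : Function.Periodic a (N : ℤ)) : IsBddMeas (shiftSum κ a) :=
  hκ.bddMeas_shiftSum (ha.abs_le_sum_range hN)

/-- On the cell `[k, k + 1]` the sum of translates, with the translates numbered relative to `k`. -/
theorem shiftSum_cell {L : ℕ} (hL : ∀ x : ℝ, (L : ℝ) < |x| → κ x = 0) (a : ℤ → ℝ) (k : ℤ) {s : ℝ}
    (h0 : 0 ≤ s) (h1 : s ≤ 1) : shiftSum κ a (k + s) =
      ∑ j ∈ Finset.range (2 * L + 3), a (k + ((L + 1 : ℕ) - j : ℤ)) * κ (s + (j - (L + 1 : ℕ) : ℤ)) := by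
  rw [shiftSum_eq_window (R := 1) (k := k) hL (by rw [abs_le]; push_cast; constructor <;> linarith)]
  symm
  refine Finset.sum_nbij' (fun j : ℕ => k + ((L + 1 : ℕ) - j : ℤ))
    (fun i => (k + (L + 1 : ℕ) - i).toNat) ?_ ?_ ?_ ?_ ?_
  · intro j hj; simp at hj ⊢; omega
  · intro i hi; simp at hi ⊢; omega
  · intro j hj; simp at hj ⊢
  · intro i hi; simp at hi ⊢; omega
  · intro j hj
    congr 2; push_cast; ring

/-- Integration of a periodic function against a periodic combination of translates. -/
theorem integral_mul_shiftSum (hκ : IsKernel κ) {N : ℕ} (hN : 1 ≤ N) {f : ℝ → ℝ} (hf : IsBddMeas f)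
    (hfp : Function.Periodic f 1) {a : ℤ → ℝ} (ha : Function.Periodic a (N : ℤ)) :
    ∫ x in (0 : ℝ)..1, f x * shiftSum κ a (N * x) =
      1 / N * ∑ i ∈ Finset.range N, a i * ∫ y, f ((i + y) / N) * κ y := by
  obtain ⟨L, hL⟩ := hκ.supp
  have hN0 : (N : ℝ) ≠ 0 := by positivity
  have hS := hκ.bddMeas_shiftSum_periodic hN ha
  have hg : IsBddMeas fun y => f (y / N) * shiftSum κ a y := (hf.comp (by fun_prop)).mul hS
  have e1 : ∫ x in (0 : ℝ)..1, f x * shiftSum κ a (N * x) =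
      1 / N * ∫ y in (0 : ℝ)..N, f (y / N) * shiftSum κ a y := by
    have := intervalIntegral.mul_integral_comp_mul_left (a := 0) (b := 1)
      (f := fun y => f (y / N) * shiftSum κ a y) (N : ℝ)
    rw [mul_zero, mul_one] at this
    rw [← this, ← mul_assoc, one_div_mul_cancel hN0, one_mul]
    simp only [mul_div_cancel_left₀ _ hN0]
  have e2 : ∫ y in (0 : ℝ)..N, f (y / N) * shiftSum κ a y =
      ∑ k ∈ Finset.range N, ∫ y in (k : ℝ)..((k + 1 : ℕ) : ℝ), f (y / N) * shiftSum κ a y := by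
    rw [intervalIntegral.sum_integral_adjacent_intervals (a := fun k : ℕ => (k : ℝ))
      fun k _ => hg.intervalIntegrable _ _]
    simp
  -- The contribution of cell k through the translate with relative index L + 1 - j.
  set h : ℕ → ℤ → ℝ := fun j k => a (k + ((L + 1 : ℕ) - j : ℤ)) *
    ∫ s in (0 : ℝ)..1, f ((k + s) / N) * κ (s + (j - (L + 1 : ℕ) : ℤ)) with hh
  have e3 : ∀ k : ℕ, ∫ y in (k : ℝ)..((k + 1 : ℕ) : ℝ), f (y / N) * shiftSum κ a y =
      ∑ j ∈ Finset.range (2 * L + 3), h j k := by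
    intro k
    have e := intervalIntegral.integral_comp_add_left (a := 0) (b := 1)
      (fun y => f (y / N) * shiftSum κ a y) (k : ℝ)
    rw [add_zero] at e
    rw [Nat.cast_succ, ← e]
    have : ∀ s ∈ uIcc (0 : ℝ) 1, f ((k + s) / N) * shiftSum κ a (k + s) =
        ∑ j ∈ Finset.range (2 * L + 3), a (k + ((L + 1 : ℕ) - j : ℤ)) *
          (f ((k + s) / N) * κ (s + (j - (L + 1 : ℕ) : ℤ))) := by
      intro s hs
      rw [uIcc_of_le zero_le_one] at hs
      have := shiftSum_cell hL a k hs.1 hs.2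
      rw [Int.cast_natCast] at this
      rw [this, Finset.mul_sum]
      refine Finset.sum_congr rfl fun j _ => by ring
    rw [intervalIntegral.integral_congr this, intervalIntegral.integral_finsetSum]
    · simp only [intervalIntegral.integral_const_mul, hh, Int.cast_natCast]
    · intro j _
      exact (((hf.comp (by fun_prop)).mul (hκ.1.comp (by fun_prop))).const_mul _).intervalIntegrable _ _
  -- For fixed j the contribution is N-periodic in k, so the summation index can be shifted until
  -- the coefficient is `a k` itself.
  have e4 : ∀ j, ∑ k ∈ Finset.range N, h j k = ∑ k ∈ Finset.range N, a k *
      ∫ y in ((j : ℝ) - (L + 1))..(((j + 1 : ℕ) : ℝ) - (L + 1)), f ((k + y) / N) * κ y := by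
    intro j
    have hp : Function.Periodic (h j) (N : ℤ) := by
      intro k
      simp only [hh]
      congr 1
      · rw [show k + (N : ℤ) + ((L + 1 : ℕ) - j : ℤ) = k + ((L + 1 : ℕ) - j : ℤ) + N by ring]
        exact ha _
      · refine intervalIntegral.integral_congr fun s _ => ?_
        have : ((k + (N : ℤ) : ℤ) + s) / (N : ℝ) = (k + s) / N + 1 := by
          push_cast; field_simp; ring
        simp only [this, hfp _]
    rw [← hp.sum_range_add (j - (L + 1 : ℕ))]
    refine Finset.sum_congr rfl fun k _ => ?_
    simp only [hh]
    congr 1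
    · congr 1; ring
    · have e := intervalIntegral.integral_comp_add_right (a := 0) (b := 1)
        (fun y => f ((k + y) / N) * κ y) ((j : ℝ) - (L + 1))
      rw [zero_add, show (1 : ℝ) + (j - (L + 1)) = ((j + 1 : ℕ) : ℝ) - (L + 1) by push_cast; ring] at e
      rw [← e]
      refine intervalIntegral.integral_congr fun s _ => ?_
      congr 2
      · push_cast; ring
      · push_cast; ring
  -- The offsets j tile an interval that contains the support of the kernel.
  have e5 : ∀ k : ℕ, ∑ j ∈ Finset.range (2 * L + 3),
      ∫ y in ((j : ℝ) - (L + 1))..(((j + 1 : ℕ) : ℝ) - (L + 1)), f ((k + y) / N) * κ y =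
      ∫ y, f ((k + y) / N) * κ y := by
    intro k
    have hi : IsBddMeas fun y => f ((k + y) / N) * κ y := (hf.comp (by fun_prop)).mul hκ.1
    rw [intervalIntegral.sum_integral_adjacent_intervals (a := fun j : ℕ => (j : ℝ) - (L + 1))
      fun k _ => hi.intervalIntegrable _ _]
    apply intervalIntegral.integral_eq_integral_of_support_subset
    intro x hx
    have h1 : |x| ≤ L := not_lt.1 fun h => hx (by simp [hL x h])
    have := abs_le.1 h1
    push_cast
    constructor <;> linarith
  rw [e1, e2, Finset.sum_congr rfl fun k _ => e3 k, Finset.sum_comm,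
    Finset.sum_congr rfl fun j _ => e4 j, Finset.sum_comm]
  simp only [← Finset.mul_sum, e5]

theorem integral_shiftSum_one (hκ : IsKernel κ) {f : ℝ → ℝ} (hf : IsBddMeas f)
    (hfp : Function.Periodic f 1) :
    ∫ x in (0 : ℝ)..1, f x * shiftSum κ (fun _ => 1) x = ∫ y, f y * κ y := by
  have := integral_mul_shiftSum hκ le_rfl hf hfp (a := fun _ => 1) fun _ => rfl
  simpa using this

theorem abs_integral_mul_kernel_le (hκ : IsKernel κ) : ∃ C : ℝ, 0 < C ∧ ∀ (f : ℝ → ℝ) (ε : ℝ),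
    0 ≤ ε → (∀ y, κ y ≠ 0 → |f y| ≤ ε) → |∫ y, f y * κ y| ≤ C * ε := by
  refine ⟨(∫ y, |κ y|) + 1, by positivity, fun f ε hε hf => ?_⟩
  have h1 : |∫ y, f y * κ y| ≤ ∫ y, ε * |κ y| := by
    refine norm_integral_le_of_norm_le (f := fun y => f y * κ y) (hκ.integrable.abs.const_mul ε) ?_
    refine Eventually.of_forall fun y => ?_
    rw [Real.norm_eq_abs, abs_mul]
    by_cases h : κ y = 0
    · simp [h]
    · exact mul_le_mul_of_nonneg_right (hf y h) (abs_nonneg _)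
  rw [integral_const_mul] at h1
  nlinarith

/-- Unfolding the period gives a mean of the coefficients against local integrals, each controlled
by the L¹ norm of the kernel. The mean of |a i| is the coefficient norm in all superconvergence
bounds. -/
theorem abs_integral_mul_shiftSum_le (hκ : IsKernel κ) : ∃ C : ℝ, 0 < C ∧ ∀ (N : ℕ) (f : ℝ → ℝ)
    (a : ℤ → ℝ) (ε : ℝ), 1 ≤ N → IsBddMeas f → Function.Periodic f 1 → Function.Periodic a (N : ℤ) →
    (∀ x, |f x| ≤ ε) →
    |∫ x in (0 : ℝ)..1, f x * shiftSum κ a (N * x)| ≤ C * ε * (1 / N * ∑ i ∈ Finset.range N, |a i|) := by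
  obtain ⟨C, hC0, hC⟩ := abs_integral_mul_kernel_le hκ
  refine ⟨C, hC0, fun N f a ε hN hf hfp ha hε => ?_⟩
  rw [integral_mul_shiftSum hκ hN hf hfp ha, abs_mul, abs_of_nonneg (by positivity : (0:ℝ) ≤ 1 / N)]
  have : |∑ i ∈ Finset.range N, a i * ∫ y, f ((i + y) / N) * κ y| ≤
      ∑ i ∈ Finset.range N, |a i| * (C * ε) := by
    refine (Finset.abs_sum_le_sum_abs _ _).trans (Finset.sum_le_sum fun i _ => ?_)
    rw [abs_mul]
    exact mul_le_mul_of_nonneg_left (hC _ ε ((abs_nonneg _).trans (hε 0)) fun y _ => hε _) (abs_nonneg _)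
  rw [← Finset.sum_mul] at this
  calc _ ≤ 1 / (N : ℝ) * ((∑ i ∈ Finset.range N, |a i|) * (C * ε)) := by gcongr
    _ = _ := by ring

/-! ### Differentiation of sums of translates -/

/-- `κ` is a continuous kernel with derivative `κ'` off the integers. -/
structure IsDerivKernel (κ κ' : ℝ → ℝ) : Prop where
  left : IsKernel κ
  right : IsKernel κ'
  cont : Continuous κ
  deriv : ∀ x : ℝ, x ∉ range ((↑) : ℤ → ℝ) → HasDerivAt κ (κ' x) x

theorem sub_int_notMem {x : ℝ} (hx : x ∉ range ((↑) : ℤ → ℝ)) (i : ℤ) : x - i ∉ range ((↑) : ℤ → ℝ) := by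
  rintro ⟨j, hj⟩
  exact hx ⟨j + i, by push_cast; linarith⟩

theorem hasDerivAt_shiftSum (hκ : IsKernel κ) (hκ' : IsKernel κ') {y : ℝ}
    (h : ∀ i : ℤ, HasDerivAt κ (κ' (y - i)) (y - i)) (a : ℤ → ℝ) :
    HasDerivAt (shiftSum κ a) (shiftSum κ' a y) y := by
  obtain ⟨s, hs⟩ := exists_common_window hκ hκ' 2 ⌊y⌋
  have e : shiftSum κ a =ᶠ[𝓝 y] fun z => ∑ i ∈ s, a i * κ (z - i) := by
    filter_upwards [eventually_abs_sub_floor_le y] with z hz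
    exact (hs a z hz).1
  rw [(hs a y (abs_sub_floor_le y (by norm_num))).2]
  refine HasDerivAt.congr_of_eventuallyEq ?_ e
  refine HasDerivAt.fun_sum fun i _ => ?_
  exact ((h i).comp_sub_const y i).const_mul (a i)

theorem continuous_shiftSum (hκ : IsKernel κ) (hc : Continuous κ) (a : ℤ → ℝ) :
    Continuous (shiftSum κ a) := by
  rw [continuous_iff_continuousAt]
  intro y
  obtain ⟨s, hs⟩ := eventually_shiftSum_eq hκ y
  refine ContinuousAt.congr ?_ ((hs a).mono fun _ h => h.symm)
  fun_prop

theorem contDiff_shiftSum (hκ : IsKernel κ) {n : ℕ} (hc : ContDiff ℝ n κ) (a : ℤ → ℝ) :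
    ContDiff ℝ n (shiftSum κ a) := by
  rw [contDiff_iff_contDiffAt]
  intro y
  obtain ⟨s, hs⟩ := eventually_shiftSum_eq hκ y
  refine ContDiffAt.congr_of_eventuallyEq ?_ (hs a)
  refine ContDiffAt.sum fun i _ => ?_
  refine contDiffAt_const.mul ?_
  exact (hc.comp (contDiff_id.sub contDiff_const)).contDiffAt

namespace IsDerivKernel

theorem hasDerivAt_shiftSum (h : IsDerivKernel κ κ') (a : ℤ → ℝ) {y : ℝ}
    (hy : y ∉ range ((↑) : ℤ → ℝ)) : HasDerivAt (shiftSum κ a) (shiftSum κ' a y) y :=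
  _root_.hasDerivAt_shiftSum h.left h.right (fun i => h.deriv _ (sub_int_notMem hy i)) a

/-- The sum is continuous, and the fundamental theorem of calculus tolerates the countable
exceptional set of integers. -/
theorem integral_shiftSum (h : IsDerivKernel κ κ') {a : ℤ → ℝ} {V : ℝ} (ha : ∀ i, |a i| ≤ V)
    (x y : ℝ) : ∫ t in x..y, shiftSum κ' a t = shiftSum κ a y - shiftSum κ a x := by
  refine MeasureTheory.integral_eq_of_hasDerivAt_off_countable (shiftSum κ a) (shiftSum κ' a)
    (countable_range ((↑) : ℤ → ℝ)) (continuous_shiftSum h.left h.cont a).continuousOn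
    (fun t ht => h.hasDerivAt_shiftSum a ht.2) ?_
  exact (h.right.bddMeas_shiftSum ha).intervalIntegrable _ _

theorem integral_eq_zero (h : IsDerivKernel κ κ') : ∫ t, κ' t = 0 := by
  obtain ⟨L₁, hL₁⟩ := h.right.integral_eq_interval
  obtain ⟨L₂, hL₂⟩ := h.left.supp
  set L := max L₁ (L₂ + 1)
  have hlt : (L₂ : ℝ) < L := by
    have : L₂ + 1 ≤ L := le_max_right _ _
    exact_mod_cast this
  rw [hL₁ L (le_max_left _ _), MeasureTheory.integral_eq_of_hasDerivAt_off_countable κ κ'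
    (countable_range ((↑) : ℤ → ℝ)) h.cont.continuousOn (fun t ht => h.deriv t ht.2)
    (h.right.1.intervalIntegrable _ _), hL₂ L (by rwa [abs_of_nonneg (Nat.cast_nonneg _)]),
    hL₂ (-L) (by rwa [abs_neg, abs_of_nonneg (Nat.cast_nonneg _)]), sub_zero]

/-- Product rule. Combined with `integral_eq_zero` it transfers vanishing moments from a kernel to
its derivative. -/
theorem neg_pow_mul (h : IsDerivKernel κ κ') (m : ℕ) :
    IsDerivKernel (fun x => (-x) ^ (m + 1) * κ x)
      (fun x => -(m + 1 : ℝ) * ((-x) ^ m * κ x) + (-x) ^ (m + 1) * κ' x) := by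
  refine ⟨h.left.neg_pow_mul _, ((h.left.neg_pow_mul _).const_mul _).add (h.right.neg_pow_mul _),
    by have := h.cont; fun_prop, fun x hx => ?_⟩
  have h1 : HasDerivAt (fun x : ℝ => (-x) ^ (m + 1)) ((m + 1 : ℕ) * (-x) ^ m * (-1)) x := by
    simpa using (hasDerivAt_neg x).fun_pow (m + 1)
  refine (h1.mul (h.deriv x hx)).congr_deriv ?_
  push_cast; ring

end IsDerivKernel

end

/-! ### Cardinal B-splines -/

theorem cardinalBSpline_succ (n : ℕ) (x : ℝ) :
    cardinalBSpline (n + 1) x = ∫ t in (x - 1)..x, cardinalBSpline n t := rfl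

theorem cardinalBSpline_eq_zero (n : ℕ) {x : ℝ} (hx : x < 0 ∨ (n : ℝ) + 1 ≤ x) :
    cardinalBSpline n x = 0 := by
  induction n generalizing x with
  | zero =>
    refine indicator_of_notMem (fun h => ?_) _
    rcases hx with hx | hx
    · exact absurd h.1 (not_le.2 hx)
    · simp at hx; exact absurd h.2 (not_lt.2 hx)
  | succ n ih =>
    rw [cardinalBSpline_succ]
    refine intervalIntegral.integral_zero_ae (Eventually.of_forall fun t ht => ih ?_)
    rw [uIoc_of_le (by linarith)] at ht
    push_cast at hx
    rcases hx with hx | hx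
    · exact Or.inl (by linarith [ht.2])
    · exact Or.inr (by linarith [ht.1])

theorem IsBddMeas.continuous_window {f : ℝ → ℝ} (hf : IsBddMeas f) :
    Continuous fun x => ∫ t in (x - 1)..x, f t := by
  have h : (fun x => ∫ t in (x - 1)..x, f t) =
      fun x => (∫ t in (0 : ℝ)..x, f t) - ∫ t in (0 : ℝ)..(x - 1), f t := by
    ext x
    rw [intervalIntegral.integral_interval_sub_left (hf.intervalIntegrable _ _)
      (hf.intervalIntegrable _ _)]
  rw [h]
  have hc := intervalIntegral.continuous_primitive (fun a b => hf.intervalIntegrable a b) 0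
  exact hc.sub (hc.comp (continuous_id.sub continuous_const))

theorem isKernel_cardinalBSpline (n : ℕ) : IsKernel (cardinalBSpline n) := by
  have supp : ∀ x : ℝ, ((n + 1 : ℕ) : ℝ) < |x| → cardinalBSpline n x = 0 := by
    intro x hx
    push_cast at hx
    rcases lt_abs.1 hx with h | h
    · exact cardinalBSpline_eq_zero n (Or.inr h.le)
    · exact cardinalBSpline_eq_zero n (Or.inl (by
        have : (0 : ℝ) ≤ n := Nat.cast_nonneg n
        linarith))
  have bdd : IsBddMeas (cardinalBSpline n) ∧ ∀ x, |cardinalBSpline n x| ≤ 1 := by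
    clear supp
    induction n with
    | zero =>
      have h : ∀ x, |cardinalBSpline 0 x| ≤ 1 := by
        intro x
        simp only [cardinalBSpline, indicator]
        split_ifs <;> simp
      exact ⟨⟨measurable_const.indicator measurableSet_Ico, 1, h⟩, h⟩
    | succ n ih =>
      have h : ∀ x, |cardinalBSpline (n + 1) x| ≤ 1 := by
        intro x
        have := intervalIntegral.norm_integral_le_of_norm_le_const (a := x - 1) (b := x)
          fun t _ => (Real.norm_eq_abs _).trans_le (ih.2 t)
        rw [cardinalBSpline_succ]
        simpa using this
      exact ⟨⟨ih.1.continuous_window.measurable, 1, h⟩, h⟩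
  exact ⟨bdd.1, n + 1, supp⟩

theorem continuous_cardinalBSpline (n : ℕ) : Continuous (cardinalBSpline (n + 1)) :=
  (isKernel_cardinalBSpline n).1.continuous_window

theorem hasDerivAt_cardinalBSpline_of_continuousAt {n : ℕ} {x : ℝ}
    (h : ContinuousAt (cardinalBSpline n) x) (h1 : ContinuousAt (cardinalBSpline n) (x - 1)) :
    HasDerivAt (cardinalBSpline (n + 1)) (cardinalBSpline n x - cardinalBSpline n (x - 1)) x := by
  have hB := (isKernel_cardinalBSpline n).1
  have hm : ∀ y, StronglyMeasurableAtFilter (cardinalBSpline n) (𝓝 y) := fun y =>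
    hB.1.stronglyMeasurable.stronglyMeasurableAtFilter
  have e : cardinalBSpline (n + 1) = fun x => (∫ t in (0 : ℝ)..x, cardinalBSpline n t) -
      ∫ t in (0 : ℝ)..(x - 1), cardinalBSpline n t := by
    ext x
    rw [intervalIntegral.integral_interval_sub_left (hB.intervalIntegrable _ _)
      (hB.intervalIntegrable _ _)]
    rfl
  rw [e]
  refine (intervalIntegral.integral_hasDerivAt_right (hB.intervalIntegrable _ _) (hm x) h).sub ?_
  exact (intervalIntegral.integral_hasDerivAt_right (hB.intervalIntegrable _ _) (hm _) h1).comp_sub_const x 1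

theorem hasDerivAt_cardinalBSpline (n : ℕ) (x : ℝ) : HasDerivAt (cardinalBSpline (n + 2))
    (cardinalBSpline (n + 1) x - cardinalBSpline (n + 1) (x - 1)) x :=
  hasDerivAt_cardinalBSpline_of_continuousAt (continuous_cardinalBSpline n).continuousAt
    (continuous_cardinalBSpline n).continuousAt

theorem continuousAt_cardinalBSpline (n : ℕ) {x : ℝ} (hx : x ∉ range ((↑) : ℤ → ℝ)) :
    ContinuousAt (cardinalBSpline n) x := by
  cases n with
  | zero =>
    refine ContinuousAt.congr (f := fun _ => (indicator (Ico (0 : ℝ) 1) (fun _ => (1 : ℝ)) x))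
      continuousAt_const ?_
    have h0 : x ≠ 0 := fun h => hx ⟨0, by simp [h]⟩
    have h1 : x ≠ 1 := fun h => hx ⟨1, by simp [h]⟩
    rcases lt_or_gt_of_ne h0 with h | h
    · filter_upwards [Iio_mem_nhds h] with y hy
      simp [cardinalBSpline, indicator, not_le.2 h, not_le.2 (mem_Iio.1 hy)]
    · rcases lt_or_gt_of_ne h1 with h' | h'
      · filter_upwards [Ioo_mem_nhds h h'] with y hy
        simp [cardinalBSpline, indicator, h.le, h', hy.1.le, hy.2]
      · filter_upwards [Ioi_mem_nhds h'] with y hy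
        simp [cardinalBSpline, indicator, not_lt.2 h'.le, not_lt.2 (mem_Ioi.1 hy).le]
  | succ n => exact (continuous_cardinalBSpline n).continuousAt

/-- The backward difference of a kernel. -/
noncomputable def backDiff (κ : ℝ → ℝ) (x : ℝ) : ℝ := κ x - κ (x - 1)

theorem IsKernel.backDiff {κ : ℝ → ℝ} (h : IsKernel κ) : IsKernel (backDiff κ) := h.sub (h.shift 1)

/-- Summation by parts. Through it the derivative of a spline becomes a spline of lower degree with
differenced coefficients, and conversely. -/
theorem shiftSum_backDiff {κ : ℝ → ℝ} (h : IsKernel κ) (a : ℤ → ℝ) (y : ℝ) :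
    shiftSum (backDiff κ) a y = shiftSum κ (fun i => a i - a (i - 1)) y := by
  have e : backDiff κ = fun x => κ x + -1 * κ (x - (1 : ℤ)) := by
    ext x; simp [backDiff, sub_eq_add_neg]
  rw [e, shiftSum_add_kernel h ((h.shift _).const_mul _), shiftSum_mul_kernel (h.shift _),
    shiftSum_shift_kernel, shiftSum_sub_coeff h]
  ring

theorem isDerivKernel_cardinalBSpline (n : ℕ) :
    IsDerivKernel (cardinalBSpline (n + 1)) (backDiff (cardinalBSpline n)) :=
  ⟨isKernel_cardinalBSpline _, (isKernel_cardinalBSpline n).backDiff, continuous_cardinalBSpline n,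
    fun x hx => hasDerivAt_cardinalBSpline_of_continuousAt (continuousAt_cardinalBSpline n hx)
      (continuousAt_cardinalBSpline n (by simpa using sub_int_notMem hx 1))⟩

theorem contDiff_cardinalBSpline (n : ℕ) : ContDiff ℝ n (cardinalBSpline (n + 1)) := by
  induction n with
  | zero => exact contDiff_zero.2 (continuous_cardinalBSpline 0)
  | succ n ih =>
    rw [Nat.cast_succ, contDiff_succ_iff_deriv]
    refine ⟨fun x => (hasDerivAt_cardinalBSpline n x).differentiableAt, by simp, ?_⟩
    have : deriv (cardinalBSpline (n + 1 + 1)) = fun x =>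
        cardinalBSpline (n + 1) x - cardinalBSpline (n + 1) (x - 1) :=
      funext fun x => (hasDerivAt_cardinalBSpline n x).deriv
    rw [this]
    exact ih.sub (ih.comp (contDiff_id.sub contDiff_const))

/-! ### Piecewise polynomials -/

theorem Polynomial.exists_derivative_eq (p : Polynomial ℝ) {n : ℕ} (hp : p.natDegree ≤ n) :
    ∃ q : Polynomial ℝ, q.natDegree ≤ n + 1 ∧ q.derivative = p := by
  refine ⟨∑ k ∈ Finset.range (n + 1), Polynomial.monomial (k + 1) (p.coeff k / (k + 1)), ?_, ?_⟩
  · refine Polynomial.natDegree_sum_le_of_forall_le _ _ fun k hk => ?_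
    refine (Polynomial.natDegree_monomial_le _).trans ?_
    have := Finset.mem_range.1 hk
    omega
  · rw [Polynomial.derivative_sum]
    conv_rhs => rw [p.as_sum_range' (n + 1) (by omega)]
    refine Finset.sum_congr rfl fun k _ => ?_
    rw [Polynomial.derivative_monomial]
    congr 1
    push_cast
    field_simp

/-- `f` is a polynomial of degree at most `n` on every open interval between consecutive integers. -/
def IsPiecewisePoly (n : ℕ) (f : ℝ → ℝ) : Prop :=
  ∀ i : ℤ, ∃ p : Polynomial ℝ, p.natDegree ≤ n ∧ ∀ x ∈ Ioo (i : ℝ) (i + 1), f x = p.eval x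

namespace IsPiecewisePoly

variable {n : ℕ} {f g : ℝ → ℝ}

theorem add (hf : IsPiecewisePoly n f) (hg : IsPiecewisePoly n g) :
    IsPiecewisePoly n fun x => f x + g x := by
  intro i
  obtain ⟨p, hp, hpf⟩ := hf i
  obtain ⟨q, hq, hqg⟩ := hg i
  exact ⟨p + q, Polynomial.natDegree_add_le_of_degree_le hp hq, fun x hx => by
    simp only [hpf x hx, hqg x hx, Polynomial.eval_add]⟩

theorem const_mul (c : ℝ) (hf : IsPiecewisePoly n f) : IsPiecewisePoly n fun x => c * f x := by
  intro i
  obtain ⟨p, hp, hpf⟩ := hf i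
  exact ⟨Polynomial.C c * p, (Polynomial.natDegree_C_mul_le _ _).trans hp, fun x hx => by
    simp only [hpf x hx, Polynomial.eval_mul, Polynomial.eval_C]⟩

theorem sub (hf : IsPiecewisePoly n f) (hg : IsPiecewisePoly n g) :
    IsPiecewisePoly n fun x => f x - g x := by
  simpa [sub_eq_add_neg] using hf.add (hg.const_mul (-1))

theorem sum {ι : Type*} (s : Finset ι) {f : ι → ℝ → ℝ} (h : ∀ i ∈ s, IsPiecewisePoly n (f i)) :
    IsPiecewisePoly n fun x => ∑ i ∈ s, f i x := by
  classical
  induction s using Finset.induction_on with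
  | empty => exact fun i => ⟨0, by simp, by simp⟩
  | insert a s ha ih =>
    simp only [Finset.sum_insert ha]
    exact (h a (by simp)).add (ih fun i hi => h i (by simp [hi]))

theorem shift (hf : IsPiecewisePoly n f) (k : ℤ) : IsPiecewisePoly n fun x => f (x - k) := by
  intro i
  obtain ⟨p, hp, hpf⟩ := hf (i - k)
  refine ⟨p.comp (Polynomial.X - Polynomial.C (k : ℝ)), ?_, fun x hx => ?_⟩
  · rw [Polynomial.natDegree_comp, Polynomial.natDegree_X_sub_C, mul_one]; exact hp
  · have := hpf (x - k) (by push_cast; constructor <;> linarith [hx.1, hx.2])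
    simpa using this

theorem shiftSum {κ : ℝ → ℝ} (hf : IsPiecewisePoly n κ) (hκ : IsKernel κ) (a : ℤ → ℝ) :
    IsPiecewisePoly n (shiftSum κ a) := by
  intro i
  obtain ⟨s, hs⟩ := exists_common_window hκ hκ 1 i
  obtain ⟨p, hp, hpf⟩ := sum s (fun j _ => (hf.shift j).const_mul (a j)) i
  refine ⟨p, hp, fun x hx => ?_⟩
  rw [← hpf x hx]
  exact (hs a x (by rw [abs_le]; push_cast; constructor <;> linarith [hx.1, hx.2])).1

theorem eval_Icc (hf : IsPiecewisePoly n f) (hc : Continuous f) (i : ℤ) :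
    ∃ p : Polynomial ℝ, p.natDegree ≤ n ∧ ∀ x ∈ Icc (i : ℝ) (i + 1), f x = p.eval x := by
  obtain ⟨p, hp, hpf⟩ := hf i
  refine ⟨p, hp, fun x hx => ?_⟩
  have h : EqOn f (fun x => p.eval x) (closure (Ioo (i : ℝ) (i + 1))) :=
    (show EqOn f (fun x => p.eval x) (Ioo (i : ℝ) (i + 1)) from hpf).closure hc p.continuous
  rw [closure_Ioo (by linarith)] at h
  exact h hx

end IsPiecewisePoly

theorem Ioo_int_notMem {i : ℤ} {x : ℝ} (hx : x ∈ Ioo (i : ℝ) (i + 1)) : x ∉ range ((↑) : ℤ → ℝ) := by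
  rintro ⟨j, rfl⟩
  have h1 : i < j := by exact_mod_cast hx.1
  have h2 : j < i + 1 := by exact_mod_cast hx.2
  omega

/-- Inside a cell the derivative is a difference of two B-splines of lower degree, hence a
polynomial by induction, and an antiderivative raises the degree by one. -/
theorem isPiecewisePoly_cardinalBSpline (n : ℕ) : IsPiecewisePoly n (cardinalBSpline n) := by
  induction n with
  | zero =>
    intro i
    by_cases h : i = 0
    · refine ⟨1, by simp, fun x hx => ?_⟩
      subst h
      simp only [Int.cast_zero, zero_add] at hx
      simp [cardinalBSpline, indicator, hx.1.le, hx.2]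
    · refine ⟨0, by simp, fun x hx => ?_⟩
      rw [Polynomial.eval_zero]
      refine cardinalBSpline_eq_zero 0 ?_
      rcases lt_or_gt_of_ne h with h | h
      · left
        have : (i : ℝ) + 1 ≤ 0 := by exact_mod_cast h
        linarith [hx.2]
      · right
        have : (1 : ℝ) ≤ i := by exact_mod_cast h
        push_cast; linarith [hx.1]
  | succ n ih =>
    intro i
    obtain ⟨q, hq, hqf⟩ := (ih.sub (by simpa using ih.shift 1)) i
    obtain ⟨p, hp, rfl⟩ := q.exists_derivative_eq hq
    -- A point of the cell at which the constant of integration is fixed.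
    set m : ℝ := i + 1 / 2 with hm
    have hmem : m ∈ Ioo (i : ℝ) (i + 1) := by constructor <;> rw [hm] <;> linarith
    have hd := fun x (hx : x ∈ Ioo (i : ℝ) (i + 1)) =>
      (isDerivKernel_cardinalBSpline n).deriv x (Ioo_int_notMem hx)
    refine ⟨p + Polynomial.C (cardinalBSpline (n + 1) m - p.eval m),
      (Polynomial.natDegree_add_C).trans_le hp, ?_⟩
    refine isOpen_Ioo.eqOn_of_deriv_eq isPreconnected_Ioo
      (fun x hx => (hd x hx).differentiableAt.differentiableWithinAt)
      (Polynomial.differentiable _).differentiableOn (fun x hx => ?_) hmem (by simp)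
    rw [(hd x hx).deriv, Polynomial.deriv]
    simpa [backDiff] using hqf x hx

/-! ### Reproduction of polynomials -/

theorem integral_sub_eq_integral_window (f : ℝ → ℝ) (y : ℝ) :
    ∫ s in (0 : ℝ)..1, f (y - s) = ∫ t in (y - 1)..y, f t := by
  rw [intervalIntegral.integral_comp_sub_left, sub_zero]

/-- A B-spline is the mean of the previous one over a unit window; writing x = (x - s) + s and
expanding binomially gives a recursion for the periodized moments. -/
theorem shiftSum_pow_cardinalBSpline_succ (n m : ℕ) (y : ℝ) :
    shiftSum (fun x => x ^ m * cardinalBSpline (n + 1) x) (fun _ => 1) y =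
      ∑ k ∈ Finset.range (m + 1), m.choose k * ∫ s in (0 : ℝ)..1,
        s ^ (m - k) * shiftSum (fun x => x ^ k * cardinalBSpline n x) (fun _ => 1) (y - s) := by
  obtain ⟨L, hL⟩ := (isKernel_cardinalBSpline n).supp
  obtain ⟨L', hL'⟩ := (isKernel_cardinalBSpline (n + 1)).supp
  set M := max L L'
  have h1 : ∀ x : ℝ, (M : ℝ) < |x| → cardinalBSpline n x = 0 := fun x hx =>
    hL x (lt_of_le_of_lt (by exact_mod_cast le_max_left _ _) hx)
  have h2 : ∀ x : ℝ, (M : ℝ) < |x| → cardinalBSpline (n + 1) x = 0 := fun x hx =>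
    hL' x (lt_of_le_of_lt (by exact_mod_cast le_max_right _ _) hx)
  set W := Finset.Icc (⌊y⌋ - (M + 1 : ℕ)) (⌊y⌋ + (M + 1 : ℕ))
  have hB := (isKernel_cardinalBSpline n).1
  have hyl := Int.floor_le y
  have hyu := Int.lt_floor_add_one y
  have ii : ∀ (k l : ℕ) (i : ℤ), IntervalIntegrable
      (fun s : ℝ => s ^ l * ((y - s - i) ^ k * cardinalBSpline n (y - s - i))) volume 0 1 := by
    intro k l i
    have := (hB.comp (show Measurable fun s => y - s - i by fun_prop)).intervalIntegrable 0 1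
    refine (this.continuousOn_mul (g := fun s : ℝ => s ^ l * (y - s - i) ^ k) (by fun_prop)).congr ?_
    exact fun s _ => by ring
  rw [shiftSum_eq_window (R := 1) (k := ⌊y⌋) (L := M) (fun x hx => by rw [h2 x hx, mul_zero])
    (abs_sub_floor_le y le_rfl)]
  have lhs : ∀ i ∈ W, (1 : ℝ) * ((y - i) ^ m * cardinalBSpline (n + 1) (y - i)) =
      ∑ k ∈ Finset.range (m + 1), m.choose k * ∫ s in (0 : ℝ)..1,
        s ^ (m - k) * ((y - s - i) ^ k * cardinalBSpline n (y - s - i)) := by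
    intro i _
    rw [cardinalBSpline_succ, ← integral_sub_eq_integral_window, one_mul,
      ← intervalIntegral.integral_const_mul]
    simp only [← intervalIntegral.integral_const_mul]
    rw [← intervalIntegral.integral_finsetSum fun k _ => (ii k (m - k) i).const_mul _]
    refine intervalIntegral.integral_congr fun s _ => ?_
    rw [show y - (i : ℝ) - s = y - s - i by ring, show y - (i : ℝ) = (y - s - i) + s by ring, add_pow,
      Finset.sum_mul]
    refine Finset.sum_congr rfl fun k _ => by ring
  rw [Finset.sum_congr rfl lhs, Finset.sum_comm]
  refine Finset.sum_congr rfl fun k _ => ?_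
  rw [← Finset.mul_sum, ← intervalIntegral.integral_finsetSum fun i _ => ii k (m - k) i]
  congr 1
  refine intervalIntegral.integral_congr fun s hs => ?_
  rw [uIcc_of_le zero_le_one] at hs
  rw [shiftSum_eq_window (R := 1) (k := ⌊y⌋) (L := M) (fun x hx => by rw [h1 x hx, mul_zero])
    (by rw [abs_le]; push_cast; constructor <;> linarith [hs.1, hs.2]), Finset.mul_sum]
  exact Finset.sum_congr rfl fun i _ => by ring

theorem shiftSum_cardinalBSpline_zero (a : ℤ → ℝ) (y : ℝ) :
    shiftSum (cardinalBSpline 0) a y = a ⌊y⌋ := by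
  rw [shiftSum, finsum_eq_single _ ⌊y⌋]
  · have h1 := Int.floor_le y
    have h2 := Int.lt_floor_add_one y
    rw [cardinalBSpline, indicator_of_mem, mul_one]
    constructor <;> linarith
  · intro i hi
    rw [cardinalBSpline, indicator_of_notMem, mul_zero]
    intro h
    refine hi (Int.floor_eq_iff.2 ⟨?_, ?_⟩).symm <;> linarith [h.1, h.2]

theorem shiftSum_one_periodic (κ : ℝ → ℝ) : Function.Periodic (shiftSum κ fun _ => 1) 1 := by
  have : Function.Periodic (fun _ : ℤ => (1 : ℝ)) ((1 : ℕ) : ℤ) := fun _ => rfl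
  simpa using shiftSum_periodic (κ := κ) this

/-- Moments of the translates of a B-spline of degree at least `m` do not depend on the point. -/
theorem shiftSum_pow_cardinalBSpline_const (n m : ℕ) (hm : m ≤ n) (y z : ℝ) :
    shiftSum (fun x => x ^ m * cardinalBSpline n x) (fun _ => 1) y =
      shiftSum (fun x => x ^ m * cardinalBSpline n x) (fun _ => 1) z := by
  induction n generalizing m y z with
  | zero =>
    obtain rfl : m = 0 := by omega
    simp only [pow_zero, one_mul, shiftSum_cardinalBSpline_zero]
  | succ n ih =>
    rw [shiftSum_pow_cardinalBSpline_succ, shiftSum_pow_cardinalBSpline_succ]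
    refine Finset.sum_congr rfl fun k hk => ?_
    have hk := Finset.mem_range.1 hk
    congr 1
    -- Only the top order k = m = n + 1 escapes the induction hypothesis. There the weight in s is
    -- 1, so a periodic function is integrated over a full period and the point does not matter.
    rcases Nat.lt_or_ge n k with h | h
    · obtain rfl : k = m := by omega
      simp only [Nat.sub_self, pow_zero, one_mul]
      rw [integral_sub_eq_integral_window, integral_sub_eq_integral_window]
      have := (shiftSum_one_periodic fun x => x ^ k * cardinalBSpline n x).intervalIntegral_add_eq
        (y - 1) (z - 1)
      simpa using this
    · refine intervalIntegral.integral_congr fun s _ => ?_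
      rw [ih k h (y - s) (z - s)]

/-- A constant equals its mean over a period, and that mean unfolds to the integral over the line.
-/
theorem eq_integral_of_const {κ : ℝ → ℝ} (hκ : IsKernel κ)
    (h : ∀ y z, shiftSum κ (fun _ => 1) y = shiftSum κ (fun _ => 1) z) (y : ℝ) :
    shiftSum κ (fun _ => 1) y = ∫ x, κ x := by
  have := integral_shiftSum_one hκ (IsBddMeas.const 1) (fun _ => rfl)
  simp only [one_mul] at this
  rw [← this, intervalIntegral.integral_congr fun x _ => h x y]
  simp

theorem integral_cardinalBSpline (n : ℕ) : ∫ x, cardinalBSpline n x = 1 := by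
  induction n with
  | zero =>
    rw [← eq_integral_of_const (isKernel_cardinalBSpline 0) (fun y z => by
      simp [shiftSum_cardinalBSpline_zero]) 0, shiftSum_cardinalBSpline_zero]
  | succ n ih =>
    have h := fun n => eq_integral_of_const (isKernel_cardinalBSpline n) (fun y z => by
      simpa using shiftSum_pow_cardinalBSpline_const n 0 (Nat.zero_le _) y z)
    have e := shiftSum_pow_cardinalBSpline_succ n 0 0
    simp only [pow_zero, one_mul, zero_add, Finset.range_one, Finset.sum_singleton, Nat.choose_self,
      Nat.cast_one, Nat.sub_self] at e
    rw [h (n + 1)] at e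
    rw [e]
    have : ∀ s : ℝ, shiftSum (fun x => cardinalBSpline n x) (fun _ => 1) s = 1 := fun s =>
      (h n s).trans ih
    simp [this]

theorem shiftSum_cardinalBSpline_one (n : ℕ) (y : ℝ) :
    shiftSum (cardinalBSpline n) (fun _ => 1) y = 1 := by
  rw [eq_integral_of_const (isKernel_cardinalBSpline n) (fun y z => by
      simpa using shiftSum_pow_cardinalBSpline_const n 0 (Nat.zero_le _) y z),
    integral_cardinalBSpline]

/-! ### Stability of the B-spline representation -/

theorem shiftSum_cardinalBSpline_cell (n : ℕ) (a : ℤ → ℝ) (k : ℤ) {s : ℝ} (hs : s ∈ Ioo (0 : ℝ) 1) :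
    shiftSum (cardinalBSpline n) a (k + s) =
      ∑ m ∈ Finset.range (n + 1), a (k - m) * cardinalBSpline n (s + m) := by
  have hsupp : (Function.support fun i : ℤ => a i * cardinalBSpline n (k + s - i)) ⊆
      ↑((Finset.range (n + 1)).image fun m : ℕ => k - (m : ℤ)) := by
    intro i hi
    have h0 : cardinalBSpline n (k + s - i) ≠ 0 := fun h => hi (by simp [h])
    have h1 : ¬((k : ℝ) + s - i < 0 ∨ (n : ℝ) + 1 ≤ k + s - i) := fun h =>
      h0 (cardinalBSpline_eq_zero n h)
    rw [not_or, not_lt, not_le] at h1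
    have h2 : (i : ℝ) < (k + 1 : ℤ) := by push_cast; linarith [hs.2, h1.1]
    have h3 : ((k - n - 1 : ℤ) : ℝ) < i := by push_cast; linarith [hs.1, h1.2]
    have h2' : i < k + 1 := by exact_mod_cast h2
    have h3' : k - n - 1 < i := by exact_mod_cast h3
    simp only [Finset.coe_image, Set.mem_image, Finset.mem_coe, Finset.mem_range]
    exact ⟨(k - i).toNat, by omega, by omega⟩
  rw [shiftSum, finsum_eq_sum_of_support_subset _ hsupp, Finset.sum_image (by intro x _ y _ h; simp only at h; omega)]
  refine Finset.sum_congr rfl fun m _ => ?_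
  congr 2; push_cast; ring

/-- Differentiating a relation on the cell gives one of lower degree for the differences of the
coefficients, the two end terms vanishing by support. By induction all coefficients agree, and the
partition of unity forces their common value to be 0. -/
theorem cardinalBSpline_local_linearIndependent (n : ℕ) (a : ℕ → ℝ)
    (h : ∀ s ∈ Ioo (0 : ℝ) 1, ∑ m ∈ Finset.range (n + 1), a m * cardinalBSpline n (s + m) = 0) :
    ∀ m ≤ n, a m = 0 := by
  induction n generalizing a with
  | zero =>
    intro m hm
    obtain rfl : m = 0 := by omega
    have := h (1 / 2) (by norm_num)
    norm_num [cardinalBSpline, indicator] at this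
    exact this
  | succ n ih =>
    have hdiff : ∀ m ≤ n, a m - a (m + 1) = 0 := by
      refine ih (fun m => a m - a (m + 1)) fun s hs => ?_
      have hd : HasDerivAt (fun s => ∑ m ∈ Finset.range (n + 2), a m * cardinalBSpline (n + 1) (s + m))
          (∑ m ∈ Finset.range (n + 2), a m * backDiff (cardinalBSpline n) (s + m)) s := by
        refine HasDerivAt.fun_sum fun m _ => HasDerivAt.const_mul _ ?_
        refine ((isDerivKernel_cardinalBSpline n).deriv (s + m) ?_).comp_add_const s m
        refine Ioo_int_notMem (i := m) ?_
        push_cast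
        constructor <;> linarith [hs.1, hs.2]
      have hz : HasDerivAt (fun s => ∑ m ∈ Finset.range (n + 2), a m * cardinalBSpline (n + 1) (s + m))
          0 s := by
        refine (hasDerivAt_const s (0 : ℝ)).congr_of_eventuallyEq ?_
        filter_upwards [Ioo_mem_nhds hs.1 hs.2] with t ht using h t ht
      have e := hd.unique hz
      simp only [backDiff, mul_sub, Finset.sum_sub_distrib] at e
      rw [Finset.sum_range_succ, Finset.sum_range_succ' (fun m : ℕ => a m * cardinalBSpline n (s + m - 1)),
        cardinalBSpline_eq_zero n (x := s + (n + 1 : ℕ)) (Or.inr (by push_cast; linarith [hs.1])),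
        cardinalBSpline_eq_zero n (x := s + (0 : ℕ) - 1) (Or.inl (by push_cast; linarith [hs.2])),
        mul_zero, mul_zero, add_zero, add_zero, ← Finset.sum_sub_distrib] at e
      rw [← e]
      refine Finset.sum_congr rfl fun m _ => ?_
      rw [show s + ((m + 1 : ℕ) : ℝ) - 1 = s + m by push_cast; ring]
      ring
    have hconst : ∀ m ≤ n + 1, a m = a 0 := by
      intro m hm
      induction m with
      | zero => rfl
      | succ m ihm => rw [← ihm (by omega)]; linarith [hdiff m (by omega)]
    have hs : (1 / 2 : ℝ) ∈ Ioo (0 : ℝ) 1 := by norm_num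
    have e := h _ hs
    have e1 := shiftSum_cardinalBSpline_cell (n + 1) (fun _ => 1) 0 hs
    rw [shiftSum_cardinalBSpline_one] at e1
    rw [Finset.sum_congr rfl fun m hm => by
      rw [hconst m (by have := Finset.mem_range.1 hm; omega)], ← Finset.mul_sum] at e
    simp only [one_mul] at e1
    rw [← e1, mul_one] at e
    intro m hm
    rw [hconst m hm, e]

/-- By local independence the integral is a positive definite quadratic form in the finitely many
coefficients active on a cell. Its minimum on the unit sphere is positive, and homogeneity does the
rest. -/
theorem exists_le_integral_sq_cell (n : ℕ) : ∃ C : ℝ, 0 < C ∧ ∀ a : ℕ → ℝ, a 0 ^ 2 ≤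
    C * ∫ s in (0 : ℝ)..1, (∑ m ∈ Finset.range (n + 2), a m * cardinalBSpline (n + 1) (s + m)) ^ 2 := by
  have hBc := continuous_cardinalBSpline n
  set f : (Fin (n + 2) → ℝ) → ℝ → ℝ := fun a s => (∑ m, a m * cardinalBSpline (n + 1) (s + (m : ℕ)))
    with hf
  set q : (Fin (n + 2) → ℝ) → ℝ := fun a => ∫ s in (0 : ℝ)..1, f a s ^ 2 with hq
  have hfc : Continuous (Function.uncurry fun a s => f a s ^ 2) := by
    simp only [hf, Function.uncurry_def]
    fun_prop
  have hfc' : ∀ a, Continuous (f a) := fun a => by simp only [hf]; fun_prop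
  have hqc : Continuous q :=
    intervalIntegral.continuous_parametric_intervalIntegral_of_continuous hfc continuous_const
  have hpos : ∀ a, a ≠ 0 → 0 < q a := by
    intro a ha
    by_contra hle
    refine ha ?_
    have hz : ∀ s ∈ Icc (0 : ℝ) 1, f a s = 0 := by
      intro s hs
      by_contra hne
      refine hle (intervalIntegral.integral_pos zero_lt_one ((hfc' a).pow 2).continuousOn
        (fun _ _ => sq_nonneg _) ⟨s, hs, by positivity⟩)
    have := cardinalBSpline_local_linearIndependent (n + 1)
      (fun m => if h : m < n + 2 then a ⟨m, h⟩ else 0) fun s hs => by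
        rw [Finset.sum_range, ← hz s ⟨hs.1.le, hs.2.le⟩]
        exact Finset.sum_congr rfl fun m _ => by simp
    ext m
    simpa using this m (by omega)
  have hqs : ∀ (c : ℝ) a, q (c • a) = c ^ 2 * q a := by
    intro c a
    simp only [hq, ← intervalIntegral.integral_const_mul, hf]
    refine intervalIntegral.integral_congr fun s _ => ?_
    simp only [Pi.smul_apply, smul_eq_mul, mul_assoc, ← Finset.mul_sum, mul_pow]
  obtain ⟨a₀, ha₀, hmin⟩ := (isCompact_sphere (0 : Fin (n + 2) → ℝ) 1).exists_isMinOn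
    (NormedSpace.sphere_nonempty.2 zero_le_one) hqc.continuousOn
  have ha₀' : a₀ ≠ 0 := by
    rintro rfl
    simp at ha₀
  have hc := hpos a₀ ha₀'
  refine ⟨1 / q a₀, by positivity, fun a => ?_⟩
  set b : Fin (n + 2) → ℝ := fun m => a m with hb
  have hqb : (∫ s in (0 : ℝ)..1, (∑ m ∈ Finset.range (n + 2), a m * cardinalBSpline (n + 1) (s + m)) ^ 2)
      = q b := by
    simp only [hq, hf, hb]
    refine intervalIntegral.integral_congr fun s _ => ?_
    simp only [Finset.sum_range]
  rw [hqb, one_div, ← div_eq_inv_mul, le_div_iff₀ hc]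
  by_cases h0 : b = 0
  · have : a 0 = 0 := congrFun h0 0
    rw [this, h0]
    have : q 0 = 0 := by simpa using hqs 0 0
    simp [this]
  · have hn : 0 < ‖b‖ := norm_pos_iff.2 h0
    have h1 : q a₀ ≤ q (‖b‖⁻¹ • b) := hmin (by simp [norm_smul, hn.ne'])
    rw [hqs] at h1
    have h2 : |a 0| ≤ ‖b‖ := norm_le_pi_norm b 0
    have h3 : a 0 ^ 2 ≤ ‖b‖ ^ 2 := by rw [← sq_abs]; gcongr
    calc a 0 ^ 2 * q a₀ ≤ ‖b‖ ^ 2 * (‖b‖⁻¹ ^ 2 * q b) := by gcongr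
      _ = q b := by field_simp

/-- The local bound is summed over the cells, and Cauchy–Schwarz passes from squares to absolute
values. Both sides are means, so rescaling leaves a constant independent of the mesh. -/
theorem exists_sum_abs_le_l2Norm (n : ℕ) : ∃ C : ℝ, 0 < C ∧ ∀ (N : ℕ) (a : ℤ → ℝ), 1 ≤ N →
    Function.Periodic a (N : ℤ) → 1 / (N : ℝ) * ∑ i ∈ Finset.range N, |a i| ≤
      C * l2Norm fun x => shiftSum (cardinalBSpline (n + 1)) a (N * x) := by
  obtain ⟨C, hC0, hC⟩ := exists_le_integral_sq_cell n
  refine ⟨Real.sqrt C, by positivity, fun N a hN ha => ?_⟩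
  have hN0 : (0 : ℝ) < N := by exact_mod_cast hN
  have hS := (isKernel_cardinalBSpline (n + 1)).bddMeas_shiftSum_periodic hN ha
  rw [l2Norm, ← Real.sqrt_mul hC0.le]
  refine Real.le_sqrt_of_sq_le ?_
  set S := shiftSum (cardinalBSpline (n + 1)) a
  have e1 : l2Inner (fun x => S (N * x)) (fun x => S (N * x)) = 1 / N * ∫ y in (0 : ℝ)..N, S y ^ 2 := by
    have := intervalIntegral.mul_integral_comp_mul_left (a := 0) (b := 1) (f := fun y => S y ^ 2) (N : ℝ)
    rw [mul_zero, mul_one] at this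
    rw [← this, ← mul_assoc, one_div_mul_cancel hN0.ne', one_mul, l2Inner]
    simp only [sq]
  have e2 : ∫ y in (0 : ℝ)..N, S y ^ 2 =
      ∑ k ∈ Finset.range N, ∫ y in (k : ℝ)..((k + 1 : ℕ) : ℝ), S y ^ 2 := by
    rw [intervalIntegral.sum_integral_adjacent_intervals (a := fun k : ℕ => (k : ℝ))
      fun k _ => (hS.pow 2).intervalIntegrable _ _]
    simp
  have e3 : ∀ k : ℕ, a k ^ 2 ≤ C * ∫ y in (k : ℝ)..((k + 1 : ℕ) : ℝ), S y ^ 2 := by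
    intro k
    have e := intervalIntegral.integral_comp_add_left (a := 0) (b := 1) (fun y => S y ^ 2) (k : ℝ)
    rw [add_zero] at e
    rw [Nat.cast_succ, ← e]
    have := hC fun m => a (k - m)
    simp only [Nat.cast_zero, sub_zero] at this
    refine this.trans_eq ?_
    congr 1
    refine intervalIntegral.integral_congr_Ioo_of_le zero_le_one fun s hs => ?_
    have := shiftSum_cardinalBSpline_cell (n + 1) a k hs
    simp only [Int.cast_natCast] at this
    simp only [S, this]
  have h4 : (∑ i ∈ Finset.range N, |a i|) ^ 2 ≤ N * ∑ i ∈ Finset.range N, a i ^ 2 := by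
    have := sq_sum_le_card_mul_sum_sq (s := Finset.range N) (f := fun i : ℕ => |a i|)
    simpa using this
  have h5 : ∑ i ∈ Finset.range N, a i ^ 2 ≤ C * ∫ y in (0 : ℝ)..N, S y ^ 2 := by
    rw [e2, Finset.mul_sum]
    exact Finset.sum_le_sum fun k _ => e3 k
  rw [e1, mul_pow]
  calc (1 / (N : ℝ)) ^ 2 * (∑ i ∈ Finset.range N, |a i|) ^ 2
      ≤ (1 / (N : ℝ)) ^ 2 * (N * (C * ∫ y in (0 : ℝ)..N, S y ^ 2)) := by gcongr; exact h4.trans (by gcongr)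
    _ = _ := by field_simp

/-! ### Oscillatory integrals against derivatives of splines -/

theorem integral_periodic_mul_cardinalBSpline {b : ℝ → ℝ} (hb : IsBddMeas b)
    (hbp : Function.Periodic b 1) (n : ℕ) :
    ∫ y, b y * cardinalBSpline n y = ∫ y in (0 : ℝ)..1, b y := by
  rw [← integral_shiftSum_one (isKernel_cardinalBSpline n) hb hbp]
  simp [shiftSum_cardinalBSpline_one]

/-- A translation of the variable moves the difference onto `f`. Local boundedness is enough for
`f`, which admits y * b y below. -/
theorem integral_mul_backDiff {κ f : ℝ → ℝ} (hκ : IsKernel κ)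
    (hf : ∀ L : ℕ, ∃ K : ℝ, ∀ x : ℝ, |x| ≤ L → |f x| ≤ K) (hfm : Measurable f) :
    ∫ y, f y * backDiff κ y = ∫ y, (f y - f (y + 1)) * κ y := by
  have h1 : Integrable fun y => f y * κ y := (hκ.mul_left hf hfm).integrable
  have h2 : Integrable fun y => f (y + 1) * κ y := by
    refine (hκ.mul_left (fun L => ?_) (hfm.comp (by fun_prop))).integrable
    obtain ⟨K, hK⟩ := hf (L + 1)
    refine ⟨K, fun x hx => hK _ ?_⟩
    push_cast
    exact (abs_add_le _ _).trans (by simpa using hx)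
  have h3 : Integrable fun y => f y * κ (y - 1) := by
    have := h2.comp_sub_right 1
    simpa using this
  have e : ∫ y, f y * κ (y - 1) = ∫ y, f (y + 1) * κ y := by
    have := integral_sub_right_eq_self (μ := volume) (fun y => f (y + 1) * κ y) (1 : ℝ)
    simpa using this
  simp only [backDiff, mul_sub, sub_mul]
  rw [integral_sub h1 h3, e, integral_sub h1 h2]

/-- A periodic mean-zero factor of the mesh frequency makes the pairing of a smooth function with
the derivative of a spline small. -/
theorem exists_oscillatory_bound (n : ℕ) {b : ℝ → ℝ} (hb : IsBddMeas b) (hbp : Function.Periodic b 1)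
    (hb0 : ∫ y in (0 : ℝ)..1, b y = 0) : ∃ C : ℝ, 0 < C ∧ ∀ (N : ℕ) (G G' : ℝ → ℝ) (V : ℝ) (a : ℤ → ℝ),
    1 ≤ N → IsBddMeas G → Function.Periodic G 1 → 0 ≤ V →
    (∀ x y, |G y - G x - G' x * (y - x)| ≤ V * (y - x) ^ 2) → Function.Periodic a (N : ℤ) →
    |∫ x in (0 : ℝ)..1, G x * b (N * x) * shiftSum (backDiff (cardinalBSpline n)) a (N * x)| ≤
      C * V * (1 / N) ^ 2 * (1 / N * ∑ i ∈ Finset.range N, |a i|) := by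
  have hκ := (isKernel_cardinalBSpline n).backDiff
  set κ := backDiff (cardinalBSpline n) with hκd
  have hbκ : IsKernel fun y => b y * κ y := IsKernel.bddMeas_mul hb hκ
  obtain ⟨C, hC0, hC⟩ := abs_integral_mul_kernel_le hbκ
  obtain ⟨L, hL⟩ := hbκ.supp
  obtain ⟨Kb, hKb⟩ := hb.bdd
  -- The difference annihilates the 1-periodic `b`.
  have z0 : ∫ y, b y * κ y = 0 := by
    rw [hκd, integral_mul_backDiff (isKernel_cardinalBSpline n) (fun _ => ⟨Kb, fun x _ => hKb x⟩) hb.1]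
    simp [hbp _]
  -- The difference of y * b y is -b y; paired with the B-spline it gives minus the mean of `b`, by
  -- the partition of unity, and that mean is zero.
  have z1 : ∫ y, y * (b y * κ y) = 0 := by
    simp only [← mul_assoc]
    rw [hκd, integral_mul_backDiff (f := fun y => y * b y) (isKernel_cardinalBSpline n)
      (fun L => ⟨L * Kb, fun x hx => by
        rw [abs_mul]; exact mul_le_mul hx (hKb x) (abs_nonneg _) (Nat.cast_nonneg _)⟩)
      (measurable_id.mul hb.1)]
    have : ∀ y, (y * b y - (y + 1) * b (y + 1)) * cardinalBSpline n y =
        -(b y * cardinalBSpline n y) := fun y => by rw [hbp y]; ring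
    simp only [this]
    rw [integral_neg, integral_periodic_mul_cardinalBSpline hb hbp, hb0, neg_zero]
  refine ⟨C * L ^ 2 + 1, by positivity, fun N G G' V a hN hG hGp hV hT ha => ?_⟩
  have hN0 : (0 : ℝ) < N := by exact_mod_cast hN
  have hbN : IsBddMeas fun x => b (N * x) := hb.comp (by fun_prop)
  have hbNp : Function.Periodic (fun x => b (N * x)) 1 := by
    intro x
    have := hbp.nat_mul N (N * x)
    simp only [mul_one] at this
    simpa only [mul_add, mul_one] using this
  rw [integral_mul_shiftSum hκ hN (hG.mul hbN) (hGp.mul hbNp) ha]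
  have key : ∀ i : ℕ, |∫ y, G ((i + y) / N) * b (N * ((i + y) / N)) * κ y| ≤
      C * (V * (L / N) ^ 2) := by
    intro i
    have e1 : ∀ y : ℝ, b (N * ((i + y) / N)) = b y := by
      intro y
      rw [mul_div_cancel₀ _ hN0.ne', add_comm]
      have := hbp.nat_mul i y
      simpa using this
    -- The first-order Taylor remainder of `G` at the node. The affine part integrates to zero by
    -- `z0` and `z1`, which is the source of the factor (1 / N) ^ 2.
    set R : ℝ → ℝ := fun y => G ((i + y) / N) - (G (i / N) + G' (i / N) * (1 / N) * y) with hR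
    have hi0 : Integrable fun y => b y * κ y := hbκ.integrable
    have hi1 : Integrable fun y => y * (b y * κ y) := by simpa using (hbκ.pow_mul 1).integrable
    have hi2 : Integrable fun y => G ((i + y) / N) * (b y * κ y) :=
      (hG.comp (by fun_prop)).integrable_mul hi0
    have e2 : ∫ y, G ((i + y) / N) * b (N * ((i + y) / N)) * κ y = ∫ y, R y * (b y * κ y) := by
      have : ∀ y, R y * (b y * κ y) = G ((i + y) / N) * (b y * κ y) - (G (i / N) * (b y * κ y) +
          G' (i / N) * (1 / N) * (y * (b y * κ y))) := fun y => by rw [hR]; ring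
      have hi3 : Integrable fun y => G (i / N) * (b y * κ y) +
          G' (i / N) * (1 / N) * (y * (b y * κ y)) := (hi0.const_mul _).add (hi1.const_mul _)
      simp only [this]
      rw [integral_sub hi2 hi3,
        integral_add (hi0.const_mul _) (hi1.const_mul _), integral_const_mul, integral_const_mul, z0, z1]
      simp only [e1, mul_assoc, mul_zero, add_zero, sub_zero]
    rw [e2]
    refine hC R _ (by positivity) fun y hy => ?_
    have hyL : |y| ≤ L := not_lt.1 fun h => hy (hL y h)
    have h := hT (i / N) ((i + y) / N)
    have e3 : ((i : ℝ) + y) / N - i / N = y / N := by ring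
    rw [e3] at h
    have e4 : R y = G ((i + y) / N) - G (i / N) - G' (i / N) * (y / N) := by rw [hR]; ring
    rw [e4]
    refine h.trans ?_
    gcongr V * ?_
    rw [div_pow, div_pow]
    gcongr ?_ / _
    rw [← sq_abs]
    gcongr
  rw [abs_mul, abs_of_nonneg (by positivity : (0 : ℝ) ≤ 1 / N)]
  have h2 : |∑ i ∈ Finset.range N, a i * ∫ y, G ((i + y) / N) * b (N * ((i + y) / N)) * κ y| ≤
      (∑ i ∈ Finset.range N, |a i|) * (C * (V * (L / N) ^ 2)) := by
    rw [Finset.sum_mul]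
    refine (Finset.abs_sum_le_sum_abs _ _).trans (Finset.sum_le_sum fun i _ => ?_)
    rw [abs_mul]
    exact mul_le_mul_of_nonneg_left (key i) (abs_nonneg _)
  have hA : 0 ≤ ∑ i ∈ Finset.range N, |a i| := Finset.sum_nonneg fun _ _ => abs_nonneg _
  calc _ ≤ 1 / (N : ℝ) * ((∑ i ∈ Finset.range N, |a i|) * (C * (V * (L / N) ^ 2))) := by gcongr
    _ = C * L ^ 2 * V * (1 / N) ^ 2 * (1 / N * ∑ i ∈ Finset.range N, |a i|) := by ring
    _ ≤ _ := by gcongr; linarith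

/-! ### Smooth periodic functions with bounded derivatives -/

/-- `1`-periodic functions of class `C^k` whose derivatives up to order `k` are bounded by `V`. -/
structure IsSmoothBdd (k : ℕ) (V : ℝ) (v : ℝ → ℝ) : Prop where
  periodic : Function.Periodic v 1
  contDiff : ContDiff ℝ k v
  bound : ∀ j ≤ k, ∀ x, |iteratedDeriv j v x| ≤ V

theorem Function.Periodic.deriv' {f : ℝ → ℝ} {c : ℝ} (hf : Function.Periodic f c) :
    Function.Periodic (deriv f) c := by
  intro x
  rw [← deriv_comp_add_const f c x]
  congr 1
  ext y
  exact hf y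

theorem Function.Periodic.iteratedDeriv' {f : ℝ → ℝ} {c : ℝ} (hf : Function.Periodic f c) (n : ℕ) :
    Function.Periodic (iteratedDeriv n f) c := by
  induction n with
  | zero => simpa using hf
  | succ n ih => rw [iteratedDeriv_succ]; exact ih.deriv'

namespace IsSmoothBdd

variable {k : ℕ} {V : ℝ} {v : ℝ → ℝ}

theorem nonneg (h : IsSmoothBdd k V v) : 0 ≤ V := (abs_nonneg _).trans (h.bound 0 (Nat.zero_le _) 0)

theorem mono {j : ℕ} (h : IsSmoothBdd k V v) (hj : j ≤ k) : IsSmoothBdd j V v :=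
  ⟨h.periodic, h.contDiff.of_le (by exact_mod_cast hj), fun i hi => h.bound i (hi.trans hj)⟩

theorem deriv (h : IsSmoothBdd (k + 1) V v) : IsSmoothBdd k V (deriv v) := by
  refine ⟨h.periodic.deriv', ?_, fun j hj x => ?_⟩
  · exact ((contDiff_succ_iff_deriv (n := k)).1 (by exact_mod_cast h.contDiff)).2.2
  · rw [← iteratedDeriv_succ']
    exact h.bound _ (by omega) x

theorem iteratedDeriv {j : ℕ} (h : IsSmoothBdd (k + j) V v) : IsSmoothBdd k V (iteratedDeriv j v) := by
  induction j generalizing v with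
  | zero => simpa using h
  | succ j ih =>
    rw [iteratedDeriv_succ']
    exact ih (IsSmoothBdd.deriv (by rwa [add_assoc]))

theorem abs_le (h : IsSmoothBdd k V v) (x : ℝ) : |v x| ≤ V := by
  simpa using h.bound 0 (Nat.zero_le _) x

theorem abs_deriv_le (h : IsSmoothBdd k V v) (hk : 1 ≤ k) (x : ℝ) : |_root_.deriv v x| ≤ V := by
  simpa using h.bound 1 hk x

theorem bddMeas (h : IsSmoothBdd k V v) : IsBddMeas v :=
  ⟨h.contDiff.continuous.measurable, V, h.abs_le⟩

/-- Taylor's formula. -/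
theorem taylor {n : ℕ} (h : IsSmoothBdd (n + 1) V v) (x y : ℝ) :
    |v y - ∑ k ∈ Finset.range (n + 1), _root_.iteratedDeriv k v x / k.factorial * (y - x) ^ k| ≤
      V * |y - x| ^ (n + 1) := by
  rcases eq_or_ne x y with rfl | hxy
  · have : ∑ k ∈ Finset.range (n + 1), _root_.iteratedDeriv k v x / k.factorial * (x - x) ^ k = v x := by
      rw [Finset.sum_range_succ']
      simp
    rw [this, sub_self, abs_zero]
    exact mul_nonneg h.nonneg (by positivity)
  · obtain ⟨z, -, hz⟩ := taylor_mean_remainder_lagrange_iteratedDeriv (n := n) hxy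
      (f := v) (by exact_mod_cast h.contDiff.contDiffOn)
    rw [taylor_within_apply] at hz
    have e : ∑ k ∈ Finset.range (n + 1), ((k.factorial : ℝ)⁻¹ * (y - x) ^ k) •
        iteratedDerivWithin k v (uIcc x y) x =
        ∑ k ∈ Finset.range (n + 1), _root_.iteratedDeriv k v x / k.factorial * (y - x) ^ k := by
      refine Finset.sum_congr rfl fun k hk => ?_
      have hk := Finset.mem_range.1 hk
      rw [iteratedDerivWithin_eq_iteratedDeriv (uniqueDiffOn_uIcc hxy)
        ((h.contDiff.of_le (by exact_mod_cast hk.le)).contDiffAt) left_mem_uIcc, smul_eq_mul]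
      ring
    rw [e] at hz
    rw [hz, abs_div, abs_mul, abs_pow]
    have h1 : (1 : ℝ) ≤ |((n + 1).factorial : ℝ)| := by
      rw [Nat.abs_cast]
      exact_mod_cast Nat.one_le_iff_ne_zero.2 (Nat.factorial_ne_zero _)
    refine (div_le_self (by positivity) h1).trans ?_
    exact mul_le_mul_of_nonneg_right (h.bound _ le_rfl z) (by positivity)

theorem taylor_one (h : IsSmoothBdd 1 V v) (x y : ℝ) : |v y - v x| ≤ V * |y - x| := by
  simpa using h.taylor (n := 0) x y

theorem taylor_two (h : IsSmoothBdd 2 V v) (x y : ℝ) :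
    |v y - v x - _root_.deriv v x * (y - x)| ≤ V * (y - x) ^ 2 := by
  have := h.taylor (n := 1) x y
  rw [Finset.sum_range_succ, Finset.sum_range_one, sq_abs] at this
  simpa [sub_sub] using this

/-- Multiplying the two expansions gives the form of smoothness that `exists_oscillatory_bound` asks
for, without second derivatives of a product. -/
theorem mul_taylor_two {g : ℝ → ℝ} {W : ℝ} (hg : IsSmoothBdd 2 W g) (h : IsSmoothBdd 2 V v) (x y : ℝ) :
    |g y * v y - g x * v x - (_root_.deriv g x * v x + g x * _root_.deriv v x) * (y - x)| ≤
      3 * W * V * (y - x) ^ 2 := by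
  have e : g y * v y - g x * v x - (_root_.deriv g x * v x + g x * _root_.deriv v x) * (y - x) =
      (g y - g x - _root_.deriv g x * (y - x)) * v x + (g y - g x) * (_root_.deriv v x * (y - x)) +
        g y * (v y - v x - _root_.deriv v x * (y - x)) := by ring
  have hW := hg.nonneg
  have hV := h.nonneg
  have h1 : |(g y - g x - _root_.deriv g x * (y - x)) * v x| ≤ W * (y - x) ^ 2 * V := by
    rw [abs_mul]
    exact mul_le_mul (hg.taylor_two x y) (h.abs_le x) (abs_nonneg _) (by positivity)
  have h2 : |(g y - g x) * (_root_.deriv v x * (y - x))| ≤ W * |y - x| * (V * |y - x|) := by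
    rw [abs_mul, abs_mul]
    exact mul_le_mul ((hg.mono one_le_two).taylor_one x y) (by
      gcongr; exact h.abs_deriv_le one_le_two x) (by positivity) (by positivity)
  have h3 : |g y * (v y - v x - _root_.deriv v x * (y - x))| ≤ W * (V * (y - x) ^ 2) := by
    rw [abs_mul]
    exact mul_le_mul (hg.abs_le y) (h.taylor_two x y) (abs_nonneg _) hW
  have h4 : W * |y - x| * (V * |y - x|) = W * V * (y - x) ^ 2 := by rw [← sq_abs (y - x)]; ring
  rw [e]
  refine (abs_add_three _ _ _).trans ?_
  linarith

end IsSmoothBdd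

/-! ### Quasi-interpolation operators -/

/-- The operator `∑ i, v (i / N) κ (N x - i)`. -/
noncomputable def quasiOp (κ : ℝ → ℝ) (N : ℕ) (v : ℝ → ℝ) (x : ℝ) : ℝ :=
  shiftSum κ (fun i => v (i / N)) (N * x)

/-- The periodized moment `∑ i, (i - y) ^ k κ (y - i)`. -/
noncomputable def perMoment (κ : ℝ → ℝ) (k : ℕ) : ℝ → ℝ := shiftSum (fun x => (-x) ^ k * κ x) fun _ => 1

theorem quasiOp_coeff_periodic {N : ℕ} (hN : 1 ≤ N) {v : ℝ → ℝ} (hv : Function.Periodic v 1) :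
    Function.Periodic (fun i : ℤ => v (i / N)) (N : ℤ) := by
  intro i
  have hN0 : (N : ℝ) ≠ 0 := by positivity
  have : ((i + (N : ℤ) : ℤ) : ℝ) / N = i / N + 1 := by push_cast; field_simp
  simp only [this, hv _]

theorem bddMeas_quasiOp {κ : ℝ → ℝ} (hκ : IsKernel κ) {N : ℕ} (hN : 1 ≤ N) {v : ℝ → ℝ}
    (hv : Function.Periodic v 1) : IsBddMeas (quasiOp κ N v) :=
  (hκ.bddMeas_shiftSum_periodic hN (quasiOp_coeff_periodic hN hv)).comp (by fun_prop)

theorem periodic_comp_nat_mul {b : ℝ → ℝ} (hb : Function.Periodic b 1) (N : ℕ) :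
    Function.Periodic (fun x => b (N * x)) 1 := by
  intro x
  have := hb.nat_mul N (N * x)
  simp only [mul_one] at this
  simpa only [mul_add, mul_one] using this

theorem shiftSum_comp_mul_periodic {κ : ℝ → ℝ} {N : ℕ} {a : ℤ → ℝ} (ha : Function.Periodic a (N : ℤ)) :
    Function.Periodic (fun x => shiftSum κ a (N * x)) 1 := by
  intro x
  simp only [mul_add, mul_one]
  exact shiftSum_periodic ha _

theorem quasiOp_periodic {κ : ℝ → ℝ} {N : ℕ} (hN : 1 ≤ N) {v : ℝ → ℝ} (hv : Function.Periodic v 1) :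
    Function.Periodic (quasiOp κ N v) 1 :=
  shiftSum_comp_mul_periodic (quasiOp_coeff_periodic hN hv)

theorem bddMeas_perMoment {κ : ℝ → ℝ} (hκ : IsKernel κ) (k : ℕ) : IsBddMeas (perMoment κ k) :=
  (hκ.neg_pow_mul k).bddMeas_shiftSum (V := 1) (by simp)

theorem perMoment_periodic (κ : ℝ → ℝ) (k : ℕ) : Function.Periodic (perMoment κ k) 1 :=
  shiftSum_one_periodic _

theorem integral_perMoment {κ : ℝ → ℝ} (hκ : IsKernel κ) (k : ℕ) :
    ∫ y in (0 : ℝ)..1, perMoment κ k y = ∫ x, (-x) ^ k * κ x := by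
  have := integral_shiftSum_one (hκ.neg_pow_mul k) (IsBddMeas.const 1) fun _ => rfl
  simpa [perMoment] using this

/-- Each nodal value is expanded about x. As i / N - x = -(N x - i) / N, the k-th Taylor term sums
to (1 / N) ^ k times a periodized moment; the remainder sees only nodes at distance O(1 / N). -/
theorem exists_quasiOp_taylor {κ : ℝ → ℝ} (hκ : IsKernel κ) (n : ℕ) : ∃ C : ℝ, 0 < C ∧
    ∀ (N : ℕ) (v : ℝ → ℝ) (V : ℝ), 1 ≤ N → IsSmoothBdd (n + 1) V v → ∀ x,
    |quasiOp κ N v x - ∑ k ∈ Finset.range (n + 1),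
      iteratedDeriv k v x / k.factorial * (1 / N) ^ k * perMoment κ k (N * x)| ≤
      C * V * (1 / N) ^ (n + 1) := by
  obtain ⟨C, hC0, hC⟩ := abs_shiftSum_le hκ
  obtain ⟨L, hL⟩ := hκ.supp
  refine ⟨C * L ^ (n + 1) + 1, by positivity, fun N v V hN hv x => ?_⟩
  have hN0 : (0 : ℝ) < N := by exact_mod_cast hN
  have hV := hv.nonneg
  have e : quasiOp κ N v x - ∑ k ∈ Finset.range (n + 1),
      iteratedDeriv k v x / k.factorial * (1 / N) ^ k * perMoment κ k (N * x) =
      shiftSum κ (fun i => v (i / N) - ∑ k ∈ Finset.range (n + 1),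
        iteratedDeriv k v x / k.factorial * (i / N - x) ^ k) (N * x) := by
    have hy := abs_sub_floor_le (N * x) le_rfl
    rw [shiftSum_sub_coeff hκ]
    congr 1
    simp only [perMoment]
    rw [Finset.sum_congr rfl fun k _ => by
      rw [shiftSum_eq_window (L := L) (fun z hz => by rw [hL z hz, mul_zero]) hy, Finset.mul_sum]]
    rw [shiftSum_eq_window hL hy, Finset.sum_comm]
    refine Finset.sum_congr rfl fun i _ => ?_
    rw [Finset.sum_mul]
    refine Finset.sum_congr rfl fun k _ => ?_
    have : (i : ℝ) / N - x = 1 / N * -(N * x - i) := by field_simp; ring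
    rw [this, mul_pow]
    ring
  rw [e]
  have h := hC (fun i => v (i / N) - ∑ k ∈ Finset.range (n + 1),
    iteratedDeriv k v x / k.factorial * (i / N - x) ^ k) (V * (L / N) ^ (n + 1)) (N * x) (by positivity)
    fun i hi => by
      refine (hv.taylor x (i / N)).trans ?_
      have h1 : |(N : ℝ) * x - i| ≤ L := not_lt.1 fun h => hi (hL _ h)
      have h2 : |(i : ℝ) / N - x| ≤ L / N := by
        rw [show (i : ℝ) / N - x = -(N * x - i) / N by field_simp; ring, abs_div, abs_neg,
          abs_of_pos hN0]
        gcongr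
      gcongr
  refine h.trans ?_
  calc C * (V * (L / N) ^ (n + 1)) = C * L ^ (n + 1) * V * (1 / N) ^ (n + 1) := by
        rw [div_pow, div_pow]; ring
    _ ≤ _ := by gcongr; linarith

/-- A kernel `ψ` of class `C¹` with first and second derivatives `ψ'`, `ψ''`, whose quasi-interpolant
reproduces polynomials of degree at most `d`, and whose moments of orders `1, …, d + 2` vanish. -/
structure IsQuasiKernel (d : ℕ) (ψ ψ' ψ'' : ℝ → ℝ) : Prop where
  deriv_left : IsDerivKernel ψ ψ'
  deriv_right : IsDerivKernel ψ' ψ''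
  hasDerivAt : ∀ x, HasDerivAt ψ (ψ' x) x
  reproduction : ∀ m ≤ d, ∀ y, perMoment ψ m y = if m = 0 then 1 else 0
  moment : ∀ m, 1 ≤ m → m ≤ d + 2 → ∫ x, (-x) ^ m * ψ x = 0

namespace IsQuasiKernel

variable {d : ℕ} {ψ ψ' ψ'' : ℝ → ℝ}

theorem hasDerivAt_perMoment_zero {κ κ' : ℝ → ℝ} (h : IsDerivKernel κ κ') {y : ℝ}
    (hd : ∀ i : ℤ, HasDerivAt κ (κ' (y - i)) (y - i)) :
    HasDerivAt (perMoment κ 0) (perMoment κ' 0 y) y := by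
  have := hasDerivAt_shiftSum h.left h.right hd fun _ => 1
  simpa [perMoment] using this

theorem hasDerivAt_perMoment_succ {κ κ' : ℝ → ℝ} (h : IsDerivKernel κ κ') (m : ℕ) {y : ℝ}
    (hd : ∀ i : ℤ, HasDerivAt κ (κ' (y - i)) (y - i)) :
    HasDerivAt (perMoment κ (m + 1)) (-(m + 1) * perMoment κ m y + perMoment κ' (m + 1) y) y := by
  have h' := h.neg_pow_mul m
  have := hasDerivAt_shiftSum h'.left h'.right (y := y) (fun i => by
    have h1 : HasDerivAt (fun x : ℝ => (-x) ^ (m + 1)) ((m + 1 : ℕ) * (-(y - i)) ^ m * (-1)) (y - i) := by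
      simpa using (hasDerivAt_neg (y - i)).fun_pow (m + 1)
    refine (h1.mul (hd i)).congr_deriv ?_
    push_cast; ring) fun _ => 1
  rw [shiftSum_add_kernel ((h.left.neg_pow_mul _).const_mul _) (h.right.neg_pow_mul _),
    shiftSum_mul_kernel (h.left.neg_pow_mul _)] at this
  exact this

/-- The periodized moments of ψ are constant, so their derivatives, which combine a moment of ψ'
with one of ψ of lower order, vanish. -/
theorem reproduction_deriv (h : IsQuasiKernel d ψ ψ' ψ'') (m : ℕ) (hm : m ≤ d) (y : ℝ) :
    perMoment ψ' m y = if m = 1 then 1 else 0 := by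
  have hc : ∀ (k : ℕ), k ≤ d → HasDerivAt (perMoment ψ k) 0 y := fun k hk => by
    have : perMoment ψ k = fun _ => if k = 0 then (1 : ℝ) else 0 := funext (h.reproduction k hk)
    rw [this]
    exact hasDerivAt_const _ _
  cases m with
  | zero =>
    rw [(hasDerivAt_perMoment_zero h.deriv_left fun i => h.hasDerivAt _).unique (hc 0 hm)]
    simp
  | succ m =>
    have e := (hasDerivAt_perMoment_succ h.deriv_left m fun i => h.hasDerivAt _).unique (hc (m + 1) hm)
    rw [h.reproduction m (by omega)] at e
    rcases m with _ | m
    · norm_num at e ⊢; linarith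
    · simp at e ⊢; linarith

/-- A second differentiation, now possible only off the integers. Orders 0 and 1 suffice to absorb
the factor N ^ 2 in the second derivative of the quasi-interpolant. -/
theorem reproduction_deriv_two (h : IsQuasiKernel d ψ ψ' ψ'') (hd : 1 ≤ d) (m : ℕ) (hm : m ≤ 1) {y : ℝ}
    (hy : y ∉ range ((↑) : ℤ → ℝ)) : perMoment ψ'' m y = 0 := by
  have hc : ∀ (k : ℕ), k ≤ d → HasDerivAt (perMoment ψ' k) 0 y := fun k hk => by
    have : perMoment ψ' k = fun _ => if k = 1 then (1 : ℝ) else 0 := funext (h.reproduction_deriv k hk)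
    rw [this]
    exact hasDerivAt_const _ _
  have hi := fun i : ℤ => h.deriv_right.deriv (y - i) (sub_int_notMem hy i)
  obtain rfl | rfl : m = 0 ∨ m = 1 := by omega
  · exact (hasDerivAt_perMoment_zero h.deriv_right hi).unique (hc 0 (by omega))
  · have e := (hasDerivAt_perMoment_succ h.deriv_right 0 hi).unique (hc 1 hd)
    rw [h.reproduction_deriv 0 (by omega)] at e
    simpa using e

/-- The derivative of the compactly supported (-x) ^ (m + 1) ψ has integral zero, which trades a
moment of ψ' for the moment of ψ one order below. -/
theorem moment_deriv (h : IsQuasiKernel d ψ ψ' ψ'') (m : ℕ) (hm : 1 ≤ m) (hm' : m ≤ d + 2) :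
    ∫ x, (-x) ^ (m + 1) * ψ' x = 0 := by
  have e := (h.deriv_left.neg_pow_mul m).integral_eq_zero
  rw [integral_add ((h.deriv_left.left.neg_pow_mul m).const_mul _).integrable
    (h.deriv_left.right.neg_pow_mul _).integrable, integral_const_mul, h.moment m hm hm'] at e
  simpa using e

/-- The quasi-interpolation error. -/
theorem exists_abs_sub_le (h : IsQuasiKernel d ψ ψ' ψ'') : ∃ C : ℝ, 0 < C ∧ ∀ (N : ℕ) (v : ℝ → ℝ) (V : ℝ),
    1 ≤ N → IsSmoothBdd (d + 1) V v → ∀ x, |quasiOp ψ N v x - v x| ≤ C * V * (1 / N) ^ (d + 1) := by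
  obtain ⟨C, hC0, hC⟩ := exists_quasiOp_taylor h.deriv_left.left d
  refine ⟨C, hC0, fun N v V hN hv x => ?_⟩
  have := hC N v V hN hv x
  rwa [Finset.sum_eq_single_of_mem 0 (by simp) fun k hk hk0 => by
    rw [h.reproduction k (by have := Finset.mem_range.1 hk; omega), if_neg hk0, mul_zero],
    h.reproduction 0 (Nat.zero_le _), if_pos rfl, pow_zero, iteratedDeriv_zero, Nat.factorial_zero,
    Nat.cast_one, div_one, mul_one, mul_one] at this

theorem exists_abs_sub_deriv_le (h : IsQuasiKernel d ψ ψ' ψ'') (hd : 1 ≤ d) : ∃ C : ℝ, 0 < C ∧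
    ∀ (N : ℕ) (v : ℝ → ℝ) (V : ℝ), 1 ≤ N → IsSmoothBdd (d + 1) V v → ∀ x,
    |N * quasiOp ψ' N v x - deriv v x| ≤ C * V * (1 / N) ^ d := by
  obtain ⟨C, hC0, hC⟩ := exists_quasiOp_taylor h.deriv_left.right d
  refine ⟨C, hC0, fun N v V hN hv x => ?_⟩
  have hN0 : (0 : ℝ) < N := by exact_mod_cast hN
  have := hC N v V hN hv x
  rw [Finset.sum_eq_single_of_mem 1 (Finset.mem_range.2 (by omega)) fun k hk hk0 => by
    rw [h.reproduction_deriv k (by have := Finset.mem_range.1 hk; omega), if_neg hk0, mul_zero],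
    h.reproduction_deriv 1 hd, if_pos rfl, pow_one, iteratedDeriv_one, Nat.factorial_one,
    Nat.cast_one, div_one, mul_one] at this
  have e : N * quasiOp ψ' N v x - deriv v x = N * (quasiOp ψ' N v x - deriv v x * (1 / N)) := by
    field_simp
  rw [e, abs_mul, abs_of_pos hN0]
  calc _ ≤ (N : ℝ) * (C * V * (1 / N) ^ (d + 1)) := by gcongr
    _ = _ := by rw [pow_succ]; field_simp

theorem exists_abs_deriv_two_le (h : IsQuasiKernel d ψ ψ' ψ'') (hd : 1 ≤ d) : ∃ C : ℝ, 0 < C ∧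
    ∀ (N : ℕ) (v : ℝ → ℝ) (V : ℝ), 1 ≤ N → IsSmoothBdd 2 V v →
    ∀ x : ℝ, N * x ∉ range ((↑) : ℤ → ℝ) → |N ^ 2 * quasiOp ψ'' N v x| ≤ C * V := by
  obtain ⟨C, hC0, hC⟩ := exists_quasiOp_taylor h.deriv_right.right 1
  refine ⟨C, hC0, fun N v V hN hv x hx => ?_⟩
  have hN0 : (0 : ℝ) < N := by exact_mod_cast hN
  have := hC N v V hN hv x
  rw [Finset.sum_eq_zero fun k hk => by
    rw [h.reproduction_deriv_two hd k (by have := Finset.mem_range.1 hk; omega) hx, mul_zero],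
    sub_zero] at this
  rw [abs_mul, abs_of_pos (by positivity : (0 : ℝ) < N ^ 2)]
  calc _ ≤ (N : ℝ) ^ 2 * (C * V * (1 / N) ^ (1 + 1)) := by gcongr
    _ = _ := by rw [one_add_one_eq_two]; field_simp

end IsQuasiKernel

/-! ### Superconvergence of the quasi-interpolation error against splines -/

namespace IsQuasiKernel

variable {e : ℕ} {ψ ψ' ψ'' : ℝ → ℝ}

theorem abs_integral_sub_le {f g s : ℝ → ℝ} (hf : IsBddMeas f) (hg : IsBddMeas g) (hs : IsBddMeas s)
    {A B : ℝ} (h1 : |∫ x in (0 : ℝ)..1, (f x - g x) * s x| ≤ A) (h2 : |∫ x in (0 : ℝ)..1, g x * s x| ≤ B) :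
    |∫ x in (0 : ℝ)..1, f x * s x| ≤ A + B := by
  have : ∫ x in (0 : ℝ)..1, f x * s x =
      (∫ x in (0 : ℝ)..1, (f x - g x) * s x) + ∫ x in (0 : ℝ)..1, g x * s x := by
    rw [← intervalIntegral.integral_add (((hf.sub hg).mul hs).intervalIntegrable _ _)
      ((hg.mul hs).intervalIntegrable _ _)]
    exact intervalIntegral.integral_congr fun x _ => by ring
  rw [this]
  exact (abs_add_le _ _).trans (add_le_add h1 h2)

/-- Reproduction leaves one Taylor term, of order e + 3, up to a pointwise error of order e + 4. Its
periodic factor has mean zero by the moment condition, so the oscillatory bound gains two orders, of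
which one is needed. -/
theorem exists_superconvergence (h : IsQuasiKernel (e + 2) ψ ψ' ψ'') : ∃ C : ℝ, 0 < C ∧
    ∀ (N : ℕ) (v : ℝ → ℝ) (V : ℝ) (a : ℤ → ℝ), 1 ≤ N → IsSmoothBdd (e + 5) V v →
    Function.Periodic a (N : ℤ) →
    |∫ x in (0 : ℝ)..1, (quasiOp ψ N v x - v x) *
      shiftSum (backDiff (cardinalBSpline e)) a (N * x)| ≤
      C * V * (1 / N) ^ (e + 4) * (1 / N * ∑ i ∈ Finset.range N, |a i|) := by
  have hψ := h.deriv_left.left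
  have hκ := (isKernel_cardinalBSpline e).backDiff
  obtain ⟨C₁, hC₁0, hC₁⟩ := exists_quasiOp_taylor hψ (e + 3)
  obtain ⟨C₂, hC₂0, hC₂⟩ := exists_oscillatory_bound e (bddMeas_perMoment hψ (e + 3))
    (perMoment_periodic ψ _) (by rw [integral_perMoment hψ]; exact h.moment _ (by omega) (by omega))
  obtain ⟨C₃, hC₃0, hC₃⟩ := abs_integral_mul_shiftSum_le hκ
  refine ⟨C₃ * C₁ + C₂, by positivity, fun N v V a hN hv ha => ?_⟩
  have hN0 : (0 : ℝ) < N := by exact_mod_cast hN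
  have hN1 : 1 / (N : ℝ) ≤ 1 := by
    rw [div_le_one hN0]; exact_mod_cast hN
  have hV := hv.nonneg
  have hA : 0 ≤ 1 / (N : ℝ) * ∑ i ∈ Finset.range N, |a i| := by positivity
  have hw : IsSmoothBdd 2 V (iteratedDeriv (e + 3) v) :=
    IsSmoothBdd.iteratedDeriv (hv.mono (by omega))
  set w := iteratedDeriv (e + 3) v
  set c : ℝ := 1 / (e + 3).factorial * (1 / N) ^ (e + 3) with hc
  have hc0 : 0 ≤ c := by positivity
  have hc1 : c ≤ (1 / N) ^ (e + 3) := by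
    rw [hc]
    refine mul_le_of_le_one_left (by positivity) ?_
    rw [div_le_one (by positivity)]
    exact_mod_cast Nat.one_le_iff_ne_zero.2 (Nat.factorial_ne_zero _)
  set g : ℝ → ℝ := fun x => c * (w x * perMoment ψ (e + 3) (N * x)) with hg
  have hPm : IsBddMeas fun x => perMoment ψ (e + 3) (N * x) := (bddMeas_perMoment hψ _).comp (by fun_prop)
  have hgm : IsBddMeas g := (hw.bddMeas.mul hPm).const_mul c
  have hgp : Function.Periodic g 1 := by
    intro x
    simp only [hg]
    have hp := periodic_comp_nat_mul (perMoment_periodic ψ (e + 3)) N x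
    simp only at hp
    rw [hw.periodic x, hp]
  have hf : IsBddMeas fun x => quasiOp ψ N v x - v x := (bddMeas_quasiOp hψ hN hv.periodic).sub hv.bddMeas
  have hfp : Function.Periodic (fun x => quasiOp ψ N v x - v x) 1 :=
    (quasiOp_periodic hN hv.periodic).sub hv.periodic
  have hs : IsBddMeas fun x => shiftSum (backDiff (cardinalBSpline e)) a (N * x) :=
    (hκ.bddMeas_shiftSum_periodic hN ha).comp (by fun_prop)
  have h1 : |∫ x in (0 : ℝ)..1, (quasiOp ψ N v x - v x - g x) *
      shiftSum (backDiff (cardinalBSpline e)) a (N * x)| ≤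
      C₃ * (C₁ * V * (1 / N) ^ (e + 4)) * (1 / N * ∑ i ∈ Finset.range N, |a i|) := by
    refine hC₃ N _ a _ hN (hf.sub hgm) (hfp.sub hgp) ha fun x => ?_
    have := hC₁ N v V hN (hv.mono (by omega)) x
    rw [Finset.sum_range_succ, Finset.sum_eq_single_of_mem 0 (by simp) fun k hk hk0 => by
      rw [h.reproduction k (by have := Finset.mem_range.1 hk; omega), if_neg hk0, mul_zero],
      h.reproduction 0 (Nat.zero_le _), if_pos rfl, pow_zero, iteratedDeriv_zero, Nat.factorial_zero,
      Nat.cast_one, div_one, mul_one, mul_one] at this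
    refine le_trans (le_of_eq ?_) this
    congr 1
    simp only [hg, hc, w]
    ring
  have h2 : |∫ x in (0 : ℝ)..1, g x * shiftSum (backDiff (cardinalBSpline e)) a (N * x)| ≤
      C₂ * V * (1 / N) ^ (e + 4) * (1 / N * ∑ i ∈ Finset.range N, |a i|) := by
    have e1 : ∫ x in (0 : ℝ)..1, g x * shiftSum (backDiff (cardinalBSpline e)) a (N * x) =
        c * ∫ x in (0 : ℝ)..1, w x * perMoment ψ (e + 3) (N * x) *
          shiftSum (backDiff (cardinalBSpline e)) a (N * x) := by
      rw [← intervalIntegral.integral_const_mul]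
      exact intervalIntegral.integral_congr fun x _ => by simp only [hg]; ring
    rw [e1, abs_mul, abs_of_nonneg hc0]
    have := hC₂ N w (deriv w) V a hN hw.bddMeas hw.periodic hV hw.taylor_two ha
    refine (mul_le_mul hc1 this (abs_nonneg _) (by positivity)).trans ?_
    have e2 : (1 / (N : ℝ)) ^ (e + 3) * (C₂ * V * (1 / N) ^ 2 * (1 / N * ∑ i ∈ Finset.range N, |a i|)) =
        (1 / N) * (C₂ * V * (1 / N) ^ (e + 4) * (1 / N * ∑ i ∈ Finset.range N, |a i|)) := by ring
    rw [e2]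
    exact mul_le_of_le_one_left (by positivity) hN1
  refine (abs_integral_sub_le hf hgm hs h1 h2).trans (le_of_eq ?_)
  ring

/-- Differentiation costs a factor N, so the Taylor terms of orders e + 3 and e + 4 must both be
treated as oscillations; the remainder has order e + 5 before that factor. For the term of order e +
3 both powers gained are used. -/
theorem exists_superconvergence_deriv (h : IsQuasiKernel (e + 2) ψ ψ' ψ'') : ∃ C : ℝ, 0 < C ∧
    ∀ (N : ℕ) (v G : ℝ → ℝ) (V W : ℝ) (a : ℤ → ℝ), 1 ≤ N → IsSmoothBdd (e + 6) V v → IsSmoothBdd 2 W G →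
    Function.Periodic a (N : ℤ) →
    |∫ x in (0 : ℝ)..1, G x * (N * quasiOp ψ' N v x - deriv v x) *
      shiftSum (backDiff (cardinalBSpline e)) a (N * x)| ≤
      C * V * W * (1 / N) ^ (e + 4) * (1 / N * ∑ i ∈ Finset.range N, |a i|) := by
  have hψ := h.deriv_left.right
  have hκ := (isKernel_cardinalBSpline e).backDiff
  obtain ⟨C₁, hC₁0, hC₁⟩ := exists_quasiOp_taylor hψ (e + 4)
  have osc := fun j : ℕ => fun (h1 : 1 ≤ j) (h2 : j ≤ e + 4) =>
    exists_oscillatory_bound e (bddMeas_perMoment hψ (j + 1)) (perMoment_periodic ψ' _)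
      (by rw [integral_perMoment hψ]; exact h.moment_deriv j h1 h2)
  obtain ⟨C₂, hC₂0, hC₂⟩ := osc (e + 2) (by omega) (by omega)
  obtain ⟨C₃, hC₃0, hC₃⟩ := osc (e + 3) (by omega) (by omega)
  obtain ⟨C₄, hC₄0, hC₄⟩ := abs_integral_mul_shiftSum_le hκ
  refine ⟨C₄ * C₁ + (3 * C₃ + 3 * C₂), by positivity, fun N v G V W a hN hv hG ha => ?_⟩
  have hN0 : (0 : ℝ) < N := by exact_mod_cast hN
  have hN1 : 1 / (N : ℝ) ≤ 1 := by
    rw [div_le_one hN0]; exact_mod_cast hN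
  have hV := hv.nonneg
  have hW := hG.nonneg
  have hA : 0 ≤ 1 / (N : ℝ) * ∑ i ∈ Finset.range N, |a i| := by positivity
  set S : ℝ → ℝ := fun x => shiftSum (backDiff (cardinalBSpline e)) a (N * x) with hS
  have hs : IsBddMeas S := (hκ.bddMeas_shiftSum_periodic hN ha).comp (by fun_prop)
  set A := 1 / (N : ℝ) * ∑ i ∈ Finset.range N, |a i| with hAdef
  have hPm : ∀ j, IsBddMeas fun x => perMoment ψ' j (N * x) := fun j =>
    (bddMeas_perMoment hψ _).comp (by fun_prop)
  -- The j-th Taylor term of the derivative error, including the weight `G`.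
  set T : ℕ → ℝ → ℝ := fun j x => (N * (1 / j.factorial * (1 / N) ^ j)) *
    (G x * iteratedDeriv j v x * perMoment ψ' j (N * x)) with hT
  have hwj : ∀ j ≤ e + 4, IsSmoothBdd 2 V (iteratedDeriv j v) := fun j hj =>
    IsSmoothBdd.iteratedDeriv (hv.mono (by omega))
  have hTm : ∀ j ≤ e + 4, IsBddMeas (T j) := fun j hj =>
    ((hG.bddMeas.mul (hwj j hj).bddMeas).mul (hPm j)).const_mul _
  have hTp : ∀ j ≤ e + 4, Function.Periodic (T j) 1 := by
    intro j hj x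
    simp only [hT]
    have hp := periodic_comp_nat_mul (perMoment_periodic ψ' j) N x
    simp only at hp
    rw [hG.periodic x, (hwj j hj).periodic x, hp]
  have hTb : ∀ j ≤ e + 4, ∀ C : ℝ, 0 < C → (∀ (N : ℕ) (G G' : ℝ → ℝ) (V : ℝ) (a : ℤ → ℝ),
      1 ≤ N → IsBddMeas G → Function.Periodic G 1 → 0 ≤ V →
      (∀ x y, |G y - G x - G' x * (y - x)| ≤ V * (y - x) ^ 2) → Function.Periodic a (N : ℤ) →
      |∫ x in (0 : ℝ)..1, G x * perMoment ψ' j (N * x) *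
        shiftSum (backDiff (cardinalBSpline e)) a (N * x)| ≤
        C * V * (1 / N) ^ 2 * (1 / N * ∑ i ∈ Finset.range N, |a i|)) →
      e + 3 ≤ j → |∫ x in (0 : ℝ)..1, T j x * S x| ≤ 3 * C * V * W * (1 / N) ^ (e + 4) * A := by
    intro j hj C hC0 hC hej
    have hw := hwj j hj
    have := hC N (fun x => G x * iteratedDeriv j v x) _ (3 * W * V) a hN (hG.bddMeas.mul hw.bddMeas)
      (hG.periodic.mul hw.periodic) (by positivity) (hG.mul_taylor_two hw) ha
    have e1 : ∫ x in (0 : ℝ)..1, T j x * S x = (N * (1 / j.factorial * (1 / N) ^ j)) *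
        ∫ x in (0 : ℝ)..1, G x * iteratedDeriv j v x * perMoment ψ' j (N * x) *
          shiftSum (backDiff (cardinalBSpline e)) a (N * x) := by
      rw [← intervalIntegral.integral_const_mul]
      exact intervalIntegral.integral_congr fun x _ => by simp only [hT, hS]; ring
    rw [e1, abs_mul, abs_of_nonneg (by positivity : (0 : ℝ) ≤ N * (1 / j.factorial * (1 / N) ^ j))]
    have hf1 : (1 : ℝ) / j.factorial ≤ 1 := by
      rw [div_le_one (by positivity)]
      exact_mod_cast Nat.one_le_iff_ne_zero.2 (Nat.factorial_ne_zero _)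
    have hpow : (1 / (N : ℝ)) ^ j ≤ (1 / N) ^ (e + 3) := pow_le_pow_of_le_one (by positivity) hN1 hej
    calc _ ≤ N * (1 * (1 / N) ^ (e + 3)) * (C * (3 * W * V) * (1 / N) ^ 2 * A) := by gcongr
      _ = (N * (1 / N)) * (3 * C * V * W * (1 / N) ^ (e + 4) * A) := by ring
      _ = _ := by rw [mul_one_div_cancel hN0.ne', one_mul]
  have h3 := hTb (e + 3) (by omega) C₂ hC₂0 hC₂ le_rfl
  have h4 := hTb (e + 4) le_rfl C₃ hC₃0 hC₃ (by omega)
  have hv' : Function.Periodic (deriv v) 1 := hv.periodic.deriv'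
  have hvm' : IsBddMeas (deriv v) := (hv.mono (show e + 5 + 1 ≤ e + 6 by omega)).deriv.bddMeas
  set F : ℝ → ℝ := fun x => G x * (N * quasiOp ψ' N v x - deriv v x) with hF
  have hFm : IsBddMeas F :=
    hG.bddMeas.mul (((bddMeas_quasiOp hψ hN hv.periodic).const_mul _).sub hvm')
  have hFp : Function.Periodic F 1 := by
    intro x
    simp only [hF]
    rw [hG.periodic x, quasiOp_periodic hN hv.periodic x, hv' x]
  have h1 : |∫ x in (0 : ℝ)..1, (F x - T (e + 3) x - T (e + 4) x) * S x| ≤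
      C₄ * (W * (N * (C₁ * V * (1 / N) ^ (e + 5)))) * A := by
    refine hC₄ N _ a _ hN ((hFm.sub (hTm _ (by omega))).sub (hTm _ le_rfl))
      ((hFp.sub (hTp _ (by omega))).sub (hTp _ le_rfl)) ha fun x => ?_
    have := hC₁ N v V hN (hv.mono (by omega)) x
    rw [Finset.sum_range_succ, Finset.sum_range_succ,
      Finset.sum_eq_single_of_mem 1 (Finset.mem_range.2 (by omega)) fun k hk hk0 => by
      rw [h.reproduction_deriv k (by have := Finset.mem_range.1 hk; omega), if_neg hk0, mul_zero],
      h.reproduction_deriv 1 (by omega), if_pos rfl, pow_one, iteratedDeriv_one, Nat.factorial_one,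
      Nat.cast_one, div_one, mul_one] at this
    have e1 : F x - T (e + 3) x - T (e + 4) x = G x * (N * (quasiOp ψ' N v x - (deriv v x * (1 / N) +
        iteratedDeriv (e + 3) v x / (e + 3).factorial * (1 / N) ^ (e + 3) * perMoment ψ' (e + 3) (N * x) +
        iteratedDeriv (e + 4) v x / (e + 4).factorial * (1 / N) ^ (e + 4) *
          perMoment ψ' (e + 4) (N * x)))) := by
      have hNN : (N : ℝ) * (1 / N) = 1 := mul_one_div_cancel hN0.ne'
      simp only [hF, hT]
      linear_combination (G x * deriv v x) * hNN
    rw [e1, abs_mul, abs_mul, abs_of_pos hN0]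
    gcongr
    exact hG.abs_le x
  have h5 := abs_integral_sub_le (hFm.sub (hTm _ (by omega))) (hTm _ le_rfl) hs h1 h4
  refine (abs_integral_sub_le hFm (hTm _ (by omega)) hs h5 h3).trans (le_of_eq ?_)
  have : (N : ℝ) * (C₁ * V * (1 / N) ^ (e + 5)) = (N * (1 / N)) * (C₁ * V * (1 / N) ^ (e + 4)) := by ring
  rw [this, mul_one_div_cancel hN0.ne']
  ring

end IsQuasiKernel

/-! ### Thomée–Wendroff kernels -/

section kernelSum

variable {κ κ' : ℝ → ℝ}

/-- The combination of integer translates of `κ` with finitely many coefficients. -/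
noncomputable def kernelSum (κ : ℝ → ℝ) (c : ℤ →₀ ℝ) (x : ℝ) : ℝ := c.sum fun k a => a * κ (x - k)

theorem IsKernel.kernelSum (h : IsKernel κ) (c : ℤ →₀ ℝ) : IsKernel (kernelSum κ c) :=
  IsKernel.sum c.support fun k _ => (h.shift k).const_mul (c k)

theorem hasDerivAt_kernelSum (c : ℤ →₀ ℝ) {x : ℝ} (h : ∀ k : ℤ, HasDerivAt κ (κ' (x - k)) (x - k)) :
    HasDerivAt (kernelSum κ c) (kernelSum κ' c x) x :=
  HasDerivAt.fun_sum fun k _ => ((h k).comp_sub_const x k).const_mul (c k)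

theorem IsDerivKernel.kernelSum (h : IsDerivKernel κ κ') (c : ℤ →₀ ℝ) :
    IsDerivKernel (kernelSum κ c) (kernelSum κ' c) := by
  refine ⟨h.left.kernelSum c, h.right.kernelSum c, ?_, fun x hx =>
    hasDerivAt_kernelSum c fun k => h.deriv _ (sub_int_notMem hx k)⟩
  have := h.cont
  exact continuous_finsetSum _ fun k _ => by fun_prop

theorem IsDerivKernel.backDiff (h : IsDerivKernel κ κ') : IsDerivKernel (backDiff κ) (backDiff κ') := by
  refine ⟨h.left.backDiff, h.right.backDiff, ?_, fun x hx => ?_⟩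
  · have := h.cont
    exact this.sub (this.comp (continuous_id.sub continuous_const))
  · exact (h.deriv x hx).sub
      ((h.deriv (x - 1) (by simpa using sub_int_notMem hx 1)).comp_sub_const x 1)

end kernelSum

/-- Expanding x ^ m about each shift k reduces to the moments of a single B-spline of orders at most
m, which are constant. -/
theorem shiftSum_pow_kernelSum_const (d m : ℕ) (hm : m ≤ d) (c : ℤ →₀ ℝ) (y z : ℝ) :
    shiftSum (fun x => x ^ m * kernelSum (cardinalBSpline d) c x) (fun _ => 1) y =
      shiftSum (fun x => x ^ m * kernelSum (cardinalBSpline d) c x) (fun _ => 1) z := by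
  have hB := isKernel_cardinalBSpline d
  have e : (fun x => x ^ m * kernelSum (cardinalBSpline d) c x) = fun x => ∑ k ∈ c.support,
      ∑ j ∈ Finset.range (m + 1), (c k * ((k : ℝ) ^ (m - j) * m.choose j)) *
        ((x - k) ^ j * cardinalBSpline d (x - k)) := by
    ext x
    rw [kernelSum, Finsupp.sum, Finset.mul_sum]
    refine Finset.sum_congr rfl fun k _ => ?_
    conv_lhs => rw [show x ^ m = ((x - k) + k) ^ m by rw [sub_add_cancel], add_pow, Finset.sum_mul]
    exact Finset.sum_congr rfl fun j _ => by ring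
  have hk : ∀ (k : ℤ) (j : ℕ), IsKernel fun x => (x - k) ^ j * cardinalBSpline d (x - k) := fun k j =>
    (hB.pow_mul j).shift k
  have f : ∀ y, shiftSum (fun x => x ^ m * kernelSum (cardinalBSpline d) c x) (fun _ => 1) y =
      ∑ k ∈ c.support, ∑ j ∈ Finset.range (m + 1), (c k * ((k : ℝ) ^ (m - j) * m.choose j)) *
        shiftSum (fun x => x ^ j * cardinalBSpline d x) (fun _ => 1) y := by
    intro y
    rw [e, shiftSum_sum_kernel _ fun k _ => IsKernel.sum _ fun j _ => (hk k j).const_mul _]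
    refine Finset.sum_congr rfl fun k _ => ?_
    rw [shiftSum_sum_kernel _ fun j _ => (hk k j).const_mul _]
    refine Finset.sum_congr rfl fun j _ => ?_
    rw [shiftSum_mul_kernel (hk k j),
      shiftSum_shift_kernel (κ := fun x => x ^ j * cardinalBSpline d x)]
  rw [f, f]
  refine Finset.sum_congr rfl fun k _ => Finset.sum_congr rfl fun j hj => ?_
  rw [shiftSum_pow_cardinalBSpline_const d j (by have := Finset.mem_range.1 hj; omega) y z]

theorem cardinalSpline_succ (d : ℕ) (c : ℤ →₀ ℝ) :
    cardinalSpline (d + 1) c = kernelSum (cardinalBSpline d) c := rfl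

/-- The first and second derivatives of a cardinal spline. -/
theorem IsThomeeWendroff.isQuasiKernel {e : ℕ} {c : ℤ →₀ ℝ} (h : IsThomeeWendroff (e + 3) c) :
    IsQuasiKernel (e + 2) (cardinalSpline (e + 3) c)
      (kernelSum (backDiff (cardinalBSpline (e + 1))) c)
      (kernelSum (backDiff (backDiff (cardinalBSpline e))) c) := by
  have hψ := (isKernel_cardinalBSpline (e + 2)).kernelSum c
  have hm : ∀ m < 2 * (e + 3), ∫ x, (-x) ^ m * kernelSum (cardinalBSpline (e + 2)) c x =
      if m = 0 then 1 else 0 := by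
    intro m hm
    have := h.moments m hm
    rw [cardinalSpline_succ] at this
    have e1 : ∀ x : ℝ, (-x) ^ m * kernelSum (cardinalBSpline (e + 2)) c x =
        (-1) ^ m * (x ^ m * kernelSum (cardinalBSpline (e + 2)) c x) := fun x => by
      rw [neg_pow, mul_assoc]
    simp only [e1, integral_const_mul, this]
    split_ifs with h0 <;> simp [h0]
  rw [cardinalSpline_succ]
  refine ⟨(isDerivKernel_cardinalBSpline (e + 1)).kernelSum c,
    (isDerivKernel_cardinalBSpline e).backDiff.kernelSum c,
    fun x => hasDerivAt_kernelSum c fun k => hasDerivAt_cardinalBSpline e _, fun m hme y => ?_,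
    fun m h1 h2 => by rw [hm m (by omega), if_neg (by omega)]⟩
  have e1 : (fun x : ℝ => (-x) ^ m * kernelSum (cardinalBSpline (e + 2)) c x) = fun x =>
      (-1) ^ m * (x ^ m * kernelSum (cardinalBSpline (e + 2)) c x) := by
    ext x
    rw [neg_pow, mul_assoc]
  -- Constancy of the periodized moments, a property of all splines of this degree, turns the
  -- integral moment conditions into pointwise reproduction.
  rw [perMoment, eq_integral_of_const (hψ.neg_pow_mul m), hm m (by omega)]
  intro y z
  rw [e1, shiftSum_mul_kernel (hψ.pow_mul m), shiftSum_mul_kernel (hψ.pow_mul m),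
    shiftSum_pow_kernelSum_const (e + 2) m hme c y z]

/-! ### Existence of Thomée–Wendroff kernels -/

section existence

open Polynomial

/-- The `m`-th moment of the translate by `k` of a B-spline. -/
noncomputable def bsplineMoment (d m k : ℕ) : ℝ := ∫ x : ℝ, x ^ m * cardinalBSpline d (x - k)

theorem bsplineMoment_eq (d m k : ℕ) :
    bsplineMoment d m k = ∫ x : ℝ, (x + k) ^ m * cardinalBSpline d x := by
  have := integral_sub_right_eq_self (μ := volume)
    (fun x : ℝ => (x + k) ^ m * cardinalBSpline d x) (k : ℝ)
  rw [bsplineMoment, ← this]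
  simp

theorem bsplineMoment_succ (d m k : ℕ) : bsplineMoment d m (k + 1) =
    bsplineMoment d m k + ∑ j ∈ Finset.range m, m.choose j * bsplineMoment d j k := by
  have hi : ∀ j : ℕ, Integrable fun x : ℝ => (x + k) ^ j * cardinalBSpline d x := by
    intro j
    have := ((((isKernel_cardinalBSpline d).shift k).pow_mul j).integrable).comp_add_right (k : ℝ)
    simpa using this
  have e : bsplineMoment d m (k + 1) =
      ∑ j ∈ Finset.range (m + 1), m.choose j * bsplineMoment d j k := by
    simp only [bsplineMoment_eq, ← integral_const_mul]
    rw [← integral_finsetSum _ fun j _ => (hi j).const_mul _]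
    refine integral_congr_ae (Eventually.of_forall fun x => ?_)
    simp only
    rw [show x + ((k + 1 : ℕ) : ℝ) = (x + k) + 1 by push_cast; ring, add_pow, Finset.sum_mul]
    exact Finset.sum_congr rfl fun j _ => by rw [one_pow]; ring
  rw [e, Finset.sum_range_succ, Nat.choose_self, Nat.cast_one, one_mul, add_comm]

/-- The `m`-th moment of the spline with coefficients those of a polynomial. -/
noncomputable def polyMoment (d m : ℕ) : ℝ[X] →ₗ[ℝ] ℝ :=
  Polynomial.lsum fun k => bsplineMoment d m k • LinearMap.id

theorem polyMoment_monomial (d m k : ℕ) (a : ℝ) :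
    polyMoment d m (monomial k a) = bsplineMoment d m k * a := by
  simp [polyMoment, Polynomial.lsum_apply, Polynomial.sum_monomial_index]

theorem polyMoment_zero (d : ℕ) (p : ℝ[X]) : polyMoment d 0 p = p.eval 1 := by
  induction p using Polynomial.induction_on' with
  | add p q hp hq => rw [map_add, hp, hq, eval_add]
  | monomial k a =>
    rw [polyMoment_monomial, bsplineMoment_eq]
    simp [integral_cardinalBSpline]

/-- Multiplication by X translates the spline by one, and (x + 1) ^ m - x ^ m contains only lower
powers. -/
theorem polyMoment_X_sub_one_mul (d m : ℕ) (p : ℝ[X]) : polyMoment d m ((X - 1) * p) =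
    ∑ j ∈ Finset.range m, m.choose j * polyMoment d j p := by
  induction p using Polynomial.induction_on' with
  | add p q hp hq => simp only [mul_add, map_add, hp, hq, Finset.sum_add_distrib]
  | monomial k a =>
    rw [sub_mul, one_mul, X_mul_monomial, map_sub, polyMoment_monomial, polyMoment_monomial,
      bsplineMoment_succ, add_mul, add_sub_cancel_left, Finset.sum_mul]
    exact Finset.sum_congr rfl fun j _ => by rw [polyMoment_monomial, mul_assoc]

/-- Each factor X - 1 lowers the order of the moment, so K of them annihilate all orders below K; at
order K the leading binomial coefficients multiply to K!. -/
theorem polyMoment_X_sub_one_pow_mul (d K : ℕ) (p : ℝ[X]) :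
    (∀ m < K, polyMoment d m ((X - 1) ^ K * p) = 0) ∧
      polyMoment d K ((X - 1) ^ K * p) = K.factorial * p.eval 1 := by
  induction K with
  | zero => simp [polyMoment_zero]
  | succ K ih =>
    simp only [pow_succ', mul_assoc, polyMoment_X_sub_one_mul]
    refine ⟨fun m hm => Finset.sum_eq_zero fun j hj => ?_, ?_⟩
    · rw [ih.1 j (by have := Finset.mem_range.1 hj; omega), mul_zero]
    · rw [Finset.sum_range_succ, ih.2, Finset.sum_eq_zero fun j hj => by
        rw [ih.1 j (Finset.mem_range.1 hj), mul_zero], Nat.choose_succ_self_right, Nat.factorial_succ]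
      push_cast; ring

theorem exists_one_add_pow_eq {R : Type*} [CommRing R] (y : R) (n : ℕ) :
    ∃ q, (1 + y) ^ n = 1 + n * y + y ^ 2 * q := by
  induction n with
  | zero => exact ⟨0, by simp⟩
  | succ n ih =>
    obtain ⟨q, hq⟩ := ih
    refine ⟨n + q + y * q, ?_⟩
    rw [pow_succ, hq]
    push_cast; ring

/-- Adding β (X - 1)^(K+1) p would correct the next moment but might create zeros on the unit
circle. Instead p is multiplied by (1 + (β/n) (X - 1)^(K+1))^n. This agrees with 1 + β (X - 1)^(K+1)
up to a multiple of (X - 1)^(2K+2), invisible to the moments in question, and for large n its base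
is close to 1 on the circle. -/
theorem exists_poly_moments (d K : ℕ) : ∃ p : ℝ[X],
    (∀ m ≤ K, polyMoment d m p = if m = 0 then 1 else 0) ∧ ∀ z : ℂ, ‖z‖ = 1 → aeval z p ≠ 0 := by
  induction K with
  | zero =>
    refine ⟨1, fun m hm => ?_, by simp⟩
    obtain rfl : m = 0 := by omega
    simp [polyMoment_zero]
  | succ K ih =>
    obtain ⟨p, hp, hz⟩ := ih
    -- The correction changes this moment by β (K + 1)!, because p takes the value 1 at 1.
    set β : ℝ := -polyMoment d (K + 1) p / (K + 1).factorial with hβ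
    -- On the unit circle |z - 1| ≤ 2, so this n keeps the perturbation of 1 below 1 in modulus.
    obtain ⟨n, hn⟩ := exists_nat_gt (|β| * 2 ^ (K + 1))
    have hn0 : (0 : ℝ) < n := lt_of_le_of_lt (by positivity) hn
    obtain ⟨q, hq⟩ := exists_one_add_pow_eq (C (β / n) * (X - 1 : ℝ[X]) ^ (K + 1)) n
    have h1 : p.eval 1 = 1 := by rw [← polyMoment_zero d, hp 0 (Nat.zero_le _), if_pos rfl]
    have e : p * (1 + C (β / n) * (X - 1) ^ (K + 1)) ^ n = p + β • ((X - 1) ^ (K + 1) * p) +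
        (X - 1) ^ (K + 2) * ((X - 1) ^ K * (C (β / n) ^ 2 * q * p)) := by
      have hC : (n : ℝ[X]) * C (β / n) = C β := by
        rw [← C_eq_natCast, ← C_mul, mul_div_cancel₀ _ hn0.ne']
      rw [hq, smul_eq_C_mul, ← hC]
      ring
    refine ⟨p * (1 + C (β / n) * (X - 1) ^ (K + 1)) ^ n, fun m hm => ?_, fun z hz1 => ?_⟩
    · rw [e, map_add, map_add, map_smul, (polyMoment_X_sub_one_pow_mul d (K + 2) _).1 m (by omega),
        add_zero]
      rcases Nat.lt_or_ge m (K + 1) with h | h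
      · rw [(polyMoment_X_sub_one_pow_mul d (K + 1) p).1 m h, smul_zero, add_zero, hp m (by omega)]
      · obtain rfl : m = K + 1 := by omega
        rw [(polyMoment_X_sub_one_pow_mul d (K + 1) p).2, h1, if_neg (by omega), hβ, smul_eq_mul]
        have : ((K + 1).factorial : ℝ) ≠ 0 := by exact_mod_cast Nat.factorial_ne_zero _
        field_simp
        ring
    · rw [map_mul, map_pow]
      refine mul_ne_zero (hz z hz1) (pow_ne_zero _ fun h => ?_)
      rw [map_add, map_one, map_mul, map_pow, map_sub, map_one, aeval_X, aeval_C] at h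
      have h2 : ‖(algebraMap ℝ ℂ) (β / n) * (z - 1) ^ (K + 1)‖ = 1 := by
        rw [← norm_neg, ← norm_one (α := ℂ)]
        congr 1
        linear_combination -h
      rw [norm_mul, norm_pow, norm_algebraMap', Real.norm_eq_abs, abs_div, abs_of_pos hn0] at h2
      have h3 : ‖z - 1‖ ≤ 2 := (norm_sub_le _ _).trans (by rw [hz1, norm_one]; norm_num)
      have h4 : |β| / n * ‖z - 1‖ ^ (K + 1) ≤ |β| / n * 2 ^ (K + 1) := by gcongr
      have h5 : |β| / n * 2 ^ (K + 1) < 1 := by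
        rw [div_mul_eq_mul_div, div_lt_one hn0]; exact hn
      linarith

theorem exists_isThomeeWendroff (d : ℕ) : ∃ c : ℤ →₀ ℝ, IsThomeeWendroff (d + 1) c := by
  obtain ⟨p, hp, hz⟩ := exists_poly_moments d (2 * (d + 1))
  have hsum : ∀ {M : Type} [AddCommMonoid M] (h : ℤ → ℝ → M), (∀ k, h k 0 = 0) →
      (∀ k a b, h k (a + b) = h k a + h k b) →
      (∑ k ∈ p.support, Finsupp.single (k : ℤ) (p.coeff k)).sum h = ∑ k ∈ p.support, h k (p.coeff k) := by
    intro M _ h h0 ha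
    rw [← Finsupp.sum_finsetSum_index h0 ha]
    exact Finset.sum_congr rfl fun k _ => Finsupp.sum_single_index (h0 _)
  refine ⟨∑ k ∈ p.support, Finsupp.single (k : ℤ) (p.coeff k), fun m hm => ?_, fun θ => ?_⟩
  · rw [← hp m hm.le]
    have e : ∀ x, cardinalSpline (d + 1) (∑ k ∈ p.support, Finsupp.single (k : ℤ) (p.coeff k)) x =
        ∑ k ∈ p.support, p.coeff k * cardinalBSpline d (x - k) := by
      intro x
      rw [cardinalSpline, hsum _ (by simp) (fun _ _ _ => add_mul _ _ _)]
      simp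
    simp only [e, Finset.mul_sum]
    rw [integral_finsetSum]
    · simp only [polyMoment, Polynomial.lsum_apply, Polynomial.sum, bsplineMoment]
      refine Finset.sum_congr rfl fun k _ => ?_
      rw [LinearMap.smul_apply, LinearMap.id_apply, smul_eq_mul, mul_comm, ← integral_const_mul]
      congr 1; ext x; ring
    · intro k _
      have := ((((isKernel_cardinalBSpline d).shift k).pow_mul m).const_mul (p.coeff k)).integrable
      refine this.congr (Eventually.of_forall fun x => ?_)
      simp only; ring
  · rw [hsum _ (by simp) (fun _ _ _ => by push_cast; ring)]
    have := hz (Complex.exp (θ * Complex.I)) (Complex.norm_exp_ofReal_mul_I θ)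
    rw [aeval_def, eval₂_eq_sum, Polynomial.sum] at this
    convert this using 2 with k
    rw [← Complex.exp_nat_mul]
    congr 2
    push_cast; ring

end existence

/-! ### Periodic splines are combinations of B-splines -/

theorem Function.Periodic.map_emod {N : ℕ} {a : ℤ → ℝ} (ha : Function.Periodic a (N : ℤ)) (i : ℤ) :
    a (i % N) = a i := by
  have := ha.sub_zsmul_eq (i / N) (x := i)
  rw [← this]; congr 1
  rw [Int.emod_def, smul_eq_mul, mul_comm]

/-- Partial sums over one period; the vanishing total is what makes them close up at the
wrap-around. -/
theorem exists_periodic_backward_difference {N : ℕ} (hN : 1 ≤ N) {a : ℤ → ℝ}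
    (ha : Function.Periodic a (N : ℤ)) (h0 : ∑ i ∈ Finset.range N, a i = 0) :
    ∃ b : ℤ → ℝ, Function.Periodic b (N : ℤ) ∧ ∀ i, b i - b (i - 1) = a i := by
  have hN' : (0 : ℤ) < N := by omega
  refine ⟨fun i => ∑ j ∈ Finset.range ((i % N).toNat + 1), a j, fun i => ?_, fun i => ?_⟩
  · simp only [Int.add_emod_right]
  · have h1 := Int.emod_nonneg i hN'.ne'
    have h2 := Int.emod_lt_of_pos i hN'
    rcases h1.eq_or_lt with h | h
    · have e : (i - 1) % N = N - 1 := by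
        rw [Int.sub_emod, ← h, zero_sub]
        rcases Nat.lt_or_ge 1 N with h' | h'
        · rw [Int.emod_eq_of_lt zero_le_one (by omega), ← Int.add_emod_right]
          rw [Int.emod_eq_of_lt] <;> omega
        · obtain rfl : N = 1 := by omega
          simp
      simp only [e, ← h]
      rw [show ((N : ℤ) - 1).toNat + 1 = N by omega, h0]
      have := ha.map_emod i
      rw [← h] at this
      simp [this]
    · have e : (i - 1) % N = i % N - 1 := by
        rw [Int.sub_emod, Int.emod_eq_of_lt zero_le_one (by omega), Int.emod_eq_of_lt] <;> omega
      simp only [e]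
      rw [show (i % (N : ℤ) - 1).toNat + 1 = (i % N).toNat by omega, Finset.sum_range_succ,
        add_sub_cancel_left, Int.toNat_of_nonneg h1, ha.map_emod]

theorem sum_coeff_eq_integral {n N : ℕ} (hN : 1 ≤ N) {a : ℤ → ℝ} (ha : Function.Periodic a (N : ℤ)) :
    ∑ i ∈ Finset.range N, a i = ∫ y in (0 : ℝ)..N, shiftSum (cardinalBSpline n) a y := by
  have hN0 : (N : ℝ) ≠ 0 := by positivity
  have h1 := integral_mul_shiftSum (isKernel_cardinalBSpline n) hN (IsBddMeas.const 1) (fun _ => rfl) ha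
  simp only [one_mul, integral_cardinalBSpline, mul_one] at h1
  have h2 := intervalIntegral.mul_integral_comp_mul_left (a := 0) (b := 1)
      (f := shiftSum (cardinalBSpline n) a) (N : ℝ)
  rw [mul_zero, mul_one] at h2
  rw [← h2, h1, ← mul_assoc, mul_one_div_cancel hN0, one_mul]

/-- Periodicity of `f` forces the coefficients of its derivative to sum to zero, so they are a
periodic difference. The B-spline sum with the summed coefficients has the same derivative, and the
partition of unity absorbs the additive constant. -/
theorem exists_coeff_of_integral {n N : ℕ} (hN : 1 ≤ N) {f : ℝ → ℝ} (hf : Function.Periodic f N)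
    {a : ℤ → ℝ} (ha : Function.Periodic a (N : ℤ))
    (h : ∀ y, f y = f 0 + ∫ t in (0 : ℝ)..y, shiftSum (cardinalBSpline n) a t) :
    ∃ b : ℤ → ℝ, Function.Periodic b (N : ℤ) ∧ f = shiftSum (cardinalBSpline (n + 1)) b := by
  have h0 : ∑ i ∈ Finset.range N, a i = 0 := by
    rw [sum_coeff_eq_integral (n := n) hN ha]
    have := h N
    rw [show f N = f 0 by simpa using hf 0] at this
    linarith
  obtain ⟨b, hb, hba⟩ := exists_periodic_backward_difference hN ha h0
  have hB := isKernel_cardinalBSpline n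
  have hB' := isKernel_cardinalBSpline (n + 1)
  set c := f 0 - shiftSum (cardinalBSpline (n + 1)) b 0
  refine ⟨fun i => b i + c * 1, fun i => by simp only [hb i], ?_⟩
  ext y
  rw [shiftSum_add_coeff hB', shiftSum_mul_coeff hB', shiftSum_cardinalBSpline_one, h y]
  have e1 : ∀ t, shiftSum (cardinalBSpline n) a t = shiftSum (backDiff (cardinalBSpline n)) b t := by
    intro t
    rw [shiftSum_backDiff hB]
    congr 1; ext i; exact (hba i).symm
  simp only [e1]
  rw [(isDerivKernel_cardinalBSpline n).integral_shiftSum (hb.abs_le_sum_range hN)]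
  ring

/-- Induction on the degree through the derivative. The base case is a continuous piecewise linear
function, whose derivative is a step function. -/
theorem exists_coeff_of_piecewisePoly {N : ℕ} (hN : 1 ≤ N) (n : ℕ) {f : ℝ → ℝ}
    (hf : Function.Periodic f N) (hc : ContDiff ℝ n f) (hp : IsPiecewisePoly (n + 1) f) :
    ∃ b : ℤ → ℝ, Function.Periodic b (N : ℤ) ∧ f = shiftSum (cardinalBSpline (n + 1)) b := by
  induction n generalizing f with
  | zero =>
    -- The slope on the cell, read off from two interior points at distance 1/2.
    set a : ℤ → ℝ := fun i => 2 * (f (i + 3 / 4) - f (i + 1 / 4)) with ha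
    have hap : Function.Periodic a (N : ℤ) := by
      intro i
      have h1 : ∀ t : ℝ, f (((i + (N : ℤ) : ℤ) : ℝ) + t) = f (i + t) := fun t => by
        rw [← hf (i + t)]; congr 1; push_cast; ring
      simp only [ha, h1]
    refine exists_coeff_of_integral (n := 0) hN hf hap fun y => ?_
    have hB := (isKernel_cardinalBSpline 0).bddMeas_shiftSum_periodic hN hap
    have := MeasureTheory.integral_eq_of_hasDerivAt_off_countable (a := 0) (b := y) f
      (shiftSum (cardinalBSpline 0) a) (countable_range ((↑) : ℤ → ℝ)) hc.continuous.continuousOn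
      (fun t ht => ?_) (hB.intervalIntegrable _ _)
    · rw [this]; ring
    · obtain ⟨p, hpd, hpf⟩ := hp ⌊t⌋
      have hne : (⌊t⌋ : ℝ) ≠ t := fun h => ht.2 ⟨_, h⟩
      have ht' : t ∈ Ioo (⌊t⌋ : ℝ) (⌊t⌋ + 1) :=
        ⟨lt_of_le_of_ne (Int.floor_le t) hne, Int.lt_floor_add_one t⟩
      have hpx : p = Polynomial.C (p.coeff 1) * Polynomial.X + Polynomial.C (p.coeff 0) :=
        Polynomial.eq_X_add_C_of_natDegree_le_one hpd
      have hev : ∀ x, p.eval x = p.coeff 1 * x + p.coeff 0 := fun x => by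
        conv_lhs => rw [hpx]
        simp
      rw [shiftSum_cardinalBSpline_zero]
      have hal : a ⌊t⌋ = p.coeff 1 := by
        simp only [ha]
        rw [hpf _ (by constructor <;> linarith), hpf _ (by constructor <;> linarith), hev, hev]
        ring
      rw [hal]
      have hd : HasDerivAt (fun x => p.coeff 1 * x + p.coeff 0) (p.coeff 1) t := by
        simpa using ((hasDerivAt_id t).const_mul (p.coeff 1)).add_const (p.coeff 0)
      refine hd.congr_of_eventuallyEq ?_
      filter_upwards [Ioo_mem_nhds ht'.1 ht'.2] with x hx
      rw [hpf x hx, hev]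
  | succ n ih =>
    have hc' := contDiff_succ_iff_deriv.1 (show ContDiff ℝ ((n : WithTop ℕ∞) + 1) f by exact_mod_cast hc)
    obtain ⟨a, ha, hfa⟩ := ih (f := deriv f) hf.deriv' hc'.2.2 fun i => by
      obtain ⟨p, hpd, hpf⟩ := hp i
      refine ⟨p.derivative, (Polynomial.natDegree_derivative_le p).trans (by omega), fun x hx => ?_⟩
      rw [← Polynomial.deriv]
      refine Filter.EventuallyEq.deriv_eq ?_
      filter_upwards [Ioo_mem_nhds hx.1 hx.2] with t ht using hpf t ht
    refine exists_coeff_of_integral hN hf ha fun y => ?_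
    rw [← hfa, intervalIntegral.integral_deriv_eq_sub (fun x _ => hc'.1 x)
      (hc'.2.2.continuous.intervalIntegrable _ _)]
    ring

theorem exists_coeff_of_mem_periodicSplines {e N : ℕ} (hN : 1 ≤ N) {φ : ℝ → ℝ}
    (hφ : φ ∈ periodicSplines (e + 3) N) : ∃ a : ℤ → ℝ, Function.Periodic a (N : ℤ) ∧
      φ = fun x => shiftSum (cardinalBSpline (e + 2)) a (N * x) := by
  have hN0 : (0 : ℝ) < N := by exact_mod_cast hN
  have hN' : (0 : ℤ) < N := by omega
  obtain ⟨hp, hc, hpoly⟩ := hφ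
  have hPP : IsPiecewisePoly (e + 1 + 1) fun y => φ (y / N) := by
    intro i
    have h1 := Int.emod_nonneg i hN'.ne'
    have h2 := Int.emod_lt_of_pos i hN'
    -- The definition speaks of the cells of one period; every other cell is translated back by the
    -- whole number `i / N` of periods.
    obtain ⟨p, hpd, hpf⟩ := hpoly (i % N).toNat (by omega)
    refine ⟨p.comp (Polynomial.C (1 / (N : ℝ)) * Polynomial.X - Polynomial.C ((i / N : ℤ) : ℝ)),
      ?_, fun y hy => ?_⟩
    · refine (Polynomial.natDegree_comp_le).trans ?_
      have h3 : (Polynomial.C (1 / (N : ℝ)) * Polynomial.X - Polynomial.C ((i / N : ℤ) : ℝ)).natDegree ≤ 1 := by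
        refine (Polynomial.natDegree_sub_C).trans_le ((Polynomial.natDegree_C_mul_le _ _).trans ?_)
        exact Polynomial.natDegree_X_le
      calc _ ≤ (e + 2) * 1 := Nat.mul_le_mul hpd h3
        _ = _ := by ring
    · have e1 : φ (y / N) = φ (y / N - (i / N : ℤ)) := by
        have := hp.sub_int_mul_eq (i / N) (x := y / N)
        simpa using this.symm
      have e2 : ((i % N).toNat : ℝ) = i - N * (i / N : ℤ) := by
        have : ((i % N).toNat : ℤ) = i - N * (i / N) := by
          rw [Int.toNat_of_nonneg h1, Int.emod_def]
        exact_mod_cast this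
      beta_reduce
      rw [e1, hpf]
      · simp only [Polynomial.eval_comp, Polynomial.eval_sub, Polynomial.eval_mul, Polynomial.eval_C,
          Polynomial.eval_X]
        congr 1; ring
      · rw [e2]
        constructor
        · rw [div_le_iff₀ hN0, sub_mul, div_mul_cancel₀ _ hN0.ne']
          nlinarith [hy.1]
        · rw [le_div_iff₀ hN0, sub_mul, div_mul_cancel₀ _ hN0.ne']
          nlinarith [hy.2]
  obtain ⟨a, ha, h⟩ := exists_coeff_of_piecewisePoly hN (e + 1) (f := fun y => φ (y / N)) (fun y => by
      simp only [add_div, div_self hN0.ne', hp _]) (hc.comp (by fun_prop)) hPP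
  refine ⟨a, ha, ?_⟩
  ext x
  have := congrFun h (N * x)
  simp only [mul_div_cancel_left₀ _ hN0.ne'] at this
  exact this

theorem shiftSum_mem_periodicSplines {e N : ℕ} (hN : 1 ≤ N) {κ : ℝ → ℝ} (hκ : IsKernel κ)
    (hc : ContDiff ℝ (e + 1 : ℕ) κ) (hp : IsPiecewisePoly (e + 2) κ) {a : ℤ → ℝ}
    (ha : Function.Periodic a (N : ℤ)) : (fun x => shiftSum κ a (N * x)) ∈ periodicSplines (e + 3) N := by
  have hN0 : (0 : ℝ) < N := by exact_mod_cast hN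
  have hsc := contDiff_shiftSum hκ hc a
  refine ⟨shiftSum_comp_mul_periodic ha, hsc.comp (by fun_prop), fun i _ => ?_⟩
  obtain ⟨p, hpd, hpf⟩ := (hp.shiftSum hκ a).eval_Icc hsc.continuous i
  refine ⟨p.comp (Polynomial.C (N : ℝ) * Polynomial.X), ?_, fun x hx => ?_⟩
  · refine (Polynomial.natDegree_comp_le).trans ?_
    have h3 : (Polynomial.C (N : ℝ) * Polynomial.X).natDegree ≤ 1 :=
      (Polynomial.natDegree_C_mul_le _ _).trans Polynomial.natDegree_X_le
    calc _ ≤ (e + 2) * 1 := Nat.mul_le_mul hpd h3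
      _ = _ := by omega
  · beta_reduce
    rw [hpf]
    · simp
    · rw [mem_Icc, div_le_iff₀ hN0, le_div_iff₀ hN0] at hx
      simp only [Int.cast_natCast]
      constructor <;> linarith [hx.1, hx.2]

theorem bspline_shiftSum_mem {e N : ℕ} (hN : 1 ≤ N) {a : ℤ → ℝ} (ha : Function.Periodic a (N : ℤ)) :
    (fun x => shiftSum (cardinalBSpline (e + 2)) a (N * x)) ∈ periodicSplines (e + 3) N :=
  shiftSum_mem_periodicSplines hN (isKernel_cardinalBSpline _) (contDiff_cardinalBSpline (e + 1))
    (isPiecewisePoly_cardinalBSpline _) ha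

theorem quasiOp_mem_periodicSplines {e N : ℕ} (hN : 1 ≤ N) (c : ℤ →₀ ℝ) {v : ℝ → ℝ}
    (hv : Function.Periodic v 1) :
    quasiOp (cardinalSpline (e + 3) c) N v ∈ periodicSplines (e + 3) N := by
  refine shiftSum_mem_periodicSplines hN ((isKernel_cardinalBSpline (e + 2)).kernelSum c) ?_ ?_
    (quasiOp_coeff_periodic hN hv)
  · refine ContDiff.sum fun k _ => contDiff_const.mul ?_
    exact (contDiff_cardinalBSpline (e + 1)).comp (contDiff_id.sub contDiff_const)
  · exact IsPiecewisePoly.sum _ fun k _ => ((isPiecewisePoly_cardinalBSpline (e + 2)).shift k).const_mul _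

/-- The periodized basis function for j collects the translates with index congruent to j modulo N,
and periodicity of v makes their coefficients equal. -/
theorem quasiInterpolant_eq_quasiOp {e N : ℕ} (hN : 1 ≤ N) (c : ℤ →₀ ℝ) {v : ℝ → ℝ}
    (hv : Function.Periodic v 1) :
    quasiInterpolant (e + 3) c N v = quasiOp (cardinalSpline (e + 3) c) N v := by
  ext x
  have hN0 : (N : ℝ) ≠ 0 := by positivity
  have hN' : (0 : ℤ) < N := by omega
  set ψ := cardinalSpline (e + 3) c
  have hψ : IsKernel ψ := (isKernel_cardinalBSpline (e + 2)).kernelSum c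
  set F : ℤ → ℝ := fun i => v (i / N) * ψ (N * x - i) with hF
  have hFs : (Function.support F).Finite := by
    obtain ⟨L, hL⟩ := hψ.supp
    refine (Finset.Icc (⌊N * x⌋ - (L + 1 : ℕ)) (⌊N * x⌋ + (L + 1 : ℕ))).finite_toSet.subset fun i hi => ?_
    refine mem_window (abs_sub_floor_le (N * x) le_rfl) (not_lt.1 fun h => hi ?_)
    simp [hF, hL _ h]
  have h1 : ∀ j : ℕ, v (j / N) * quasiBasis (e + 3) c N j x =
      ∑ᶠ i : ℤ, if i % N = (j : ℤ) % N then F i else 0 := by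
    intro j
    have hinj : Function.Injective fun l : ℤ => (j : ℤ) + N * l := fun a b h => by
      simpa [show N ≠ 0 by omega] using h
    rw [quasiBasis, ← smul_eq_mul, smul_finsum]
    have e1 : ∀ l : ℤ, v (j / N) • cardinalSpline (e + 3) c (N * (x - l) - j) = F (j + N * l) := by
      intro l
      simp only [hF, smul_eq_mul]
      congr 1
      · have := hv.int_mul l (j / N)
        rw [mul_one] at this
        rw [← this]; congr 1; push_cast; field_simp
      · congr 1; push_cast; ring
    rw [finsum_congr e1, ← finsum_mem_range (f := F) hinj, finsum_mem_def]
    refine finsum_congr fun i => ?_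
    by_cases h : i % N = (j : ℤ) % N
    · rw [if_pos h, indicator_of_mem]
      refine ⟨(i - j) / N, ?_⟩
      have : (N : ℤ) ∣ i - j := Int.ModEq.dvd (show (j : ℤ) ≡ i [ZMOD N] from h.symm)
      simp only
      rw [Int.mul_ediv_cancel' this]; ring
    · rw [if_neg h, indicator_of_notMem]
      rintro ⟨l, rfl⟩
      exact h (by simp)
  rw [quasiInterpolant, Finset.sum_congr rfl fun j _ => h1 j, ← finsum_sum_comm]
  · refine finsum_congr fun i => ?_
    have hm0 := Int.emod_nonneg i hN'.ne'
    have hm1 := Int.emod_lt_of_pos i hN'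
    -- The nodes are numbered from 1 to N, so N represents the residue 0.
    set j₀ : ℕ := if i % N = 0 then N else (i % N).toNat with hj₀
    have hj0 : 1 ≤ j₀ ∧ j₀ ≤ N ∧ (j₀ : ℤ) % N = i % N := by
      rw [hj₀]; split_ifs with h
      · simp [h, hN]
      · refine ⟨by omega, by omega, ?_⟩
        rw [Int.toNat_of_nonneg hm0, Int.emod_emod]
    rw [Finset.sum_eq_single_of_mem j₀ (Finset.mem_Icc.2 ⟨hj0.1, hj0.2.1⟩), if_pos hj0.2.2.symm]
    intro j hj hne
    have hj := Finset.mem_Icc.1 hj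
    rw [if_neg]
    intro h
    rw [← hj0.2.2] at h
    have hd : (N : ℤ) ∣ (j₀ : ℤ) - j := Int.ModEq.dvd (show (j : ℤ) ≡ j₀ [ZMOD N] from h.symm)
    obtain ⟨k, hk⟩ := hd
    have h3 : |(N : ℤ) * k| < N := by rw [← hk, abs_lt]; omega
    have h4 : k = 0 := by
      by_contra hk0
      rw [abs_mul, abs_of_pos hN'] at h3
      have := Int.one_le_abs hk0
      nlinarith
    rw [h4] at hk
    omega
  · intro j _
    refine hFs.subset fun i hi => ?_
    by_contra h0
    exact hi (by simp only [Function.notMem_support.1 h0, ite_self])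

/-! ### Periodic Lipschitz functions -/

/-- `1`-periodic Lipschitz functions. -/
structure IsPerLip (f : ℝ → ℝ) : Prop where
  periodic : Function.Periodic f 1
  lipschitz : ∃ K : ℝ≥0, LipschitzWith K f

namespace IsPerLip

variable {f g : ℝ → ℝ}

theorem bddMeas (hf : IsPerLip f) : IsBddMeas f := by
  obtain ⟨K, hK⟩ := hf.lipschitz
  refine ⟨hK.continuous.measurable, |f 0| + K, fun x => ?_⟩
  have h1 : f x = f (Int.fract x) := by
    have := hf.periodic.sub_int_mul_eq ⌊x⌋ (x := x)
    rw [mul_one] at this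
    rw [← this, Int.fract]
  have h2 := hK.dist_le_mul (Int.fract x) 0
  rw [Real.dist_eq, Real.dist_eq, sub_zero, abs_of_nonneg (Int.fract_nonneg x)] at h2
  have h3 : (K : ℝ) * Int.fract x ≤ K := mul_le_of_le_one_right K.2 (Int.fract_lt_one x).le
  rw [h1]
  have := abs_sub_abs_le_abs_sub (f (Int.fract x)) (f 0)
  linarith

/-- The Lipschitz bound holds at every point, since `deriv` takes the value 0 where the function is
not differentiable. -/
theorem deriv_bddMeas (hf : IsPerLip f) : IsBddMeas (deriv f) := by
  obtain ⟨K, hK⟩ := hf.lipschitz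
  exact ⟨measurable_deriv f, K, fun x => norm_deriv_le_of_lipschitz hK⟩

theorem ae_differentiableAt (hf : IsPerLip f) : ∀ᵐ x, DifferentiableAt ℝ f x := by
  obtain ⟨K, hK⟩ := hf.lipschitz
  exact hK.ae_differentiableAt_real

theorem absolutelyContinuous (hf : IsPerLip f) (a b : ℝ) : AbsolutelyContinuousOnInterval f a b := by
  obtain ⟨K, hK⟩ := hf.lipschitz
  exact hK.lipschitzOnWith.absolutelyContinuousOnInterval

theorem mul (hf : IsPerLip f) (hg : IsPerLip g) : IsPerLip fun x => f x * g x := by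
  obtain ⟨K, hK⟩ := hf.lipschitz
  obtain ⟨L, hL⟩ := hg.lipschitz
  obtain ⟨A, hA0, hA⟩ := hf.bddMeas.exists_pos
  obtain ⟨B, hB0, hB⟩ := hg.bddMeas.exists_pos
  refine ⟨hf.periodic.mul hg.periodic, ⟨A * L + B * K, by positivity⟩, LipschitzWith.of_dist_le_mul fun x y => ?_⟩
  have h1 := hK.dist_le_mul x y
  have h2 := hL.dist_le_mul x y
  rw [Real.dist_eq] at h1 h2 ⊢
  have e : f x * g x - f y * g y = f x * (g x - g y) + (f x - f y) * g y := by ring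
  rw [e]
  refine (abs_add_le _ _).trans ?_
  rw [abs_mul, abs_mul]
  calc |f x| * |g x - g y| + |f x - f y| * |g y| ≤ A * (L * dist x y) + (K * dist x y) * B := by
        gcongr
        · exact hA x
        · exact hB y
    _ = (A * L + B * K) * dist x y := by ring

theorem add (hf : IsPerLip f) (hg : IsPerLip g) : IsPerLip fun x => f x + g x := by
  obtain ⟨K, hK⟩ := hf.lipschitz
  obtain ⟨L, hL⟩ := hg.lipschitz
  exact ⟨hf.periodic.add hg.periodic, K + L, hK.add hL⟩

theorem const_mul (c : ℝ) (hf : IsPerLip f) : IsPerLip fun x => c * f x :=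
  mul (f := fun _ => c) ⟨fun _ => rfl, 0, LipschitzWith.const c⟩ hf

/-- Integration by parts over a period. -/
theorem integral_mul_deriv (hf : IsPerLip f) (hg : IsPerLip g) :
    ∫ x in (0 : ℝ)..1, f x * deriv g x = -∫ x in (0 : ℝ)..1, deriv f x * g x := by
  rw [(hf.absolutelyContinuous 0 1).integral_mul_deriv_eq_deriv_mul (hg.absolutelyContinuous 0 1)]
  have h1 := hf.periodic 0
  have h2 := hg.periodic 0
  rw [zero_add] at h1 h2
  rw [h1, h2, sub_self, zero_sub]

theorem ae_deriv_mul (hf : IsPerLip f) (hg : IsPerLip g) :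
    ∀ᵐ x, deriv (fun x => f x * g x) x = deriv f x * g x + f x * deriv g x := by
  filter_upwards [hf.ae_differentiableAt, hg.ae_differentiableAt] with x h1 h2
  exact deriv_fun_mul h1 h2

end IsPerLip

/-- Two integrands that agree almost everywhere have the same integral. -/
theorem integral_congr_of_ae {f g : ℝ → ℝ} {a b : ℝ} (h : ∀ᵐ x, f x = g x) :
    ∫ x in a..b, f x = ∫ x in a..b, g x :=
  intervalIntegral.integral_congr_ae (h.mono fun _ hx _ => hx)

/-! ### Periodic functions with Lipschitz derivative -/

/-- `1`-periodic differentiable functions with Lipschitz derivative. -/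
structure IsPerW2 (f : ℝ → ℝ) : Prop where
  periodic : Function.Periodic f 1
  differentiable : Differentiable ℝ f
  lip_deriv : ∃ K : ℝ≥0, LipschitzWith K (deriv f)

namespace IsPerW2

variable {f g : ℝ → ℝ}

theorem deriv_perLip (hf : IsPerW2 f) : IsPerLip (deriv f) := ⟨hf.periodic.deriv', hf.lip_deriv⟩

theorem perLip (hf : IsPerW2 f) : IsPerLip f := by
  obtain ⟨K, hK0, hK⟩ := hf.deriv_perLip.bddMeas.exists_pos
  refine ⟨hf.periodic, ⟨K, hK0.le⟩, lipschitzWith_of_nnnorm_deriv_le hf.differentiable fun x => ?_⟩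
  exact hK x

theorem bddMeas (hf : IsPerW2 f) : IsBddMeas f := hf.perLip.bddMeas

theorem bddMeas_deriv (hf : IsPerW2 f) : IsBddMeas (deriv f) := hf.perLip.deriv_bddMeas

theorem iteratedDeriv_two : iteratedDeriv 2 f = deriv (deriv f) := by
  rw [iteratedDeriv_succ, iteratedDeriv_one]

theorem bddMeas_deriv_two (hf : IsPerW2 f) : IsBddMeas (iteratedDeriv 2 f) := by
  rw [iteratedDeriv_two]
  exact hf.deriv_perLip.deriv_bddMeas

theorem deriv_add (hf : IsPerW2 f) (hg : IsPerW2 g) :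
    deriv (fun x => f x + g x) = fun x => deriv f x + deriv g x :=
  funext fun x => deriv_fun_add (hf.differentiable x) (hg.differentiable x)

theorem deriv_const_mul (c : ℝ) (hf : IsPerW2 f) :
    deriv (fun x => c * f x) = fun x => c * deriv f x :=
  funext fun x => _root_.deriv_const_mul c (hf.differentiable x)

/-- Second derivatives may fail to exist at the knots, for instance for quadratic splines, so
linearity holds almost everywhere only; this is enough under an integral. -/
theorem ae_deriv_two_add (hf : IsPerW2 f) (hg : IsPerW2 g) : ∀ᵐ x,
    iteratedDeriv 2 (fun x => f x + g x) x = iteratedDeriv 2 f x + iteratedDeriv 2 g x := by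
  simp only [iteratedDeriv_two, hf.deriv_add hg]
  filter_upwards [hf.deriv_perLip.ae_differentiableAt, hg.deriv_perLip.ae_differentiableAt] with x h1 h2
  exact deriv_fun_add h1 h2

theorem ae_deriv_two_const_mul (c : ℝ) (hf : IsPerW2 f) : ∀ᵐ x,
    iteratedDeriv 2 (fun x => c * f x) x = c * iteratedDeriv 2 f x := by
  simp only [iteratedDeriv_two, hf.deriv_const_mul]
  filter_upwards [hf.deriv_perLip.ae_differentiableAt] with x h1
  exact _root_.deriv_const_mul c h1

theorem add (hf : IsPerW2 f) (hg : IsPerW2 g) : IsPerW2 fun x => f x + g x := by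
  refine ⟨hf.periodic.add hg.periodic, hf.differentiable.add hg.differentiable, ?_⟩
  rw [hf.deriv_add hg]
  exact (hf.deriv_perLip.add hg.deriv_perLip).lipschitz

theorem const_mul (c : ℝ) (hf : IsPerW2 f) : IsPerW2 fun x => c * f x := by
  refine ⟨(hf.perLip.const_mul c).periodic, hf.differentiable.const_mul c, ?_⟩
  rw [hf.deriv_const_mul]
  exact (hf.deriv_perLip.const_mul c).lipschitz

theorem sub (hf : IsPerW2 f) (hg : IsPerW2 g) : IsPerW2 fun x => f x - g x := by
  have := hf.add (hg.const_mul (-1))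
  simpa [sub_eq_add_neg] using this

end IsPerW2

theorem IsSmoothBdd.perW2 {k : ℕ} {V : ℝ} {v : ℝ → ℝ} (h : IsSmoothBdd (k + 2) V v) : IsPerW2 v := by
  have h1 : IsSmoothBdd (k + 1) V (_root_.deriv v) := h.deriv
  refine ⟨h.periodic, h.contDiff.differentiable (by simp), ⟨V, h.nonneg⟩, ?_⟩
  refine lipschitzWith_of_nnnorm_deriv_le (h1.contDiff.differentiable (by simp)) fun x => ?_
  exact h1.abs_deriv_le (by omega) x

/-! ### The `L²` norm -/

section l2

variable {f g : ℝ → ℝ}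

theorem l2Inner_self_nonneg (f : ℝ → ℝ) : 0 ≤ l2Inner f f :=
  intervalIntegral.integral_nonneg zero_le_one fun _ _ => mul_self_nonneg _

theorem l2Norm_nonneg (f : ℝ → ℝ) : 0 ≤ l2Norm f := Real.sqrt_nonneg _

theorem l2Norm_sq (f : ℝ → ℝ) : l2Norm f ^ 2 = l2Inner f f := Real.sq_sqrt (l2Inner_self_nonneg f)

theorem l2Inner_comm (f g : ℝ → ℝ) : l2Inner f g = l2Inner g f := by
  simp only [l2Inner, mul_comm]

theorem l2Inner_add_left {h : ℝ → ℝ} (hf : IsBddMeas f) (hg : IsBddMeas g) (hh : IsBddMeas h) :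
    l2Inner (fun x => f x + g x) h = l2Inner f h + l2Inner g h := by
  simp only [l2Inner, add_mul]
  exact intervalIntegral.integral_add ((hf.mul hh).intervalIntegrable _ _)
    ((hg.mul hh).intervalIntegrable _ _)

theorem l2Inner_const_mul_left (c : ℝ) (f g : ℝ → ℝ) : l2Inner (fun x => c * f x) g = c * l2Inner f g := by
  simp only [l2Inner, mul_assoc, intervalIntegral.integral_const_mul]

/-- The Cauchy–Schwarz inequality. -/
theorem abs_l2Inner_le (hf : IsBddMeas f) (hg : IsBddMeas g) : |l2Inner f g| ≤ l2Norm f * l2Norm g := by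
  have h : ∀ t : ℝ, 0 ≤ l2Inner g g * (t * t) + 2 * l2Inner f g * t + l2Inner f f := by
    intro t
    have e : l2Inner (fun x => f x + t * g x) (fun x => f x + t * g x) =
        l2Inner g g * (t * t) + 2 * l2Inner f g * t + l2Inner f f := by
      have hg' := hg.const_mul t
      rw [l2Inner_add_left hf hg' (hf.add hg'), l2Inner_comm f, l2Inner_comm (fun x => t * g x),
        l2Inner_add_left hf hg' hf, l2Inner_add_left hf hg' hg', l2Inner_const_mul_left,
        l2Inner_const_mul_left, l2Inner_comm f fun x => t * g x, l2Inner_const_mul_left,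
        l2Inner_comm g fun x => t * g x, l2Inner_const_mul_left, l2Inner_comm g f]
      ring
    rw [← e]
    exact l2Inner_self_nonneg _
  have hd := discrim_le_zero h
  rw [discrim] at hd
  refine abs_le_of_sq_le_sq ?_ (mul_nonneg (l2Norm_nonneg _) (l2Norm_nonneg _))
  rw [mul_pow, l2Norm_sq, l2Norm_sq]
  linarith

theorem abs_integral_le_of_ae_le {ε : ℝ} (h : ∀ᵐ x, |f x| ≤ ε) :
    |∫ x in (0 : ℝ)..1, f x| ≤ ε := by
  have := intervalIntegral.norm_integral_le_of_norm_le (a := (0 : ℝ)) (b := 1) (f := f) (g := fun _ => ε)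
    zero_le_one (h.mono fun x hx _ => hx) intervalIntegrable_const
  simpa using this

theorem l2Norm_le_of_ae_le {ε : ℝ} (hε : 0 ≤ ε) (h : ∀ᵐ x, |f x| ≤ ε) :
    l2Norm f ≤ ε := by
  rw [l2Norm]
  refine Real.sqrt_le_iff.2 ⟨hε, (le_abs_self _).trans (abs_integral_le_of_ae_le ?_)⟩
  filter_upwards [h] with x hx
  rw [abs_mul, ← sq]
  gcongr

/-- A bounded weight can be taken out of an `L²` pairing. -/
theorem abs_integral_mul_le {w : ℝ → ℝ} (hf : IsBddMeas f) (hg : IsBddMeas g) {B : ℝ}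
    (hB : ∀ᵐ x, |w x| ≤ B) : |∫ x in (0 : ℝ)..1, w x * f x * g x| ≤ B * (l2Norm f * l2Norm g) := by
  have hB0 : 0 ≤ B := by
    obtain ⟨x, hx⟩ := hB.exists
    exact (abs_nonneg _).trans hx
  have h1 : |∫ x in (0 : ℝ)..1, w x * f x * g x| ≤ ∫ x in (0 : ℝ)..1, B * (|f x| * |g x|) := by
    refine intervalIntegral.norm_integral_le_of_norm_le (f := fun x => w x * f x * g x) zero_le_one
      (hB.mono fun x hx _ => ?_) (((hf.abs.mul hg.abs).const_mul B).intervalIntegrable _ _)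
    rw [Real.norm_eq_abs, abs_mul, abs_mul, mul_assoc]
    gcongr
  have habs : ∀ f : ℝ → ℝ, l2Norm (fun x => |f x|) = l2Norm f := fun f => by
    simp only [l2Norm, l2Inner, abs_mul_abs_self]
  have h2 := abs_l2Inner_le hf.abs hg.abs
  rw [habs, habs] at h2
  rw [intervalIntegral.integral_const_mul] at h1
  refine h1.trans ?_
  gcongr
  exact (le_abs_self _).trans h2

theorem abs_integral_mul_le_one {w : ℝ → ℝ} (hf : IsBddMeas f) {B : ℝ}
    (hB : ∀ᵐ x, |w x| ≤ B) : |∫ x in (0 : ℝ)..1, w x * f x| ≤ B * l2Norm f := by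
  have := abs_integral_mul_le hf (IsBddMeas.const 1) hB
  have h1 : l2Norm (fun _ => 1) = 1 := by simp [l2Norm, l2Inner]
  simpa [h1] using this

theorem h1Inner_self (f : ℝ → ℝ) : h1Inner f f = l2Norm f ^ 2 + l2Norm (deriv f) ^ 2 := by
  rw [h1Inner, l2Norm_sq, l2Norm_sq]

theorem l2Norm_le_sqrt_h1Inner (f : ℝ → ℝ) : l2Norm f ≤ Real.sqrt (h1Inner f f) := by
  rw [h1Inner_self]
  exact Real.le_sqrt_of_sq_le (by nlinarith [sq_nonneg (l2Norm (deriv f))])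

theorem l2Norm_deriv_le_sqrt_h1Inner (f : ℝ → ℝ) : l2Norm (deriv f) ≤ Real.sqrt (h1Inner f f) := by
  rw [h1Inner_self]
  exact Real.le_sqrt_of_sq_le (by nlinarith [sq_nonneg (l2Norm f)])

end l2

/-! ### The Camassa–Holm form -/

theorem l2Inner_congr_ae {f g k : ℝ → ℝ} (h : ∀ᵐ x, f x = g x) : l2Inner f k = l2Inner g k :=
  integral_congr_of_ae (h.mono fun x hx => by rw [hx])

theorem l2Inner_add_right {f g h : ℝ → ℝ} (hf : IsBddMeas f) (hg : IsBddMeas g) (hh : IsBddMeas h) :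
    l2Inner h (fun x => f x + g x) = l2Inner h f + l2Inner h g := by
  rw [l2Inner_comm, l2Inner_add_left hf hg hh, l2Inner_comm f, l2Inner_comm g]

theorem l2Inner_const_mul_right (c : ℝ) (f g : ℝ → ℝ) : l2Inner g (fun x => c * f x) = c * l2Inner g f := by
  rw [l2Inner_comm, l2Inner_const_mul_left, l2Inner_comm]

/-- The trilinear form `3 (w z', φ) + ½ (w' z', φ') + (w z'', φ')`. -/
noncomputable def chForm (w z φ : ℝ → ℝ) : ℝ :=
  3 * l2Inner (fun x => w x * deriv z x) φ + 1 / 2 * l2Inner (fun x => deriv w x * deriv z x) (deriv φ) +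
    l2Inner (fun x => w x * iteratedDeriv 2 z x) (deriv φ)

section chForm

variable {f g w z φ : ℝ → ℝ}

theorem chForm_add_left (hf : IsPerW2 f) (hg : IsPerW2 g) (hz : IsPerW2 z) (hφ : IsPerW2 φ) :
    chForm (fun x => f x + g x) z φ = chForm f z φ + chForm g z φ := by
  simp only [chForm, hf.deriv_add hg, add_mul]
  rw [l2Inner_add_left (hf.bddMeas.mul hz.bddMeas_deriv) (hg.bddMeas.mul hz.bddMeas_deriv) hφ.bddMeas,
    l2Inner_add_left (hf.bddMeas_deriv.mul hz.bddMeas_deriv) (hg.bddMeas_deriv.mul hz.bddMeas_deriv)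
      hφ.bddMeas_deriv,
    l2Inner_add_left (hf.bddMeas.mul hz.bddMeas_deriv_two) (hg.bddMeas.mul hz.bddMeas_deriv_two)
      hφ.bddMeas_deriv]
  ring

theorem chForm_const_mul_left (c : ℝ) (hf : IsPerW2 f) :
    chForm (fun x => c * f x) z φ = c * chForm f z φ := by
  simp only [chForm, hf.deriv_const_mul, mul_assoc, l2Inner_const_mul_left]
  ring

theorem chForm_add_mid (hf : IsPerW2 f) (hg : IsPerW2 g) (hw : IsPerW2 w) (hφ : IsPerW2 φ) :
    chForm w (fun x => f x + g x) φ = chForm w f φ + chForm w g φ := by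
  have h2 := l2Inner_congr_ae (k := deriv φ) ((hf.ae_deriv_two_add hg).mono fun x hx =>
    show w x * iteratedDeriv 2 (fun x => f x + g x) x = w x * iteratedDeriv 2 f x + w x * iteratedDeriv 2 g x by
      rw [hx, mul_add])
  rw [chForm, h2]
  simp only [chForm, hf.deriv_add hg, mul_add]
  rw [l2Inner_add_left (hw.bddMeas.mul hf.bddMeas_deriv) (hw.bddMeas.mul hg.bddMeas_deriv) hφ.bddMeas,
    l2Inner_add_left (hw.bddMeas_deriv.mul hf.bddMeas_deriv) (hw.bddMeas_deriv.mul hg.bddMeas_deriv)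
      hφ.bddMeas_deriv,
    l2Inner_add_left (hw.bddMeas.mul hf.bddMeas_deriv_two) (hw.bddMeas.mul hg.bddMeas_deriv_two)
      hφ.bddMeas_deriv]
  ring

theorem chForm_const_mul_mid (c : ℝ) (hf : IsPerW2 f) :
    chForm w (fun x => c * f x) φ = c * chForm w f φ := by
  have h2 := l2Inner_congr_ae (k := deriv φ) ((hf.ae_deriv_two_const_mul c).mono fun x hx =>
    show w x * iteratedDeriv 2 (fun x => c * f x) x = c * (w x * iteratedDeriv 2 f x) by rw [hx]; ring)
  rw [chForm, h2]
  simp only [chForm, hf.deriv_const_mul, mul_left_comm _ c, l2Inner_const_mul_left]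
  ring

theorem chForm_add_right (hf : IsPerW2 f) (hg : IsPerW2 g) (hw : IsPerW2 w) (hz : IsPerW2 z) :
    chForm w z (fun x => f x + g x) = chForm w z f + chForm w z g := by
  simp only [chForm, hf.deriv_add hg]
  rw [l2Inner_add_right hf.bddMeas hg.bddMeas (hw.bddMeas.mul hz.bddMeas_deriv),
    l2Inner_add_right hf.bddMeas_deriv hg.bddMeas_deriv (hw.bddMeas_deriv.mul hz.bddMeas_deriv),
    l2Inner_add_right hf.bddMeas_deriv hg.bddMeas_deriv (hw.bddMeas.mul hz.bddMeas_deriv_two)]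
  ring

theorem chForm_const_mul_right (c : ℝ) (hf : IsPerW2 f) :
    chForm w z (fun x => c * f x) = c * chForm w z f := by
  simp only [chForm, hf.deriv_const_mul, l2Inner_const_mul_right]
  ring

/-- Conservation of the energy. -/
theorem chForm_self (hw : IsPerW2 w) : chForm w w w = 0 := by
  have h1 := (hw.perLip.mul hw.perLip).integral_mul_deriv hw.perLip
  rw [integral_congr_of_ae ((hw.perLip.ae_deriv_mul hw.perLip).mono fun x hx =>
    show deriv (fun x => w x * w x) x * w x = 2 * (w x * deriv w x * w x) by rw [hx]; ring),
    intervalIntegral.integral_const_mul] at h1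
  rw [integral_congr_of_ae (g := fun x => w x * deriv w x * w x) (.of_forall fun x => by ring)] at h1
  -- The first term of the form integrates a multiple of the derivative of w³. For the other two, ∫
  -- w ((w')²)' = -∫ (w')³ makes them cancel.
  have hd := hw.deriv_perLip
  have h2 := hw.perLip.integral_mul_deriv (hd.mul hd)
  rw [integral_congr_of_ae ((hd.ae_deriv_mul hd).mono fun x hx =>
    show w x * deriv (fun x => deriv w x * deriv w x) x = 2 * (w x * deriv (deriv w) x * deriv w x) by
      rw [hx]; ring), intervalIntegral.integral_const_mul] at h2
  rw [integral_congr_of_ae (f := fun x => deriv w x * (deriv w x * deriv w x))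
    (g := fun x => deriv w x * deriv w x * deriv w x) (.of_forall fun x => by ring)] at h2
  simp only [chForm, l2Inner, IsPerW2.iteratedDeriv_two]
  linarith

/-- Integrating w ((φ')²)' by parts cancels the two terms tested with φ', among them the one with
φ''. Hence no derivative is lost in the stability estimate. -/
theorem chForm_right_eq (hw : IsPerW2 w) (hφ : IsPerW2 φ) :
    chForm w φ φ = 3 * l2Inner (fun x => w x * deriv φ x) φ := by
  have hd := hφ.deriv_perLip
  have h2 := hw.perLip.integral_mul_deriv (hd.mul hd)
  rw [integral_congr_of_ae ((hd.ae_deriv_mul hd).mono fun x hx =>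
    show w x * deriv (fun x => deriv φ x * deriv φ x) x = 2 * (w x * deriv (deriv φ) x * deriv φ x) by
      rw [hx]; ring), intervalIntegral.integral_const_mul] at h2
  rw [integral_congr_of_ae (f := fun x => deriv w x * (deriv φ x * deriv φ x))
    (g := fun x => deriv w x * deriv φ x * deriv φ x) (.of_forall fun x => by ring)] at h2
  simp only [chForm, l2Inner, IsPerW2.iteratedDeriv_two]
  linarith

/-- The Camassa–Holm form is stable around a function with bounded second derivative. -/
theorem abs_chForm_sub_le {U : ℝ → ℝ} (hw : IsPerW2 w) (hU : IsPerW2 U) {B : ℝ} (h0 : ∀ x, |U x| ≤ B)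
    (h1 : ∀ x, |deriv U x| ≤ B) (h2 : ∀ᵐ x, |iteratedDeriv 2 U x| ≤ B) :
    |chForm w w (fun x => w x - U x) - chForm U U (fun x => w x - U x)| ≤
      15 / 2 * B * h1Inner (fun x => w x - U x) (fun x => w x - U x) := by
  have hθ := hw.sub hU
  set θ := fun x => w x - U x with hθe
  have e : w = fun x => U x + θ x := by ext x; simp [hθe]
  have hB : 0 ≤ B := (abs_nonneg _).trans (h0 0)
  -- The term cubic in θ vanishes by `chForm_self`, so no bound on w enters.
  have key : chForm w w θ - chForm U U θ = chForm U θ θ + chForm θ U θ := by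
    rw [e, chForm_add_left hU hθ (hU.add hθ) hθ, chForm_add_mid hU hθ hU hθ, chForm_add_mid hU hθ hθ hθ,
      chForm_self hθ]
    ring
  rw [key, chForm_right_eq hU hθ, h1Inner_self, chForm]
  have b1 : |l2Inner (fun x => U x * deriv θ x) θ| ≤ B * (l2Norm (deriv θ) * l2Norm θ) :=
    abs_integral_mul_le hθ.bddMeas_deriv hθ.bddMeas (.of_forall h0)
  have b2 : |l2Inner (fun x => θ x * deriv U x) θ| ≤ B * (l2Norm θ * l2Norm θ) := by
    simp only [mul_comm (θ _)]
    exact abs_integral_mul_le hθ.bddMeas hθ.bddMeas (.of_forall h1)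
  have b3 : |l2Inner (fun x => deriv θ x * deriv U x) (deriv θ)| ≤
      B * (l2Norm (deriv θ) * l2Norm (deriv θ)) := by
    simp only [mul_comm (deriv θ _)]
    exact abs_integral_mul_le hθ.bddMeas_deriv hθ.bddMeas_deriv (.of_forall h1)
  have b4 : |l2Inner (fun x => θ x * iteratedDeriv 2 U x) (deriv θ)| ≤
      B * (l2Norm θ * l2Norm (deriv θ)) := by
    simp only [mul_comm (θ _)]
    exact abs_integral_mul_le hθ.bddMeas hθ.bddMeas_deriv h2
  have h3 : l2Norm θ * l2Norm (deriv θ) ≤ 1 / 2 * (l2Norm θ ^ 2 + l2Norm (deriv θ) ^ 2) := by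
    nlinarith [sq_nonneg (l2Norm θ - l2Norm (deriv θ))]
  have h4 := mul_le_mul_of_nonneg_left h3 hB
  have h5 := mul_nonneg hB (sq_nonneg (l2Norm θ))
  have h6 := mul_nonneg hB (sq_nonneg (l2Norm (deriv θ)))
  rw [abs_le] at *
  constructor <;> nlinarith

/-- The consistency error of the Camassa–Holm form for a perturbation `U` of `u`. -/
theorem abs_chForm_sub_le_of_perturbation {u U : ℝ → ℝ} (hu : IsPerW2 u) (hU : IsPerW2 U) (hφ : IsPerW2 φ)
    {V ε δ D : ℝ} (hu0 : ∀ x, |u x| ≤ V) (hu2 : ∀ᵐ x, |iteratedDeriv 2 u x| ≤ V)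
    (h0 : ∀ x, |U x - u x| ≤ ε) (h1 : ∀ x, |deriv U x - deriv u x| ≤ δ)
    (h2 : ∀ᵐ x, |iteratedDeriv 2 U x| ≤ D) :
    |chForm U U φ - chForm u u φ| ≤
      |∫ x in (0 : ℝ)..1, u x * (deriv U x - deriv u x) * iteratedDeriv 2 φ x| +
        (4 * V * ε + 3 * ε * δ + 1 / 2 * δ ^ 2 + (D + V) * ε) * Real.sqrt (h1Inner φ φ) := by
  have hρ := hU.sub hu
  have hV0 : 0 ≤ V := (abs_nonneg _).trans (hu0 0)
  have hε0 : 0 ≤ ε := (abs_nonneg _).trans (h0 0)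
  have hδ0 : 0 ≤ δ := (abs_nonneg _).trans (h1 0)
  have hρ2 : ∀ᵐ x, |iteratedDeriv 2 (fun x => U x - u x) x| ≤ D + V := by
    have := hU.ae_deriv_two_add (hu.const_mul (-1))
    filter_upwards [this, hu.ae_deriv_two_const_mul (-1), hu2, h2] with x a b c d
    rw [b] at a
    have e : (fun x => U x - u x) = fun x => U x + -1 * u x := by ext; ring
    rw [e, a]
    rw [abs_le] at *
    constructor <;> linarith
  have hρ1 : deriv (fun x => U x - u x) = fun x => deriv U x - deriv u x :=
    funext fun x => deriv_fun_sub (hU.differentiable x) (hu.differentiable x)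
  rw [show (∫ x in (0 : ℝ)..1, u x * (deriv U x - deriv u x) * iteratedDeriv 2 φ x) =
    ∫ x in (0 : ℝ)..1, u x * deriv (fun x => U x - u x) x * iteratedDeriv 2 φ x by rw [hρ1]]
  replace h1 : ∀ x, |deriv (fun x => U x - u x) x| ≤ δ := by rwa [hρ1]
  set ρ := fun x => U x - u x with hρe
  have e : U = fun x => u x + ρ x := by ext x; simp [hρe]
  have key : chForm U U φ - chForm u u φ = chForm u ρ φ + chForm ρ u φ + chForm ρ ρ φ := by
    rw [e, chForm_add_left hu hρ (hu.add hρ) hφ, chForm_add_mid hu hρ hu hφ, chForm_add_mid hu hρ hρ hφ]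
    ring
  -- The first-order terms tested with φ combine to (u ρ)', so only ρ itself, of the better size ε,
  -- remains.
  have i1 := (hu.perLip.mul hρ.perLip).integral_mul_deriv hφ.perLip
  rw [integral_congr_of_ae ((hu.perLip.ae_deriv_mul hρ.perLip).mono fun x hx =>
    show deriv (fun x => u x * ρ x) x * φ x = ρ x * deriv u x * φ x + u x * deriv ρ x * φ x by
      rw [hx]; ring),
    intervalIntegral.integral_add
      (((hρ.bddMeas.mul hu.bddMeas_deriv).mul hφ.bddMeas).intervalIntegrable _ _)
      (((hu.bddMeas.mul hρ.bddMeas_deriv).mul hφ.bddMeas).intervalIntegrable _ _)] at i1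
  -- The terms linear in ρ with u' ρ' and u ρ'' combine to (u ρ')'. Moving the derivative onto φ'
  -- leaves the pairing of u ρ' with φ'', the one left to superconvergence.
  have i2 := (hu.perLip.mul hρ.deriv_perLip).integral_mul_deriv hφ.deriv_perLip
  rw [integral_congr_of_ae ((hu.perLip.ae_deriv_mul hρ.deriv_perLip).mono fun x hx =>
    show deriv (fun x => u x * deriv ρ x) x * deriv φ x =
      deriv u x * deriv ρ x * deriv φ x + u x * deriv (deriv ρ) x * deriv φ x by rw [hx]; ring),
    intervalIntegral.integral_add
      (((hu.bddMeas_deriv.mul hρ.bddMeas_deriv).mul hφ.bddMeas_deriv).intervalIntegrable _ _)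
      (((hu.bddMeas.mul hρ.deriv_perLip.deriv_bddMeas).mul hφ.bddMeas_deriv).intervalIntegrable _ _)] at i2
  have c1 : |∫ x in (0 : ℝ)..1, u x * ρ x * deriv φ x| ≤ V * ε * l2Norm (deriv φ) :=
    abs_integral_mul_le_one hφ.bddMeas_deriv (.of_forall fun x => by
      rw [abs_mul]; exact mul_le_mul (hu0 x) (h0 x) (abs_nonneg _) hV0)
  have c2 : |∫ x in (0 : ℝ)..1, ρ x * iteratedDeriv 2 u x * deriv φ x| ≤ ε * V * l2Norm (deriv φ) :=
    abs_integral_mul_le_one hφ.bddMeas_deriv (hu2.mono fun x hx => by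
      rw [abs_mul]; exact mul_le_mul (h0 x) hx (abs_nonneg _) hε0)
  have c3 : |∫ x in (0 : ℝ)..1, ρ x * deriv ρ x * φ x| ≤ ε * δ * l2Norm φ :=
    abs_integral_mul_le_one hφ.bddMeas (.of_forall fun x => by
      rw [abs_mul]; exact mul_le_mul (h0 x) (h1 x) (abs_nonneg _) hε0)
  have c4 : |∫ x in (0 : ℝ)..1, deriv ρ x * deriv ρ x * deriv φ x| ≤ δ * δ * l2Norm (deriv φ) :=
    abs_integral_mul_le_one hφ.bddMeas_deriv (.of_forall fun x => by
      rw [abs_mul]; exact mul_le_mul (h1 x) (h1 x) (abs_nonneg _) hδ0)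
  have c5 : |∫ x in (0 : ℝ)..1, ρ x * iteratedDeriv 2 ρ x * deriv φ x| ≤ ε * (D + V) * l2Norm (deriv φ) :=
    abs_integral_mul_le_one hφ.bddMeas_deriv (hρ2.mono fun x hx => by
      rw [abs_mul]; exact mul_le_mul (h0 x) hx (abs_nonneg _) hε0)
  have hDV : 0 ≤ D + V := by
    obtain ⟨x, hx⟩ := hρ2.exists
    exact (abs_nonneg _).trans hx
  have n0 := l2Norm_le_sqrt_h1Inner φ
  have n1 := l2Norm_deriv_le_sqrt_h1Inner φ
  have key2 : chForm U U φ - chForm u u φ =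
      -3 * (∫ x in (0 : ℝ)..1, u x * ρ x * deriv φ x)
      - (∫ x in (0 : ℝ)..1, u x * deriv ρ x * iteratedDeriv 2 φ x)
      + (∫ x in (0 : ℝ)..1, ρ x * iteratedDeriv 2 u x * deriv φ x)
      + 3 * (∫ x in (0 : ℝ)..1, ρ x * deriv ρ x * φ x)
      + 1 / 2 * (∫ x in (0 : ℝ)..1, deriv ρ x * deriv ρ x * deriv φ x)
      + ∫ x in (0 : ℝ)..1, ρ x * iteratedDeriv 2 ρ x * deriv φ x := by
    rw [key]
    simp only [chForm, l2Inner, IsPerW2.iteratedDeriv_two]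
    simp only [mul_comm (deriv ρ _) (deriv u _)]
    linarith
  rw [key2]
  have m1 := mul_le_mul_of_nonneg_left n1 (mul_nonneg hV0 hε0)
  have m2 := mul_le_mul_of_nonneg_left n1 (mul_nonneg hε0 hV0)
  have m3 := mul_le_mul_of_nonneg_left n0 (mul_nonneg hε0 hδ0)
  have m4 := mul_le_mul_of_nonneg_left n1 (mul_nonneg hδ0 hδ0)
  have m5 := mul_le_mul_of_nonneg_left n1 (mul_nonneg hε0 hDV)
  calc _ ≤ 3 * |∫ x in (0 : ℝ)..1, u x * ρ x * deriv φ x|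
      + |∫ x in (0 : ℝ)..1, u x * deriv ρ x * iteratedDeriv 2 φ x|
      + |∫ x in (0 : ℝ)..1, ρ x * iteratedDeriv 2 u x * deriv φ x|
      + 3 * |∫ x in (0 : ℝ)..1, ρ x * deriv ρ x * φ x|
      + 1 / 2 * |∫ x in (0 : ℝ)..1, deriv ρ x * deriv ρ x * deriv φ x|
      + |∫ x in (0 : ℝ)..1, ρ x * iteratedDeriv 2 ρ x * deriv φ x| := by
        refine (abs_add_le _ _).trans (add_le_add_left ((abs_add_le _ _).trans (add_le_add ((abs_add_le _ _).trans
          (add_le_add ((abs_add_le _ _).trans (add_le_add_left ((abs_sub _ _).trans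
            (add_le_add_left ?_ _)) _)) ?_)) ?_)) _)
        · rw [abs_mul]; norm_num
        · rw [abs_mul]; norm_num
        · rw [abs_mul]; norm_num
    _ ≤ _ := by nlinarith

end chForm

/-! ### Splines and quasi-interpolants as periodic functions with Lipschitz derivative -/

theorem l2Norm_const_mul (c : ℝ) (f : ℝ → ℝ) : l2Norm (fun x => c * f x) = |c| * l2Norm f := by
  rw [l2Norm, l2Inner_const_mul_left, l2Inner_const_mul_right, ← mul_assoc, ← sq,
    Real.sqrt_mul (sq_nonneg c), Real.sqrt_sq_eq_abs, l2Norm]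

theorem ae_nat_mul_notMem_int {N : ℕ} (hN : 1 ≤ N) : ∀ᵐ x : ℝ, (N : ℝ) * x ∉ range ((↑) : ℤ → ℝ) := by
  have hN0 : (N : ℝ) ≠ 0 := by positivity
  exact ((countable_range ((↑) : ℤ → ℝ)).preimage (mul_right_injective₀ hN0)).ae_notMem volume

section scaled

variable {κ κ' κ'' : ℝ → ℝ} {N : ℕ} {a : ℤ → ℝ}

theorem hasDerivAt_shiftSum_comp_mul (h : IsDerivKernel κ κ') (hd : ∀ x, HasDerivAt κ (κ' x) x)
    (N : ℕ) (a : ℤ → ℝ) (x : ℝ) :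
    HasDerivAt (fun x => shiftSum κ a (N * x)) (N * shiftSum κ' a (N * x)) x := by
  have h1 := hasDerivAt_shiftSum h.left h.right (y := N * x) (fun i => hd _) a
  have h2 : HasDerivAt (fun x : ℝ => (N : ℝ) * x) N x := by simpa using (hasDerivAt_id x).const_mul (N : ℝ)
  rw [mul_comm]
  exact h1.comp x h2

theorem deriv_shiftSum_comp_mul (h : IsDerivKernel κ κ') (hd : ∀ x, HasDerivAt κ (κ' x) x)
    (N : ℕ) (a : ℤ → ℝ) :
    deriv (fun x => shiftSum κ a (N * x)) = fun x => N * shiftSum κ' a (N * x) :=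
  funext fun x => (hasDerivAt_shiftSum_comp_mul h hd N a x).deriv

theorem iteratedDeriv_two_shiftSum_comp_mul (h : IsDerivKernel κ κ') (hd : ∀ x, HasDerivAt κ (κ' x) x)
    (h' : IsDerivKernel κ' κ'') (N : ℕ) (a : ℤ → ℝ) {x : ℝ} (hx : (N : ℝ) * x ∉ range ((↑) : ℤ → ℝ)) :
    iteratedDeriv 2 (fun x => shiftSum κ a (N * x)) x = N ^ 2 * shiftSum κ'' a (N * x) := by
  rw [IsPerW2.iteratedDeriv_two, deriv_shiftSum_comp_mul h hd]
  have h1 := h'.hasDerivAt_shiftSum a hx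
  have h2 : HasDerivAt (fun x : ℝ => (N : ℝ) * x) N x := by simpa using (hasDerivAt_id x).const_mul (N : ℝ)
  exact ((h1.comp x h2).const_mul (N : ℝ)).deriv.trans (by ring)

theorem perW2_shiftSum_comp_mul (h : IsDerivKernel κ κ') (hd : ∀ x, HasDerivAt κ (κ' x) x)
    (h' : IsDerivKernel κ' κ'') (hN : 1 ≤ N) (ha : Function.Periodic a (N : ℤ)) :
    IsPerW2 fun x => shiftSum κ a (N * x) := by
  refine ⟨shiftSum_comp_mul_periodic ha, fun x =>
    (hasDerivAt_shiftSum_comp_mul h hd N a x).differentiableAt, ?_⟩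
  rw [deriv_shiftSum_comp_mul h hd]
  obtain ⟨K, hK0, hK⟩ := (h'.right.bddMeas_shiftSum_periodic hN ha).exists_pos
  refine ⟨⟨N * (K * N), by positivity⟩, LipschitzWith.of_dist_le_mul fun x y => ?_⟩
  have h1 := h'.integral_shiftSum (a := a) (ha.abs_le_sum_range hN) (N * y) (N * x)
  rw [Real.dist_eq, ← mul_sub, ← h1, abs_mul, Nat.abs_cast, Real.dist_eq]
  have h2 := intervalIntegral.norm_integral_le_of_norm_le_const (a := N * y) (b := N * x)
    (f := shiftSum κ'' a) (C := K) fun t _ => hK t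
  rw [Real.norm_eq_abs, ← mul_sub, abs_mul, Nat.abs_cast] at h2
  calc (N : ℝ) * |∫ t in (N * y)..(N * x), shiftSum κ'' a t| ≤ N * (K * (N * |x - y|)) := by gcongr
    _ = N * (K * N) * |x - y| := by ring

end scaled

theorem perW2_of_mem_periodicSplines {e N : ℕ} (hN : 1 ≤ N) {φ : ℝ → ℝ}
    (hφ : φ ∈ periodicSplines (e + 3) N) : IsPerW2 φ := by
  obtain ⟨a, ha, rfl⟩ := exists_coeff_of_mem_periodicSplines hN hφ
  exact perW2_shiftSum_comp_mul (isDerivKernel_cardinalBSpline (e + 1)) (hasDerivAt_cardinalBSpline e)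
    (isDerivKernel_cardinalBSpline e).backDiff hN ha

/-- The second derivative of a spline, in terms of first differences of B-spline coefficients that
are controlled by the first derivative. -/
theorem exists_deriv_two_coeff (e : ℕ) : ∃ C : ℝ, 0 < C ∧ ∀ (N : ℕ) (φ : ℝ → ℝ), 1 ≤ N →
    φ ∈ periodicSplines (e + 3) N → ∃ b : ℤ → ℝ, Function.Periodic b (N : ℤ) ∧
      (∀ᵐ x, iteratedDeriv 2 φ x = N ^ 2 * shiftSum (backDiff (cardinalBSpline e)) b (N * x)) ∧
      1 / (N : ℝ) * ∑ i ∈ Finset.range N, |b i| ≤ C * (1 / N * l2Norm (deriv φ)) := by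
  obtain ⟨C, hC0, hC⟩ := exists_sum_abs_le_l2Norm e
  refine ⟨C, hC0, fun N φ hN hφ => ?_⟩
  obtain ⟨a, ha, rfl⟩ := exists_coeff_of_mem_periodicSplines hN hφ
  have hN0 : (N : ℝ) ≠ 0 := by positivity
  -- With b the first differences, φ' is N times a B-spline sum with coefficients b, so stability
  -- bounds b by φ' / N; the second difference in φ'' is kept on the kernel.
  have hb : Function.Periodic (fun i => a i - a (i - 1)) (N : ℤ) := fun i => by
    simp only [ha i, show i + (N : ℤ) - 1 = i - 1 + N by ring, ha (i - 1)]
  have h1 := isDerivKernel_cardinalBSpline (e + 1)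
  have hd := hasDerivAt_cardinalBSpline e
  refine ⟨_, hb, ?_, (hC N _ hN hb).trans_eq ?_⟩
  · filter_upwards [ae_nat_mul_notMem_int hN] with x hx
    rw [iteratedDeriv_two_shiftSum_comp_mul h1 hd (isDerivKernel_cardinalBSpline e).backDiff N a hx,
      shiftSum_backDiff (isKernel_cardinalBSpline e).backDiff]
  · rw [deriv_shiftSum_comp_mul h1 hd, l2Norm_const_mul, Nat.abs_cast, one_div, inv_mul_cancel_left₀ hN0]
    simp only [shiftSum_backDiff (isKernel_cardinalBSpline (e + 1))]

/-- `U` approximates `v` to optimal order, and superconvergently against second derivatives of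
splines. -/
structure IsOptimalApprox (e N : ℕ) (ε : ℝ) (v U : ℝ → ℝ) : Prop where
  perW2 : IsPerW2 U
  sub_le : ∀ x, |U x - v x| ≤ ε * (1 / N) ^ (e + 3)
  deriv_sub_le : ∀ x, |deriv U x - deriv v x| ≤ ε * (1 / N) ^ (e + 2)
  deriv_two_le : ∀ᵐ x, |iteratedDeriv 2 U x| ≤ ε
  integral_le : ∀ φ ∈ periodicSplines (e + 3) N,
    |∫ x in (0 : ℝ)..1, (U x - v x) * iteratedDeriv 2 φ x| ≤ ε * (1 / N) ^ (e + 3) * l2Norm (deriv φ)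
  integral_deriv_le : ∀ φ ∈ periodicSplines (e + 3) N, ∀ (G : ℝ → ℝ) (W : ℝ), IsSmoothBdd 2 W G →
    |∫ x in (0 : ℝ)..1, G x * (deriv U x - deriv v x) * iteratedDeriv 2 φ x| ≤
      ε * W * (1 / N) ^ (e + 3) * l2Norm (deriv φ)

theorem IsThomeeWendroff.exists_isOptimalApprox {e : ℕ} {c : ℤ →₀ ℝ} (h : IsThomeeWendroff (e + 3) c) :
    ∃ C : ℝ, 0 < C ∧ ∀ (N : ℕ) (v : ℝ → ℝ) (V : ℝ), 1 ≤ N → IsSmoothBdd (e + 6) V v →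
      IsOptimalApprox e N (C * V) v (quasiInterpolant (e + 3) c N v) := by
  have hq := h.isQuasiKernel
  obtain ⟨C₀, hC₀, h0⟩ := hq.exists_abs_sub_le
  obtain ⟨C₁, hC₁, h1⟩ := hq.exists_abs_sub_deriv_le (by omega)
  obtain ⟨C₂, hC₂, h2⟩ := hq.exists_abs_deriv_two_le (by omega)
  obtain ⟨C₃, hC₃, h3⟩ := exists_deriv_two_coeff e
  obtain ⟨C₄, hC₄, h4⟩ := hq.exists_superconvergence
  obtain ⟨C₅, hC₅, h5⟩ := hq.exists_superconvergence_deriv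
  refine ⟨C₀ + C₁ + C₂ + C₄ * C₃ + C₅ * C₃, by positivity, fun N v V hN hv => ?_⟩
  rw [quasiInterpolant_eq_quasiOp hN c hv.periodic]
  set ψ := cardinalSpline (e + 3) c
  have hV := hv.nonneg
  have hN0 : (0 : ℝ) < N := by exact_mod_cast hN
  have hp := quasiOp_coeff_periodic hN hv.periodic
  have hderiv : deriv (quasiOp ψ N v) = fun x => N * quasiOp (kernelSum (backDiff (cardinalBSpline (e + 1))) c) N v x :=
    deriv_shiftSum_comp_mul hq.deriv_left hq.hasDerivAt N _
  -- Balance of powers: N ^ 2 from φ'', (1 / N) ^ (e + 4) from superconvergence and 1 / N from the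
  -- coefficients leave (1 / N) ^ (e + 3).
  have hgen : ∀ (X : ℝ → ℝ) (K : ℝ) (φ : ℝ → ℝ), φ ∈ periodicSplines (e + 3) N → 0 ≤ K →
      (∀ b : ℤ → ℝ, Function.Periodic b (N : ℤ) →
        |∫ x in (0 : ℝ)..1, X x * shiftSum (backDiff (cardinalBSpline e)) b (N * x)| ≤
          K * (1 / N) ^ (e + 4) * (1 / N * ∑ i ∈ Finset.range N, |b i|)) →
      |∫ x in (0 : ℝ)..1, X x * iteratedDeriv 2 φ x| ≤ K * C₃ * (1 / N) ^ (e + 3) * l2Norm (deriv φ) := by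
    intro X K φ hφ hK hX
    obtain ⟨b, hb, hb2, hbs⟩ := h3 N φ hN hφ
    rw [integral_congr_of_ae (hb2.mono fun x hx =>
      show X x * iteratedDeriv 2 φ x = N ^ 2 * (X x * shiftSum (backDiff (cardinalBSpline e)) b (N * x)) by
        rw [hx]; ring), intervalIntegral.integral_const_mul, abs_mul, abs_of_nonneg (by positivity)]
    calc (N : ℝ) ^ 2 * |∫ x in (0 : ℝ)..1, X x * shiftSum (backDiff (cardinalBSpline e)) b (N * x)|
        ≤ N ^ 2 * (K * (1 / N) ^ (e + 4) * (C₃ * (1 / N * l2Norm (deriv φ)))) := by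
          gcongr
          exact (hX b hb).trans (by gcongr)
      _ = _ := by rw [pow_succ _ (e + 3)]; field_simp
  have hpow : ∀ k : ℕ, (0 : ℝ) ≤ (1 / N : ℝ) ^ k := fun k => by positivity
  refine ⟨perW2_shiftSum_comp_mul hq.deriv_left hq.hasDerivAt hq.deriv_right hN hp, fun x => ?_, fun x => ?_, ?_,
    fun φ hφ => ?_, fun φ hφ G W hG => ?_⟩
  · refine (h0 N v V hN (hv.mono (by omega)) x).trans ?_
    have := hpow (e + 3)
    gcongr
    nlinarith [mul_pos hC₄ hC₃, mul_pos hC₅ hC₃]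
  · rw [hderiv]
    refine (h1 N v V hN (hv.mono (by omega)) x).trans ?_
    have := hpow (e + 2)
    gcongr
    nlinarith [mul_pos hC₄ hC₃, mul_pos hC₅ hC₃]
  · filter_upwards [ae_nat_mul_notMem_int hN] with x hx
    have e1 := iteratedDeriv_two_shiftSum_comp_mul hq.deriv_left hq.hasDerivAt hq.deriv_right N
      (fun i => v (i / N)) hx
    have e2 := h2 N v V hN (hv.mono (by omega)) x hx
    rw [show iteratedDeriv 2 (quasiOp ψ N v) x = _ from e1]
    refine e2.trans ?_
    gcongr
    nlinarith [mul_pos hC₄ hC₃, mul_pos hC₅ hC₃]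
  · refine (hgen (fun x => quasiOp ψ N v x - v x) (C₄ * V) φ hφ (by positivity) fun b hb =>
      h4 N v V b hN (hv.mono (by omega)) hb).trans ?_
    have := hpow (e + 3)
    have := l2Norm_nonneg (deriv φ)
    rw [mul_right_comm C₄]
    gcongr
    nlinarith [mul_pos hC₄ hC₃, mul_pos hC₅ hC₃]
  · have hW := hG.nonneg
    rw [hderiv]
    refine (hgen (fun x => G x * (N * quasiOp (kernelSum (backDiff (cardinalBSpline (e + 1))) c) N v x - deriv v x))
      (C₅ * V * W) φ hφ (by positivity) fun b hb => h5 N v G V W b hN hv hG hb).trans ?_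
    have := hpow (e + 3)
    have := l2Norm_nonneg (deriv φ)
    rw [show C₅ * V * W * C₃ = (C₅ * C₃) * V * W by ring]
    gcongr
    nlinarith [mul_pos hC₄ hC₃, mul_pos hC₅ hC₃]

/-! ### Energy estimates and global solvability of conservative quadratic differential equations -/

/-- Gronwall's inequality: f(t) exp(-L t) - η t is nonincreasing. -/
theorem le_exp_mul_of_hasDerivWithinAt {f f' : ℝ → ℝ} {T L η : ℝ} (hL : 0 ≤ L) (hη : 0 ≤ η) (h0 : 0 ≤ f 0)
    (hf : ∀ t ∈ Icc 0 T, HasDerivWithinAt f (f' t) (Icc 0 T) t)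
    (hle : ∀ t ∈ Icc 0 T, f' t ≤ L * f t + η) :
    ∀ t ∈ Icc 0 T, f t ≤ Real.exp (L * T) * (f 0 + η * T) := by
  intro t ht
  have hT : 0 ≤ T := ht.1.trans ht.2
  set g : ℝ → ℝ := fun s => f s * Real.exp (-(L * s)) - η * s with hg
  have hexp : ∀ s, HasDerivAt (fun s => Real.exp (-(L * s))) (Real.exp (-(L * s)) * -L) s := fun s => by
    have := ((hasDerivAt_id s).const_mul L).neg.exp
    simpa using this
  have hgd : ∀ s ∈ Icc 0 T, HasDerivWithinAt g
      (f' s * Real.exp (-(L * s)) + f s * (Real.exp (-(L * s)) * -L) - η) (Icc 0 T) s := fun s hs =>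
    ((hf s hs).mul (hexp s).hasDerivWithinAt).sub
      (by simpa using ((hasDerivAt_id s).const_mul η).hasDerivWithinAt)
  have hanti : AntitoneOn g (Icc 0 T) := by
    refine antitoneOn_of_deriv_nonpos (convex_Icc 0 T) (fun s hs => (hgd s hs).continuousWithinAt) ?_ ?_
    · rw [interior_Icc]
      exact fun s hs => ((hgd s (Ioo_subset_Icc_self hs)).mono Ioo_subset_Icc_self).differentiableWithinAt
    · rw [interior_Icc]
      intro s hs
      have hs' := Ioo_subset_Icc_self hs
      rw [((hgd s hs').hasDerivAt (Icc_mem_nhds hs.1 hs.2)).deriv]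
      have h1 := mul_le_mul_of_nonneg_right (hle s hs') (Real.exp_pos (-(L * s))).le
      have h2 : Real.exp (-(L * s)) ≤ 1 := Real.exp_le_one_iff.2 (by nlinarith [hs.1])
      nlinarith
  have h1 := hanti ⟨le_rfl, hT⟩ ht ht.1
  simp only [hg, mul_zero, neg_zero, Real.exp_zero, mul_one, sub_zero] at h1
  have h2 : f t * Real.exp (-(L * t)) ≤ f 0 + η * t := by linarith
  have h3 := mul_le_mul_of_nonneg_right h2 (Real.exp_pos (L * t)).le
  rw [mul_assoc, ← Real.exp_add, neg_add_cancel, Real.exp_zero, mul_one, mul_comm] at h3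
  have := ht.1
  have := ht.2
  refine h3.trans ?_
  gcongr

section

variable {E : Type*} [NormedAddCommGroup E] [InnerProductSpace ℝ E]

/-- Gronwall for the squared distance; 2 ε s ≤ ε² + s² absorbs the linear term and accounts for the
1 in the rate. -/
theorem norm_sub_sq_le_of_inner_le {x x' y y' : ℝ → E} {T K ε : ℝ} (hK : 0 ≤ K)
    (hx : ∀ t ∈ Icc 0 T, HasDerivWithinAt x (x' t) (Icc 0 T) t)
    (hy : ∀ t ∈ Icc 0 T, HasDerivWithinAt y (y' t) (Icc 0 T) t)
    (h : ∀ t ∈ Icc 0 T, inner ℝ (x t - y t) (x' t - y' t) ≤ K * ‖x t - y t‖ ^ 2 + ε * ‖x t - y t‖) :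
    ∀ t ∈ Icc 0 T, ‖x t - y t‖ ^ 2 ≤
      Real.exp ((2 * K + 1) * T) * (‖x 0 - y 0‖ ^ 2 + ε ^ 2 * T) := by
  refine le_exp_mul_of_hasDerivWithinAt (f := fun t => ‖x t - y t‖ ^ 2) (by positivity) (sq_nonneg ε)
    (sq_nonneg _) (fun t ht => ((hx t ht).sub (hy t ht)).norm_sq) fun t ht => ?_
  have := h t ht
  simp only [Pi.sub_apply]
  nlinarith [sq_nonneg (ε - ‖x t - y t‖)]

/-- Cutting the field off by a scalar bump makes it bounded and globally Lipschitz, hence solvable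
on all of [0, T], and keeps it orthogonal to the position. So the norm stays controlled and the
solution never sees the cut-off. -/
theorem exists_solution_of_conservative_quadratic [FiniteDimensional ℝ E] (β : E →L[ℝ] E →L[ℝ] E)
    (hβ : ∀ x, inner ℝ x (β x x) = 0) (x₀ : E) {T : ℝ} (hT : 0 ≤ T) :
    ∃ α : ℝ → E, α 0 = x₀ ∧ ∀ t ∈ Icc 0 T, HasDerivWithinAt α (β (α t) (α t)) (Icc 0 T) t := by
  have : CompleteSpace E := FiniteDimensional.complete ℝ E
  -- The inner radius exceeds the bound exp T * ‖x₀‖ that the energy estimate with K = ε = 0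
  -- provides below.
  let b : ContDiffBump (0 : E) := ⟨Real.exp T * ‖x₀‖ + 1, Real.exp T * ‖x₀‖ + 2, by positivity, by linarith⟩
  set F : E → E := fun x => b x • β x x with hF
  have hFc : ContDiff ℝ 1 F := b.contDiff.smul (β.contDiff.clm_apply contDiff_id)
  have hFs : HasCompactSupport F := b.hasCompactSupport.smul_right
  obtain ⟨K, hK⟩ := hFc.lipschitzWith_of_hasCompactSupport hFs one_ne_zero
  obtain ⟨L, hL⟩ := hFs.exists_bound_of_continuous hFc.continuous
  have hL0 : 0 ≤ L := (norm_nonneg _).trans (hL 0)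
  have hPL : IsPicardLindelof (fun _ => F) (tmin := 0) (tmax := T) ⟨0, le_rfl, hT⟩ x₀
      (⟨L, hL0⟩ * ⟨T, hT⟩) 0 ⟨L, hL0⟩ K :=
    IsPicardLindelof.of_time_independent (fun x _ => hL x) hK.lipschitzOnWith (by
      simp only [sub_zero, NNReal.coe_zero, sub_self, max_eq_left hT]
      exact le_rfl)
  obtain ⟨α, hα0, hα⟩ := hPL.exists_eq_forall_mem_Icc_hasDerivWithinAt₀
  refine ⟨α, hα0, fun t ht => ?_⟩
  have hnorm := norm_sub_sq_le_of_inner_le (K := 0) (ε := 0) (y := fun _ => 0) (y' := fun _ => 0) le_rfl hα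
    (fun t _ => hasDerivWithinAt_const _ _ _) (fun t _ => by simp [hF, inner_smul_right, hβ])
  have h1 : ‖α t‖ ≤ Real.exp T * ‖x₀‖ := by
    have h2 := hnorm t ht
    simp only [hα0, sub_zero, mul_zero, zero_add, one_mul, ne_eq, OfNat.ofNat_ne_zero, not_false_eq_true,
      zero_pow, zero_mul, add_zero] at h2
    refine abs_le_of_sq_le_sq' (h2.trans ?_) (by positivity) |>.2
    rw [mul_pow]
    gcongr
    exact le_self_pow₀ (Real.one_le_exp hT) two_ne_zero
  have h3 := hα t ht
  have hb1 : b (α t) = 1 := b.one_of_mem_closedBall (by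
    rw [mem_closedBall_zero_iff]
    exact h1.trans (le_add_of_nonneg_right zero_le_one))
  simpa only [hF, hb1, one_smul] using h3

/-- Both curves are bounded on the compact interval, where the quadratic field is Lipschitz; then
the energy estimate applies with ε = 0. -/
theorem eqOn_of_quadratic (β : E →L[ℝ] E →L[ℝ] E) {T : ℝ} {x y : ℝ → E} (h0 : x 0 = y 0)
    (hx : ∀ t ∈ Icc 0 T, HasDerivWithinAt x (β (x t) (x t)) (Icc 0 T) t)
    (hy : ∀ t ∈ Icc 0 T, HasDerivWithinAt y (β (y t) (y t)) (Icc 0 T) t) :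
    ∀ t ∈ Icc 0 T, x t = y t := by
  have bdd : ∀ z z' : ℝ → E, (∀ t ∈ Icc 0 T, HasDerivWithinAt z (z' t) (Icc 0 T) t) →
      ∃ R, ∀ t ∈ Icc 0 T, ‖z t‖ ≤ R := fun z z' hz =>
    isCompact_Icc.exists_bound_of_continuousOn fun t ht => (hz t ht).continuousWithinAt
  obtain ⟨R, hR⟩ := bdd x _ hx
  obtain ⟨S, hS⟩ := bdd y _ hy
  have key := norm_sub_sq_le_of_inner_le (K := ‖β‖ * |R| + ‖β‖ * |S|) (ε := 0) (by positivity) hx hy fun t ht => by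
    have e : β (x t) (x t) - β (y t) (y t) = β (x t) (x t - y t) + β (x t - y t) (y t) := by
      simp only [map_sub, _root_.sub_apply]; abel
    rw [e, inner_add_right, zero_mul, add_zero, add_mul]
    refine add_le_add ((real_inner_le_norm _ _).trans ?_) ((real_inner_le_norm _ _).trans ?_)
    · calc _ ≤ ‖x t - y t‖ * (‖β‖ * |R| * ‖x t - y t‖) := by
            gcongr
            refine (β.le_opNorm₂ _ _).trans ?_
            gcongr
            exact (hR t ht).trans (le_abs_self _)
        _ = _ := by ring
    · calc _ ≤ ‖x t - y t‖ * (‖β‖ * ‖x t - y t‖ * |S|) := by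
            gcongr
            refine (β.le_opNorm₂ _ _).trans ?_
            gcongr
            exact (hS t ht).trans (le_abs_self _)
        _ = _ := by ring
  intro t ht
  have h := key t ht
  rw [h0] at h
  have h2 : ‖x t - y t‖ ^ 2 ≤ 0 := by simpa using h
  have h3 : ‖x t - y t‖ = 0 := by nlinarith [norm_nonneg (x t - y t)]
  exact sub_eq_zero.1 (norm_eq_zero.1 h3)

/-- A curve in a finite-dimensional subspace of functions is differentiable if it is so pointwise. -/
theorem exists_hasDerivWithinAt_of_pointwise [FiniteDimensional ℝ E] (ι : E →ₗ[ℝ] ℝ → ℝ)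
    (hι : Function.Injective ι) {α : ℝ → E} {s : Set ℝ} {t : ℝ} (hs : UniqueDiffWithinAt ℝ s t)
    (h : ∀ x, DifferentiableWithinAt ℝ (fun τ => ι (α τ) x) s t) :
    ∃ α', HasDerivWithinAt α α' s t := by
  -- Finite dimension makes the image closed for pointwise convergence, so the pointwise limit of
  -- the difference quotients is the image of a vector.
  have hc : IsClosedEmbedding ι := LinearMap.isClosedEmbedding_of_injective (LinearMap.ker_eq_bot.2 hι)
  have hlim : Tendsto (fun τ => ι (slope α t τ)) (𝓝[s \ {t}] t)
      (𝓝 fun x => derivWithin (fun τ => ι (α τ) x) s t) := by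
    rw [tendsto_pi_nhds]
    intro x
    refine (hasDerivWithinAt_iff_tendsto_slope.1 (h x).hasDerivWithinAt).congr fun τ => ?_
    simp [slope]
  have : (𝓝[s \ {t}] t).NeBot := by
    rw [← accPt_principal_iff_nhdsWithin]
    exact hs.accPt
  obtain ⟨v, hv⟩ := hc.isClosed_range.mem_of_tendsto hlim (.of_forall fun τ => mem_range_self _)
  exact ⟨v, hasDerivWithinAt_iff_tendsto_slope.2 (hc.isEmbedding.tendsto_nhds_iff.2 (by rwa [hv]))⟩

end

/-! ### The spline space with the inner product of `H¹` -/

/-- The space of periodic splines, as a submodule. -/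
def splineSubmodule (r N : ℕ) : Submodule ℝ (ℝ → ℝ) where
  carrier := periodicSplines r N
  add_mem' := by
    rintro f g ⟨hf, hf', hf''⟩ ⟨hg, hg', hg''⟩
    refine ⟨hf.add hg, hf'.add hg', fun i hi => ?_⟩
    obtain ⟨p, hp, hpf⟩ := hf'' i hi
    obtain ⟨q, hq, hqg⟩ := hg'' i hi
    refine ⟨p + q, (Polynomial.natDegree_add_le _ _).trans (max_le hp hq), fun x hx => ?_⟩
    rw [Pi.add_apply, hpf x hx, hqg x hx, Polynomial.eval_add]
  zero_mem' := ⟨fun _ => rfl, contDiff_const, fun i _ => ⟨0, by simp, by simp⟩⟩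
  smul_mem' := by
    rintro c f ⟨hf, hf', hf''⟩
    refine ⟨hf.smul c, contDiff_const.smul hf', fun i hi => ?_⟩
    obtain ⟨p, hp, hpf⟩ := hf'' i hi
    refine ⟨c • p, (Polynomial.natDegree_smul_le _ _).trans hp, fun x hx => ?_⟩
    rw [Pi.smul_apply, hpf x hx, Polynomial.eval_smul]

/-- The space of periodic splines of order `e + 3`, to be given the inner product of `H¹`. -/
def SplineSpace (e N : ℕ) : Type := splineSubmodule (e + 3) N

namespace SplineSpace

variable {e N : ℕ}

instance : AddCommGroup (SplineSpace e N) := inferInstanceAs (AddCommGroup (splineSubmodule (e + 3) N))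

instance : Module ℝ (SplineSpace e N) := inferInstanceAs (Module ℝ (splineSubmodule (e + 3) N))

/-- The inclusion of the splines into the functions. -/
def incl (e N : ℕ) : SplineSpace e N →ₗ[ℝ] ℝ → ℝ := (splineSubmodule (e + 3) N).subtype

instance : CoeFun (SplineSpace e N) fun _ => ℝ → ℝ := ⟨incl e N⟩

theorem incl_injective : Function.Injective (incl e N) := Subtype.val_injective

theorem mem (φ : SplineSpace e N) : incl e N φ ∈ periodicSplines (e + 3) N := Subtype.property φ

/-- A spline as an element of the space of splines. -/
def ofMem {φ : ℝ → ℝ} (h : φ ∈ periodicSplines (e + 3) N) : SplineSpace e N := ⟨φ, h⟩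

@[simp]
theorem incl_ofMem {φ : ℝ → ℝ} (h : φ ∈ periodicSplines (e + 3) N) : incl e N (ofMem h) = φ := rfl

theorem incl_add (f g : SplineSpace e N) : incl e N (f + g) = fun x => f x + g x := rfl

theorem incl_smul (c : ℝ) (f : SplineSpace e N) : incl e N (c • f) = fun x => c * f x := rfl

theorem incl_sub (f g : SplineSpace e N) : incl e N (f - g) = fun x => f x - g x := rfl

variable [NeZero N]

theorem perW2 (φ : SplineSpace e N) : IsPerW2 (incl e N φ) :=
  perW2_of_mem_periodicSplines NeZero.one_le φ.mem

end SplineSpace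

theorem h1Inner_add_left {f g h : ℝ → ℝ} (hf : IsPerW2 f) (hg : IsPerW2 g) (hh : IsPerW2 h) :
    h1Inner (fun x => f x + g x) h = h1Inner f h + h1Inner g h := by
  simp only [h1Inner, hf.deriv_add hg]
  rw [l2Inner_add_left hf.bddMeas hg.bddMeas hh.bddMeas,
    l2Inner_add_left hf.bddMeas_deriv hg.bddMeas_deriv hh.bddMeas_deriv]
  ring

theorem h1Inner_const_mul_left (c : ℝ) {f g : ℝ → ℝ} (hf : IsPerW2 f) :
    h1Inner (fun x => c * f x) g = c * h1Inner f g := by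
  simp only [h1Inner, hf.deriv_const_mul, l2Inner_const_mul_left]
  ring

theorem h1Inner_comm (f g : ℝ → ℝ) : h1Inner f g = h1Inner g f := by
  simp only [h1Inner, l2Inner_comm f, l2Inner_comm (deriv f)]

theorem eq_zero_of_h1Inner_self_eq_zero {f : ℝ → ℝ} (hf : IsPerW2 f) (h : h1Inner f f = 0) : f = 0 := by
  have h0 : l2Inner f f = 0 := by
    have h1 := l2Inner_self_nonneg f
    have h2 := l2Inner_self_nonneg (deriv f)
    rw [h1Inner] at h
    linarith
  have hc : Continuous f := hf.differentiable.continuous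
  have hz : ∀ x ∈ Icc (0 : ℝ) 1, f x = 0 := fun x hx => by
    by_contra hne
    have hpos : 0 < l2Inner f f := intervalIntegral.integral_pos zero_lt_one (hc.mul hc).continuousOn
      (fun _ _ => mul_self_nonneg _) ⟨x, hx, mul_self_pos.2 hne⟩
    exact hpos.ne' h0
  ext x
  have := hf.periodic.sub_int_mul_eq ⌊x⌋ (x := x)
  rw [mul_one] at this
  rw [← this]
  exact hz _ ⟨Int.fract_nonneg x, (Int.fract_lt_one x).le⟩

namespace SplineSpace

variable {e N : ℕ} [NeZero N]

/-- The inner product of `H¹` on the space of splines. -/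
noncomputable abbrev core (e N : ℕ) [NeZero N] : InnerProductSpace.Core ℝ (SplineSpace e N) where
  inner f g := h1Inner f g
  conj_inner_symm f g := h1Inner_comm _ _
  re_inner_nonneg f := by
    change 0 ≤ h1Inner f f
    rw [h1Inner_self]
    positivity
  add_left f g h := h1Inner_add_left f.perW2 g.perW2 h.perW2
  smul_left f g c := h1Inner_const_mul_left c f.perW2
  definite f h := incl_injective (eq_zero_of_h1Inner_self_eq_zero f.perW2 h)

noncomputable instance : NormedAddCommGroup (SplineSpace e N) := (core e N).toNormedAddCommGroup

noncomputable instance : InnerProductSpace ℝ (SplineSpace e N) := InnerProductSpace.ofCore (core e N).toCore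

theorem inner_eq (f g : SplineSpace e N) : inner ℝ f g = h1Inner f g := rfl

theorem norm_eq (f : SplineSpace e N) : ‖f‖ = Real.sqrt (h1Inner f f) := by
  rw [← inner_eq, real_inner_self_eq_norm_sq, Real.sqrt_sq (norm_nonneg _)]

instance : FiniteDimensional ℝ (SplineSpace e N) := by
  have hN : 1 ≤ N := NeZero.one_le
  have hp : ∀ a : ZMod N → ℝ, Function.Periodic (fun i : ℤ => a i) (N : ℤ) := fun a i => by simp
  let L : (ZMod N → ℝ) →ₗ[ℝ] SplineSpace e N :=
    { toFun := fun a => ofMem (bspline_shiftSum_mem hN (hp a))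
      map_add' := fun a b => incl_injective (funext fun x =>
        shiftSum_add_coeff (isKernel_cardinalBSpline _) _ _ _)
      map_smul' := fun c a => incl_injective (funext fun x =>
        shiftSum_mul_coeff (isKernel_cardinalBSpline _) _ _ _) }
  refine Module.Finite.of_surjective L fun φ => ?_
  obtain ⟨b, hb, h⟩ := exists_coeff_of_mem_periodicSplines hN φ.mem
  refine ⟨fun z => b z.val, incl_injective ?_⟩
  rw [h]
  change (fun x => shiftSum _ (fun i : ℤ => b ((i : ZMod N).val)) _) = _
  simp only [ZMod.val_intCast, hb.map_emod]

/-- The bilinear operator that represents the Camassa–Holm form. -/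
noncomputable def chOp (e N : ℕ) [NeZero N] : SplineSpace e N →L[ℝ] SplineSpace e N →L[ℝ] SplineSpace e N := by
  let F : SplineSpace e N → SplineSpace e N → SplineSpace e N →ₗ[ℝ] ℝ := fun w z =>
    { toFun := fun φ => -chForm w z φ
      map_add' := fun f g => by
        rw [incl_add, chForm_add_right f.perW2 g.perW2 w.perW2 z.perW2]; ring
      map_smul' := fun c f => by
        rw [incl_smul, chForm_const_mul_right c f.perW2]; simp }
  exact LinearMap.toContinuousBilinearMap (LinearMap.mk₂ ℝ
    (fun w z => (InnerProductSpace.toDual ℝ (SplineSpace e N)).symm (LinearMap.toContinuousLinearMap (F w z)))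
    (fun f g z => by
      rw [← map_add, ← map_add]; congr 2; ext φ
      change -chForm _ _ _ = -chForm _ _ _ + -chForm _ _ _
      rw [incl_add, chForm_add_left f.perW2 g.perW2 z.perW2 φ.perW2]; ring)
    (fun c f z => by
      rw [← map_smul, ← map_smul]; congr 2; ext φ
      change -chForm _ _ _ = c * -chForm _ _ _
      rw [incl_smul, chForm_const_mul_left c f.perW2]; ring)
    (fun w f g => by
      rw [← map_add, ← map_add]; congr 2; ext φ
      change -chForm _ _ _ = -chForm _ _ _ + -chForm _ _ _
      rw [incl_add, chForm_add_mid f.perW2 g.perW2 w.perW2 φ.perW2]; ring)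
    (fun c w f => by
      rw [← map_smul, ← map_smul]; congr 2; ext φ
      change -chForm _ _ _ = c * -chForm _ _ _
      rw [incl_smul, chForm_const_mul_mid c f.perW2]; ring))

theorem inner_chOp (w z φ : SplineSpace e N) : inner ℝ (chOp e N w z) φ = -chForm w z φ :=
  InnerProductSpace.toDual_symm_apply

theorem inner_chOp_self (w : SplineSpace e N) : inner ℝ w (chOp e N w w) = 0 := by
  rw [real_inner_comm, inner_chOp, chForm_self w.perW2, neg_zero]

theorem eq_chOp_iff (v w : SplineSpace e N) :
    v = chOp e N w w ↔ ∀ φ : SplineSpace e N, h1Inner v φ + chForm w w φ = 0 := by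
  refine ⟨fun h φ => ?_, fun h => ext_inner_right ℝ fun φ => ?_⟩
  · rw [← inner_eq, h, inner_chOp]; ring
  · rw [inner_chOp, inner_eq]; linarith [h φ]

theorem hasDerivWithinAt_apply {α : ℝ → SplineSpace e N} {v : SplineSpace e N} {s : Set ℝ} {t : ℝ}
    (h : HasDerivWithinAt α v s t) (x : ℝ) : HasDerivWithinAt (fun t => α t x) (v x) s t := by
  let L : SplineSpace e N →L[ℝ] ℝ := LinearMap.toContinuousLinearMap ((LinearMap.proj x).comp (incl e N))
  exact L.hasFDerivAt.comp_hasDerivWithinAt t h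

theorem timeDeriv_eq {α : ℝ → SplineSpace e N} {v : SplineSpace e N} {T t : ℝ} (hT : 0 < T) (ht : t ∈ Icc 0 T)
    (h : HasDerivWithinAt α v (Icc 0 T) t) : timeDeriv T (fun t => incl e N (α t)) t = v :=
  funext fun x => (hasDerivWithinAt_apply h x).derivWithin (uniqueDiffOn_Icc hT t ht)

end SplineSpace

/-! ### The semidiscretization as an ordinary differential equation -/

/-- The semidiscretization is a differential equation in the space of splines. -/
theorem isGalerkinSolution_of_hasDerivWithinAt {e N : ℕ} [NeZero N] {T : ℝ} (hT : 0 < T)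
    {α : ℝ → SplineSpace e N}
    (hα : ∀ t ∈ Icc 0 T, HasDerivWithinAt α (SplineSpace.chOp e N (α t) (α t)) (Icc 0 T) t) :
    IsGalerkinSolution (e + 3) N T (α 0) fun t => α t := by
  refine ⟨fun t _ => (α t).mem, fun x t ht =>
    (SplineSpace.hasDerivWithinAt_apply (hα t ht) x).differentiableWithinAt, fun t ht φ hφ => ?_, rfl⟩
  rw [SplineSpace.timeDeriv_eq hT ht (hα t ht)]
  have := (SplineSpace.eq_chOp_iff _ (α t)).1 rfl (SplineSpace.ofMem hφ)
  rw [SplineSpace.incl_ofMem, h1Inner, chForm] at this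
  simp only [sq]
  linarith

/-- Differentiability is assumed pointwise in x only; finite dimension upgrades it to the H¹
topology. This allows uniqueness among all solutions in the sense of the definition. -/
theorem IsGalerkinSolution.exists_curve {e N : ℕ} [NeZero N] {T : ℝ} (hT : 0 < T) {w₀ : ℝ → ℝ}
    {w : ℝ → ℝ → ℝ} (h : IsGalerkinSolution (e + 3) N T w₀ w) :
    ∃ α : ℝ → SplineSpace e N, (∀ t ∈ Icc 0 T, SplineSpace.incl e N (α t) = w t) ∧
      ∀ t ∈ Icc 0 T, HasDerivWithinAt α (SplineSpace.chOp e N (α t) (α t)) (Icc 0 T) t := by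
  classical
  let α : ℝ → SplineSpace e N := fun t =>
    if ht : t ∈ Icc 0 T then SplineSpace.ofMem (h.mem t ht) else 0
  have hαw : ∀ t ∈ Icc 0 T, SplineSpace.incl e N (α t) = w t := fun t ht => by
    simp only [α, dif_pos ht, SplineSpace.incl_ofMem]
  refine ⟨α, hαw, fun t ht => ?_⟩
  obtain ⟨v, hv⟩ := exists_hasDerivWithinAt_of_pointwise (SplineSpace.incl e N) SplineSpace.incl_injective
    (uniqueDiffOn_Icc hT t ht) fun x =>
      (h.differentiable x t ht).congr (fun s hs => congrFun (hαw s hs) x) (congrFun (hαw t ht) x)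
  have hv' : timeDeriv T w t = v := by
    rw [← SplineSpace.timeDeriv_eq hT ht hv]
    exact funext fun x => derivWithin_congr (fun s hs => (congrFun (hαw s hs) x).symm) (congrFun (hαw t ht) x).symm
  rwa [(SplineSpace.eq_chOp_iff v (α t)).2 fun φ => ?_] at hv
  have := h.equation t ht φ φ.mem
  rw [hv', ← hαw t ht] at this
  rw [h1Inner, chForm]
  simp only [sq] at this
  linarith

/-- The semidiscretization is uniquely solvable. -/
theorem exists_galerkin_curve {e N : ℕ} [NeZero N] {T : ℝ} (hT : 0 < T) (w₀ : SplineSpace e N) :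
    ∃ α : ℝ → SplineSpace e N, α 0 = w₀ ∧
      (∀ t ∈ Icc 0 T, HasDerivWithinAt α (SplineSpace.chOp e N (α t) (α t)) (Icc 0 T) t) ∧
      IsGalerkinSolution (e + 3) N T w₀ (fun t => α t) ∧
      ∀ w', IsGalerkinSolution (e + 3) N T w₀ w' → ∀ t ∈ Icc 0 T, w' t = α t := by
  obtain ⟨α, h0, hα⟩ := exists_solution_of_conservative_quadratic (SplineSpace.chOp e N)
    SplineSpace.inner_chOp_self w₀ hT.le
  refine ⟨α, h0, hα, h0 ▸ isGalerkinSolution_of_hasDerivWithinAt hT hα, fun w' hw' t ht => ?_⟩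
  obtain ⟨α', hα'w, hα'⟩ := hw'.exists_curve hT
  rw [← hα'w t ht]
  congr 1
  refine eqOn_of_quadratic _ (SplineSpace.incl_injective ?_) hα' hα t ht
  rw [hα'w 0 ⟨le_rfl, hT.le⟩, hw'.initial, h0]

/-! ### Regularity in time and space -/

section regularity

variable {T : ℝ} {f : ℝ → ℝ → ℝ}

theorem uniqueDiffOn_strip (hT : 0 < T) : UniqueDiffOn ℝ (Icc 0 T ×ˢ (univ : Set ℝ)) :=
  (uniqueDiffOn_Icc hT).prod uniqueDiffOn_univ

theorem hasDerivAt_slice {n : ℕ} (hf : ContDiffOn ℝ (n + 1 : ℕ) (Function.uncurry f) (Icc 0 T ×ˢ univ)) {t : ℝ}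
    (ht : t ∈ Icc 0 T) (x : ℝ) :
    HasDerivAt (f t) (fderivWithin ℝ (Function.uncurry f) (Icc 0 T ×ˢ univ) (t, x) (0, 1)) x := by
  have h1 := (hf.differentiableOn (by simp) (t, x) ⟨ht, mem_univ x⟩).hasFDerivWithinAt
  have h2 : HasDerivWithinAt (fun y : ℝ => (t, y)) (0, 1) univ x :=
    ((hasDerivAt_const x t).prodMk (hasDerivAt_id x)).hasDerivWithinAt
  exact hasDerivWithinAt_univ.1 (h1.comp_hasDerivWithinAt x h2 fun y _ => ⟨ht, mem_univ y⟩)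

theorem hasDerivWithinAt_time {n : ℕ} (hf : ContDiffOn ℝ (n + 1 : ℕ) (Function.uncurry f) (Icc 0 T ×ˢ univ))
    {t : ℝ} (ht : t ∈ Icc 0 T) (x : ℝ) :
    HasDerivWithinAt (fun s => f s x)
      (fderivWithin ℝ (Function.uncurry f) (Icc 0 T ×ˢ univ) (t, x) (1, 0)) (Icc 0 T) t := by
  have h1 := (hf.differentiableOn (by simp) (t, x) ⟨ht, mem_univ x⟩).hasFDerivWithinAt
  have h2 : HasDerivWithinAt (fun s : ℝ => (s, x)) (1, 0) (Icc 0 T) t :=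
    ((hasDerivAt_id t).prodMk (hasDerivAt_const t x)).hasDerivWithinAt
  have h3 : MapsTo (fun s : ℝ => (s, x)) (Icc 0 T) (Icc 0 T ×ˢ univ) := fun s hs => ⟨hs, mem_univ x⟩
  exact h1.comp_hasDerivWithinAt t h2 h3

theorem hasDerivWithinAt_timeDeriv {n : ℕ}
    (hf : ContDiffOn ℝ (n + 1 : ℕ) (Function.uncurry f) (Icc 0 T ×ˢ univ)) {t : ℝ} (ht : t ∈ Icc 0 T) (x : ℝ) :
    HasDerivWithinAt (fun s => f s x) (timeDeriv T f t x) (Icc 0 T) t :=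
  (hasDerivWithinAt_time hf ht x).differentiableWithinAt.hasDerivWithinAt

/-- Space and one-sided time derivatives are values of the derivative within the strip on fixed
vectors, so each costs one order of joint smoothness, up to the boundary. -/
theorem contDiffOn_fderivWithin_strip (hT : 0 < T) {n : ℕ}
    (hf : ContDiffOn ℝ (n + 1 : ℕ) (Function.uncurry f) (Icc 0 T ×ˢ univ)) (v : ℝ × ℝ) :
    ContDiffOn ℝ n (fun p => fderivWithin ℝ (Function.uncurry f) (Icc 0 T ×ˢ univ) p v) (Icc 0 T ×ˢ univ) :=
  (hf.fderivWithin (uniqueDiffOn_strip hT) (by norm_cast)).clm_apply contDiffOn_const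

theorem contDiffOn_deriv_slice (hT : 0 < T) {n : ℕ}
    (hf : ContDiffOn ℝ (n + 1 : ℕ) (Function.uncurry f) (Icc 0 T ×ˢ univ)) :
    ContDiffOn ℝ n (Function.uncurry fun t => deriv (f t)) (Icc 0 T ×ˢ univ) :=
  (contDiffOn_fderivWithin_strip hT hf (0, 1)).congr fun p hp => (hasDerivAt_slice hf hp.1 p.2).deriv

theorem contDiffOn_timeDeriv (hT : 0 < T) {n : ℕ}
    (hf : ContDiffOn ℝ (n + 1 : ℕ) (Function.uncurry f) (Icc 0 T ×ˢ univ)) :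
    ContDiffOn ℝ n (Function.uncurry (timeDeriv T f)) (Icc 0 T ×ˢ univ) :=
  (contDiffOn_fderivWithin_strip hT hf (1, 0)).congr fun p hp =>
    (hasDerivWithinAt_time hf hp.1 p.2).derivWithin (uniqueDiffOn_Icc hT _ hp.1)

theorem contDiffOn_iteratedDeriv_slice (hT : 0 < T) (j : ℕ) {n : ℕ}
    (hf : ContDiffOn ℝ (n + j : ℕ) (Function.uncurry f) (Icc 0 T ×ˢ univ)) :
    ContDiffOn ℝ n (Function.uncurry fun t => iteratedDeriv j (f t)) (Icc 0 T ×ˢ univ) := by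
  induction j generalizing n with
  | zero => simpa using hf
  | succ j ih =>
    simp only [iteratedDeriv_succ]
    exact contDiffOn_deriv_slice hT (ih (n := n + 1) (by rwa [add_right_comm]))

theorem periodic_timeDeriv (hp : ∀ t ∈ Icc 0 T, Function.Periodic (f t) 1) {t : ℝ} (ht : t ∈ Icc 0 T) :
    Function.Periodic (timeDeriv T f t) 1 := fun x =>
  derivWithin_congr (fun s hs => hp s hs x) (hp t ht x)

theorem exists_bound_of_periodic (hf : ContinuousOn (Function.uncurry f) (Icc 0 T ×ˢ univ))
    (hp : ∀ t ∈ Icc 0 T, Function.Periodic (f t) 1) : ∃ V, ∀ t ∈ Icc 0 T, ∀ x, |f t x| ≤ V := by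
  obtain ⟨V, hV⟩ := (isCompact_Icc.prod (isCompact_Icc (a := (0 : ℝ)) (b := 1))).exists_bound_of_continuousOn
    (hf.mono (prod_mono_right (subset_univ _)))
  refine ⟨V, fun t ht x => ?_⟩
  have := (hp t ht).sub_int_mul_eq ⌊x⌋ (x := x)
  rw [mul_one] at this
  rw [← this]
  exact hV (t, Int.fract x) ⟨ht, Int.fract_nonneg x, (Int.fract_lt_one x).le⟩

theorem exists_isSmoothBdd (hT : 0 < T) {k : ℕ}
    (hf : ContDiffOn ℝ k (Function.uncurry f) (Icc 0 T ×ˢ univ))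
    (hp : ∀ t ∈ Icc 0 T, Function.Periodic (f t) 1) : ∃ V, ∀ t ∈ Icc 0 T, IsSmoothBdd k V (f t) := by
  have hb : ∀ j : ℕ, ∃ V, j ≤ k → ∀ t ∈ Icc 0 T, ∀ x, |iteratedDeriv j (f t) x| ≤ V := fun j => by
    by_cases hj : j ≤ k
    · obtain ⟨i, rfl⟩ := Nat.exists_eq_add_of_le' hj
      obtain ⟨V, hV⟩ := exists_bound_of_periodic (contDiffOn_iteratedDeriv_slice hT j hf).continuousOn
        fun t ht => (hp t ht).iteratedDeriv' j
      exact ⟨V, fun _ => hV⟩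
    · exact ⟨0, fun h => absurd h hj⟩
  choose V hV using hb
  refine ⟨∑ j ∈ Finset.range (k + 1), |V j|, fun t ht => ⟨hp t ht, ?_, fun j hj x => ?_⟩⟩
  · exact contDiffOn_univ.1 (hf.comp (f := fun x : ℝ => (t, x)) (by fun_prop) fun x _ => ⟨ht, mem_univ x⟩)
  · exact (hV j hj t ht x).trans ((le_abs_self _).trans
      (Finset.single_le_sum (f := fun j => |V j|) (fun _ _ => abs_nonneg _) (Finset.mem_range.2 (by omega))))

end regularity

/-! ### Consistency of the quasi-interpolant -/

/-- The weak form of the Camassa–Holm equation. -/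
theorem h1Inner_add_chForm_eq_zero {V W : ℝ} {g u φ : ℝ → ℝ} (hg : IsSmoothBdd 4 W g) (hu : IsSmoothBdd 4 V u)
    (hφ : IsPerW2 φ) (h : ∀ x, g x - iteratedDeriv 2 g x + 3 * u x * deriv u x =
      2 * deriv u x * iteratedDeriv 2 u x + u x * iteratedDeriv 3 u x) :
    h1Inner g φ + chForm u u φ = 0 := by
  have hu1 := (IsSmoothBdd.perW2 (k := 2) hu)
  have hu2 := (IsSmoothBdd.perW2 (k := 1) hu.deriv).deriv_perLip
  have hg1 := (IsSmoothBdd.perW2 (k := 2) hg)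
  have hd := hu1.deriv_perLip
  have hp := hφ.perLip
  -- The right-hand side of the equation is the derivative of ½ (u')² + u u''. The three
  -- integrations by parts move this derivative, and one from g'', onto φ.
  have i1 := hg1.deriv_perLip.integral_mul_deriv hp
  have i2 := (hd.mul hd).integral_mul_deriv hp
  rw [integral_congr_of_ae ((hd.ae_deriv_mul hd).mono fun x hx =>
    show deriv (fun x => deriv u x * deriv u x) x * φ x = 2 * (deriv u x * deriv (deriv u) x * φ x) by
      rw [hx]; ring), intervalIntegral.integral_const_mul] at i2
  have i3 := (hu1.perLip.mul hu2).integral_mul_deriv hp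
  rw [integral_congr_of_ae ((hu1.perLip.ae_deriv_mul hu2).mono fun x hx =>
    show deriv (fun x => u x * deriv (deriv u) x) x * φ x =
      deriv u x * deriv (deriv u) x * φ x + u x * deriv (deriv (deriv u)) x * φ x by rw [hx]; ring),
    intervalIntegral.integral_add
      (((hd.bddMeas.mul hd.deriv_bddMeas).mul hp.bddMeas).intervalIntegrable _ _)
      (((hu1.bddMeas.mul hu2.deriv_bddMeas).mul hp.bddMeas).intervalIntegrable _ _)] at i3
  have e3 : iteratedDeriv 3 u = deriv (deriv (deriv u)) := by
    rw [iteratedDeriv_succ, IsPerW2.iteratedDeriv_two]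
  simp only [IsPerW2.iteratedDeriv_two, e3] at h
  have key : ∫ x in (0 : ℝ)..1, g x * φ x = (∫ x in (0 : ℝ)..1, deriv (deriv g) x * φ x)
      - 3 * (∫ x in (0 : ℝ)..1, u x * deriv u x * φ x)
      + 2 * (∫ x in (0 : ℝ)..1, deriv u x * deriv (deriv u) x * φ x)
      + ∫ x in (0 : ℝ)..1, u x * deriv (deriv (deriv u)) x * φ x := by
    have I1 : IntervalIntegrable (fun x => deriv (deriv g) x * φ x) volume 0 1 :=
      (hg1.deriv_perLip.deriv_bddMeas.mul hp.bddMeas).intervalIntegrable _ _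
    have I2 : IntervalIntegrable (fun x => u x * deriv u x * φ x) volume 0 1 :=
      ((hu1.bddMeas.mul hd.bddMeas).mul hp.bddMeas).intervalIntegrable _ _
    have I3 : IntervalIntegrable (fun x => deriv u x * deriv (deriv u) x * φ x) volume 0 1 :=
      ((hd.bddMeas.mul hd.deriv_bddMeas).mul hp.bddMeas).intervalIntegrable _ _
    have I4 : IntervalIntegrable (fun x => u x * deriv (deriv (deriv u)) x * φ x) volume 0 1 :=
      ((hu1.bddMeas.mul hu2.deriv_bddMeas).mul hp.bddMeas).intervalIntegrable _ _
    rw [← intervalIntegral.integral_const_mul, ← intervalIntegral.integral_const_mul,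
      ← intervalIntegral.integral_sub I1 (I2.const_mul 3),
      ← intervalIntegral.integral_add (I1.sub (I2.const_mul 3)) (I3.const_mul 2),
      ← intervalIntegral.integral_add ((I1.sub (I2.const_mul 3)).add (I3.const_mul 2)) I4]
    refine intervalIntegral.integral_congr fun x _ => ?_
    have := congrArg (· * φ x) (h x)
    beta_reduce at this ⊢
    linarith
  simp only [h1Inner, chForm, l2Inner, IsPerW2.iteratedDeriv_two]
  rw [key, i1]
  linarith

/-- The `H¹` inner product of an approximation error with a spline. -/
theorem IsOptimalApprox.abs_h1Inner_sub_le {e N k : ℕ} {ε V : ℝ} {v U φ : ℝ → ℝ} (h : IsOptimalApprox e N ε v U)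
    (hv : IsSmoothBdd (k + 2) V v) (hN : 1 ≤ N) (hφ : φ ∈ periodicSplines (e + 3) N) :
    |h1Inner U φ - h1Inner v φ| ≤ 2 * ε * (1 / N) ^ (e + 3) * Real.sqrt (h1Inner φ φ) := by
  have hW := perW2_of_mem_periodicSplines hN hφ
  have hvW := hv.perW2
  have hρ := h.perW2.sub hvW
  have hε : 0 ≤ ε * (1 / N : ℝ) ^ (e + 3) := (abs_nonneg _).trans (h.sub_le 0)
  have e1 : h1Inner U φ - h1Inner v φ = h1Inner (fun x => U x - v x) φ := by
    have := h1Inner_add_left hρ hvW hW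
    simp only [sub_add_cancel] at this
    linarith
  -- Pairing the error itself with φ'', rather than its derivative with φ', makes superconvergence
  -- available.
  have e2 := hρ.perLip.integral_mul_deriv hW.deriv_perLip
  rw [e1, h1Inner, l2Inner, l2Inner, ← neg_neg (∫ x in (0 : ℝ)..1, deriv _ x * _), ← e2]
  have b1 : |∫ x in (0 : ℝ)..1, (U x - v x) * φ x| ≤ ε * (1 / N : ℝ) ^ (e + 3) * l2Norm φ :=
    abs_integral_mul_le_one hW.bddMeas (.of_forall h.sub_le)
  have b2 := h.integral_le φ hφ
  rw [IsPerW2.iteratedDeriv_two] at b2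
  have n0 := mul_le_mul_of_nonneg_left (l2Norm_le_sqrt_h1Inner φ) hε
  have n1 := mul_le_mul_of_nonneg_left (l2Norm_deriv_le_sqrt_h1Inner φ) hε
  rw [abs_le] at *
  constructor <;> linarith

/-- The quasi-interpolant satisfies the semidiscrete equation up to a truncation error of optimal
order. -/
theorem IsOptimalApprox.abs_truncation_le {e N : ℕ} {ε V : ℝ} {u g U G φ : ℝ → ℝ} (hU : IsOptimalApprox e N ε u U)
    (hG : IsOptimalApprox e N ε g G) (hu : IsSmoothBdd 4 V u) (hg : IsSmoothBdd 4 V g) (hN : 1 ≤ N)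
    (h : ∀ x, g x - iteratedDeriv 2 g x + 3 * u x * deriv u x =
      2 * deriv u x * iteratedDeriv 2 u x + u x * iteratedDeriv 3 u x)
    (hφ : φ ∈ periodicSplines (e + 3) N) :
    |h1Inner G φ + chForm U U φ| ≤
      (2 * ε + 6 * V * ε + 9 / 2 * ε ^ 2) * (1 / N) ^ (e + 3) * Real.sqrt (h1Inner φ φ) := by
  have hW := perW2_of_mem_periodicSplines hN hφ
  have hV := hu.nonneg
  have hN0 : (0 : ℝ) < N := by exact_mod_cast hN
  have hh0 : (0 : ℝ) ≤ 1 / N := by positivity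
  have hh1 : (1 : ℝ) / N ≤ 1 := (div_le_one hN0).2 (by exact_mod_cast hN)
  have hε : 0 ≤ ε := by
    obtain ⟨x, hx⟩ := hU.deriv_two_le.exists
    exact (abs_nonneg _).trans hx
  have h1 := hG.abs_h1Inner_sub_le (k := 2) hg hN hφ
  have h2 := abs_chForm_sub_le_of_perturbation (IsSmoothBdd.perW2 (k := 2) hu) hU.perW2 hW hu.abs_le
    (.of_forall (hu.bound 2 (by omega))) hU.sub_le hU.deriv_sub_le hU.deriv_two_le
  have h3 := hU.integral_deriv_le φ hφ u V (hu.mono (by omega))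
  have h4 := h1Inner_add_chForm_eq_zero hg hu hW h
  have hn := l2Norm_deriv_le_sqrt_h1Inner φ
  set S := Real.sqrt (h1Inner φ φ)
  have hS : 0 ≤ S := Real.sqrt_nonneg _
  set p := (1 / N : ℝ) ^ (e + 3) with hp
  have hp0 : 0 ≤ p := by positivity
  set q := (1 / N : ℝ) ^ (e + 2) with hq
  have hq0 : 0 ≤ q := by positivity
  have hq1 : q ≤ 1 := pow_le_one₀ hh0 hh1
  -- The term quadratic in the derivative error has order 2 (e + 2) ≥ e + 3.
  have hqp : q ^ 2 ≤ p := by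
    rw [hq, hp, ← pow_mul]
    exact pow_le_pow_of_le_one hh0 hh1 (by omega)
  have h5 : ε * V * p * l2Norm (deriv φ) ≤ ε * V * p * S := by gcongr
  have h6 : ε * p * (ε * q) ≤ ε ^ 2 * p := by
    have : ε ^ 2 * p * q ≤ ε ^ 2 * p * 1 := by gcongr
    linarith
  have h7 : (ε * q) ^ 2 ≤ ε ^ 2 * p := by rw [mul_pow]; gcongr
  have h8 : 4 * V * (ε * p) + 3 * (ε * p) * (ε * q) + 1 / 2 * (ε * q) ^ 2 + (ε + V) * (ε * p) ≤
      (5 * V * ε + 9 / 2 * ε ^ 2) * p := by nlinarith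
  have h9 := mul_le_mul_of_nonneg_right h8 hS
  rw [abs_le] at h1 h2 ⊢
  constructor <;> linarith [h2.1, h2.2, h1.1, h1.2]

/-! ### The error estimate -/

theorem l2Norm_add_le {f g : ℝ → ℝ} (hf : IsBddMeas f) (hg : IsBddMeas g) :
    l2Norm (fun x => f x + g x) ≤ l2Norm f + l2Norm g := by
  refine abs_le_of_sq_le_sq' ?_ (add_nonneg (l2Norm_nonneg f) (l2Norm_nonneg g)) |>.2
  have h := (le_abs_self _).trans (abs_l2Inner_le hf hg)
  rw [l2Norm_sq, l2Inner_add_left hf hg (hf.add hg), l2Inner_add_right hf hg hf, l2Inner_add_right hf hg hg,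
    l2Inner_comm g f, add_sq, l2Norm_sq, l2Norm_sq]
  linarith

theorem hasDerivWithinAt_of_pointwise {e N : ℕ} [NeZero N] {α : ℝ → SplineSpace e N} {v : SplineSpace e N}
    {s : Set ℝ} {t : ℝ} (hs : UniqueDiffWithinAt ℝ s t)
    (h : ∀ x, HasDerivWithinAt (fun τ => α τ x) (v x) s t) : HasDerivWithinAt α v s t := by
  obtain ⟨w, hw⟩ := exists_hasDerivWithinAt_of_pointwise (SplineSpace.incl e N) SplineSpace.incl_injective hs
    fun x => (h x).differentiableWithinAt
  have : w = v := SplineSpace.incl_injective (funext fun x =>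
    hs.eq_deriv _ (SplineSpace.hasDerivWithinAt_apply hw x) (h x))
  rwa [← this]

/-- Stability of the semidiscretization: an approximate solution with bounded second derivatives is
close to the exact one. -/
theorem galerkin_norm_sub_sq_le {e N : ℕ} [NeZero N] {T B ε : ℝ} {α U U' : ℝ → SplineSpace e N}
    (hB : 0 ≤ B) (hα : ∀ t ∈ Icc 0 T, HasDerivWithinAt α (SplineSpace.chOp e N (α t) (α t)) (Icc 0 T) t)
    (hU : ∀ t ∈ Icc 0 T, HasDerivWithinAt U (U' t) (Icc 0 T) t)
    (h0 : ∀ t ∈ Icc 0 T, ∀ x, |U t x| ≤ B) (h1 : ∀ t ∈ Icc 0 T, ∀ x, |deriv (U t) x| ≤ B)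
    (h2 : ∀ t ∈ Icc 0 T, ∀ᵐ x, |iteratedDeriv 2 (U t) x| ≤ B)
    (hε : ∀ t ∈ Icc 0 T, ∀ φ : SplineSpace e N, |h1Inner (U' t) φ + chForm (U t) (U t) φ| ≤ ε * ‖φ‖) :
    ∀ t ∈ Icc 0 T, ‖α t - U t‖ ^ 2 ≤
      Real.exp ((2 * (15 / 2 * B) + 1) * T) * (‖α 0 - U 0‖ ^ 2 + ε ^ 2 * T) := by
  refine norm_sub_sq_le_of_inner_le (by positivity) hα hU fun t ht => ?_
  have s1 := abs_chForm_sub_le (α t).perW2 (U t).perW2 (h0 t ht) (h1 t ht) (h2 t ht)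
  rw [← SplineSpace.incl_sub, ← SplineSpace.inner_eq, real_inner_self_eq_norm_sq] at s1
  have s2 := hε t ht (α t - U t)
  rw [← SplineSpace.inner_eq] at s2
  rw [real_inner_comm, inner_sub_left, SplineSpace.inner_chOp]
  rw [abs_le] at s1 s2
  linarith [s1.1, s2.1]

theorem hasDerivWithinAt_quasiInterpolant {r N : ℕ} {c : ℤ →₀ ℝ} {u g : ℝ → ℝ → ℝ} {s : Set ℝ} {t : ℝ}
    (h : ∀ x, HasDerivWithinAt (fun τ => u τ x) (g t x) s t) (x : ℝ) :
    HasDerivWithinAt (fun τ => quasiInterpolant r c N (u τ) x) (quasiInterpolant r c N (g t) x) s t :=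
  HasDerivWithinAt.fun_sum fun _ _ => (h _).mul_const _

theorem quasiInterpolant_mem {e N : ℕ} (hN : 1 ≤ N) (c : ℤ →₀ ℝ) {v : ℝ → ℝ} (hv : Function.Periodic v 1) :
    quasiInterpolant (e + 3) c N v ∈ periodicSplines (e + 3) N := by
  rw [quasiInterpolant_eq_quasiOp hN c hv]
  exact quasiOp_mem_periodicSplines hN c hv

/-- Convergence of the semidiscretization for initial values that are close to the
quasi-interpolant. -/
theorem exists_uniquelySolvableWithError {e : ℕ} {c : ℤ →₀ ℝ} (hc : IsThomeeWendroff (e + 3) c) {T : ℝ}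
    {u : ℝ → ℝ → ℝ} (hT : 0 < T) (hu : IsPeriodicRCHSolution (e + 7) T u) (D : ℝ) :
    ∃ C : ℝ, ∀ (N : ℕ) [NeZero N] (w₀ : SplineSpace e N),
      (∀ U₀ : SplineSpace e N, SplineSpace.incl e N U₀ = quasiInterpolant (e + 3) c N (u 0) →
        ‖w₀ - U₀‖ ≤ D * (1 / N) ^ (e + 3)) →
      UniquelySolvableWithError (e + 3) N T u w₀ (C * (1 / (N : ℝ)) ^ (e + 3)) := by
  classical
  -- The approximation bounds take e + 6 derivatives, and they are applied to u_t as well as to u.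
  have hs : ContDiffOn ℝ (e + 6 + 1 : ℕ) (Function.uncurry u) (Icc 0 T ×ˢ univ) := by
    exact_mod_cast hu.smooth
  obtain ⟨V₁, hV₁⟩ := exists_isSmoothBdd hT (hs.of_le (by norm_cast; omega) :
    ContDiffOn ℝ (e + 6 : ℕ) (Function.uncurry u) _) hu.periodic
  obtain ⟨V₂, hV₂⟩ := exists_isSmoothBdd hT (contDiffOn_timeDeriv hT hs) fun t ht =>
    periodic_timeDeriv hu.periodic ht
  obtain ⟨V, hVu, hVg⟩ : ∃ V, (∀ t ∈ Icc 0 T, IsSmoothBdd (e + 6) V (u t)) ∧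
      ∀ t ∈ Icc 0 T, IsSmoothBdd (e + 6) V (timeDeriv T u t) :=
    ⟨max V₁ V₂, fun t ht => ⟨(hV₁ t ht).1, (hV₁ t ht).2, fun j hj x =>
      ((hV₁ t ht).3 j hj x).trans (le_max_left _ _)⟩, fun t ht => ⟨(hV₂ t ht).1, (hV₂ t ht).2, fun j hj x =>
      ((hV₂ t ht).3 j hj x).trans (le_max_right _ _)⟩⟩
  have hT0 : (0 : ℝ) ∈ Icc 0 T := ⟨le_rfl, hT.le⟩
  have hV0 := (hVu 0 hT0).nonneg
  obtain ⟨C, hC0, hC⟩ := hc.exists_isOptimalApprox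
  set ε := C * V with hε
  have hε0 : 0 ≤ ε := by positivity
  set K := 2 * ε + 6 * V * ε + 9 / 2 * ε ^ 2 with hK
  set B := V + ε with hB
  have hB0 : 0 ≤ B := by positivity
  set A := Real.exp ((2 * (15 / 2 * B) + 1) * T) * (D ^ 2 + K ^ 2 * T) with hA
  refine ⟨Real.sqrt A + ε, fun N _ w₀ hw₀ => ?_⟩
  have hN : 1 ≤ N := NeZero.one_le
  have hN0 : (0 : ℝ) < N := by exact_mod_cast hN
  have hh0 : (0 : ℝ) ≤ 1 / N := by positivity
  have hh1 : (1 : ℝ) / N ≤ 1 := (div_le_one hN0).2 (by exact_mod_cast hN)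
  obtain ⟨α, hα0, hα, hsol, huniq⟩ := exists_galerkin_curve hT w₀
  refine ⟨_, hsol, huniq, ?_⟩
  set Q : (ℝ → ℝ → ℝ) → ℝ → SplineSpace e N := fun f t =>
    if h : Function.Periodic (f t) 1 then SplineSpace.ofMem (quasiInterpolant_mem hN c h) else 0 with hQ
  have hQe : ∀ f t, Function.Periodic (f t) 1 →
      SplineSpace.incl e N (Q f t) = quasiInterpolant (e + 3) c N (f t) := fun f t h => by
    simp only [hQ, dif_pos h, SplineSpace.incl_ofMem]
  have hQu : ∀ t ∈ Icc 0 T, IsOptimalApprox e N ε (u t) (Q u t) := fun t ht => by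
    rw [hQe u t (hu.periodic t ht)]
    exact hC N _ V hN (hVu t ht)
  have hQg : ∀ t ∈ Icc 0 T, IsOptimalApprox e N ε (timeDeriv T u t) (Q (timeDeriv T u) t) := fun t ht => by
    rw [hQe _ t (hVg t ht).periodic]
    exact hC N _ V hN (hVg t ht)
  -- The quasi-interpolant samples at fixed nodes, hence commutes with differentiation in time.
  have hQd : ∀ t ∈ Icc 0 T, HasDerivWithinAt (Q u) (Q (timeDeriv T u) t) (Icc 0 T) t := fun t ht => by
    refine hasDerivWithinAt_of_pointwise (uniqueDiffOn_Icc hT t ht) fun x => ?_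
    rw [hQe _ t (hVg t ht).periodic]
    refine (hasDerivWithinAt_quasiInterpolant (fun x => hasDerivWithinAt_timeDeriv hs ht x) x).congr
      (fun τ hτ => ?_) ?_
    · rw [hQe u τ (hu.periodic τ hτ)]
    · rw [hQe u t (hu.periodic t ht)]
  have hpow : ∀ k : ℕ, ε * (1 / N : ℝ) ^ k ≤ ε := fun k => mul_le_of_le_one_right hε0 (pow_le_one₀ hh0 hh1)
  have key := galerkin_norm_sub_sq_le (ε := K * (1 / N) ^ (e + 3)) hB0 hα hQd
    (fun t ht x => by
      have a := (hQu t ht).sub_le x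
      have b := (hVu t ht).abs_le x
      have d := hpow (e + 3)
      rw [abs_le] at *
      constructor <;> linarith)
    (fun t ht x => by
      have a := (hQu t ht).deriv_sub_le x
      have b := (hVu t ht).abs_deriv_le (by omega) x
      have d := hpow (e + 2)
      rw [abs_le] at *
      constructor <;> linarith)
    (fun t ht => (hQu t ht).deriv_two_le.mono fun x hx => hx.trans (by linarith))
    (fun t ht φ => by
      rw [SplineSpace.norm_eq]
      exact (hQu t ht).abs_truncation_le (hQg t ht) ((hVu t ht).mono (by omega)) ((hVg t ht).mono (by omega)) hN
        (hu.equation t ht) φ.mem)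
  intro t ht
  have h1 : ‖α t - Q u t‖ ≤ Real.sqrt A * (1 / N) ^ (e + 3) := by
    refine abs_le_of_sq_le_sq' ((key t ht).trans ?_) (by positivity) |>.2
    have hi := hw₀ (Q u 0) (hQe u 0 (hu.periodic 0 hT0))
    rw [hα0, mul_pow (Real.sqrt A), Real.sq_sqrt (by positivity), hA, mul_assoc]
    gcongr
    calc ‖w₀ - Q u 0‖ ^ 2 + (K * (1 / N : ℝ) ^ (e + 3)) ^ 2 * T
        ≤ (D * (1 / N : ℝ) ^ (e + 3)) ^ 2 + (K * (1 / N : ℝ) ^ (e + 3)) ^ 2 * T := by gcongr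
      _ = _ := by ring
  have h2 : l2Norm (fun x => Q u t x - α t x) ≤ Real.sqrt A * (1 / N) ^ (e + 3) := by
    rw [← norm_sub_rev, SplineSpace.norm_eq] at h1
    exact (l2Norm_le_sqrt_h1Inner _).trans h1
  have hub := (hVu t ht).bddMeas
  have h3 : l2Norm (fun x => u t x - Q u t x) ≤ ε * (1 / N) ^ (e + 3) :=
    l2Norm_le_of_ae_le (by positivity) (.of_forall fun x => by rw [abs_sub_comm]; exact (hQu t ht).sub_le x)
  have h4 := l2Norm_add_le (hub.sub (Q u t).perW2.bddMeas) ((Q u t).perW2.bddMeas.sub (α t).perW2.bddMeas)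
  simp only [sub_add_sub_cancel] at h4
  linarith

/-- The elliptic projection onto the splines exists, is unique and is close to any optimal
approximation in the space of splines. -/
theorem exists_h1Projection {e N : ℕ} [NeZero N] {k : ℕ} {V : ℝ} {f : ℝ → ℝ} (hf : IsSmoothBdd (k + 2) V f) :
    ∃ v : SplineSpace e N, IsH1Projection (e + 3) N f v ∧
      (∀ v', IsH1Projection (e + 3) N f v' → v' = v) ∧
      ∀ (U : SplineSpace e N) (ε : ℝ), IsOptimalApprox e N ε f U → ‖v - U‖ ≤ 2 * ε * (1 / N) ^ (e + 3) := by
  have hfW := hf.perW2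
  let F : SplineSpace e N →ₗ[ℝ] ℝ :=
    { toFun := fun φ => h1Inner f φ
      map_add' := fun a b => by
        rw [SplineSpace.incl_add, h1Inner_comm, h1Inner_add_left a.perW2 b.perW2 hfW, h1Inner_comm _ f,
          h1Inner_comm _ f]
      map_smul' := fun c a => by
        rw [SplineSpace.incl_smul, h1Inner_comm, h1Inner_const_mul_left c a.perW2, h1Inner_comm _ f]; rfl }
  set v := (InnerProductSpace.toDual ℝ (SplineSpace e N)).symm (LinearMap.toContinuousLinearMap F)
  have hv : ∀ φ : SplineSpace e N, inner ℝ v φ = h1Inner f φ := fun φ => InnerProductSpace.toDual_symm_apply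
  refine ⟨v, ⟨v.mem, fun φ hφ => hv (SplineSpace.ofMem hφ)⟩, fun v' hv' => ?_, fun U ε hU => ?_⟩
  · have : SplineSpace.ofMem hv'.1 = v := ext_inner_right ℝ fun φ => by
      rw [hv, SplineSpace.inner_eq]
      exact hv'.2 φ φ.mem
    rw [← this, SplineSpace.incl_ofMem]
  -- By orthogonality ‖v - U‖² = A(f - U, v - U), to which the superconvergent bound applies with v
  -- - U as test function.
  · have h1 := hU.abs_h1Inner_sub_le hf NeZero.one_le (v - U).mem
    rw [← SplineSpace.norm_eq, ← hv, ← SplineSpace.inner_eq, abs_sub_comm, ← inner_sub_left,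
      real_inner_self_eq_norm_sq, abs_of_nonneg (sq_nonneg _)] at h1
    have hε : 0 ≤ ε * (1 / N : ℝ) ^ (e + 3) := (abs_nonneg _).trans (hU.sub_le 0)
    rcases (norm_nonneg (v - U)).eq_or_lt with h0 | h0
    · rw [← h0]; linarith
    · rw [sq] at h1
      exact le_of_mul_le_mul_right h1 h0

end

theorem mainTheorem1 (r : ℕ) (hr : 3 ≤ r) :
    (∃ c : ℤ →₀ ℝ, IsThomeeWendroff r c) ∧
    ∃ M : ℕ, ∀ (T : ℝ) (u : ℝ → ℝ → ℝ), 0 < T → IsPeriodicRCHSolution M T u →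
      (∀ c : ℤ →₀ ℝ, IsThomeeWendroff r c →
        ∃ C h₀ : ℝ, 0 < h₀ ∧ ∀ N : ℕ, 1 ≤ N → 1 / (N : ℝ) ≤ h₀ →
          UniquelySolvableWithError r N T u (quasiInterpolant r c N (u 0))
            (C * (1 / (N : ℝ)) ^ r)) ∧
      (∃ C h₀ : ℝ, 0 < h₀ ∧ ∀ N : ℕ, 1 ≤ N → 1 / (N : ℝ) ≤ h₀ →
        ∃ v : ℝ → ℝ, IsH1Projection r N (u 0) v ∧
          (∀ v', IsH1Projection r N (u 0) v' → v' = v) ∧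
          UniquelySolvableWithError r N T u v (C * (1 / (N : ℝ)) ^ r)) := by
  obtain ⟨e, rfl⟩ := Nat.exists_eq_add_of_le' hr
  obtain ⟨c₀, hc₀⟩ := exists_isThomeeWendroff (e + 2)
  refine ⟨⟨c₀, hc₀⟩, e + 7, fun T u hT hu => ⟨fun c hc => ?_, ?_⟩⟩
  -- D = 0: the initial value is the quasi-interpolant itself.
  · obtain ⟨C, hC⟩ := exists_uniquelySolvableWithError hc hT hu 0
    refine ⟨C, 1, one_pos, fun N hN _ => ?_⟩
    have : NeZero N := ⟨by omega⟩
    have h := hC N (SplineSpace.ofMem (quasiInterpolant_mem hN c (hu.periodic 0 ⟨le_rfl, hT.le⟩))) fun U₀ hU₀ => by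
      rw [zero_mul, norm_le_zero_iff, sub_eq_zero]
      exact SplineSpace.incl_injective hU₀.symm
    exact h
  · have hs : ContDiffOn ℝ (e + 6 : ℕ) (Function.uncurry u) (Set.Icc 0 T ×ˢ Set.univ) :=
      hu.smooth.of_le (by norm_cast; omega)
    obtain ⟨V, hV⟩ := exists_isSmoothBdd hT hs hu.periodic
    have hV0 := hV 0 ⟨le_rfl, hT.le⟩
    obtain ⟨D, -, hD⟩ := hc₀.exists_isOptimalApprox
    -- No kernel occurs in this part; c₀ only supplies the comparison function, from which the
    -- projection of the initial value differs by at most 2 D V h^r in H¹.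
    obtain ⟨C, hC⟩ := exists_uniquelySolvableWithError hc₀ hT hu (2 * (D * V))
    refine ⟨C, 1, one_pos, fun N hN _ => ?_⟩
    have : NeZero N := ⟨by omega⟩
    obtain ⟨v, hv, hv', hvU⟩ := exists_h1Projection (e := e) (N := N) (k := e + 4) hV0
    refine ⟨v, hv, hv', hC N v fun U₀ hU₀ => hvU U₀ _ ?_⟩
    rw [hU₀]
    exact hD N _ V hN hV0
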